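/- **Setting.** Let $D\subset\mathbb R^3$ be a nonempty bounded open set with $C^2$ boundary $\Gamma=\partial D$ (a closed $C^2$ surface), let $d$ be the signed distance to $\Gamma$ (negative in $D$) and $\mathbf n=\nabla d$: on $\Gamma$ this is the outward unit normal, near $\Gamma$ its extension that is constant along normals. Put $\mathbf P=\mathbf I-\mathbf n\mathbf n^T$, $\nabla_\Gamma\mathbf u=\mathbf P\nabla\mathbf u\,\mathbf P$, $\operatorname{div}_\Gamma\mathbf u=\operatorname{tr}\nabla_\Gamma\mathbf u$, $E_s(\mathbf u)=\frac12(\nabla_\Gamma\mathbf u+(\nabla_\Gamma\mathbf u)^T)$, $u_N=\mathbf u\cdot\mathbf n$, $\mathbf u_T=\mathbf u-u_N\mathbf n$. Let $\Omega\supset\Gamma$ be a bounded open set and let $\mathcal T_h$ be a finite conforming triangulation of $\overline\Omega$ into (closed) tetrahedra. Let $\mathcal T_h^\Gamma=\{T\in\mathcal T_h: T\cap\Gamma\ne\emptyset\}$, $h_T=\operatorname{diam}T$, $h=\max_{T\in\mathcal T_h^\Gamma}h_T$, $\Omega_h^\Gamma=\operatorname{int}\bigcup_{T\in\mathcal T_h^\Gamma}T$,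 and, for $\hat c>0$, let $\mathcal T^\Gamma_{\rm reg}=\{T\in\mathcal T_h^\Gamma:|\Gamma\cap T|\ge\hat c\,h_T^2\}$ (the regular elements). For $k\ge1$ let $V_h^k$ be the space of continuous functions on $\Omega_h^\Gamma$ that are polynomials of degree at most $k$ on each $T\in\mathcal T_h^\Gamma$, $\mathbf U_h=(V_h^{k+1})^3$ and $Q_h=\{q\in V_h^k:\int_\Gamma q\,ds=0\}$. With $\tau=c_\tau h^{-2}$, $\rho_p=c_ph$, $\rho_u\in[c_uh,C_uh^{-1}]$ let $$\|\mathbf v\|_A^2=\int_\Gamma\big(2E_s(\mathbf v):E_s(\mathbf v)+\mathbf v\cdot\mathbf v+\tau v_N^2\big)\,ds+\rho_u\int_{\Omega_h^\Gamma}|(\nabla\mathbf v)\mathbf n|^2\,dx,$$ $$b_T(\mathbf v,q)=-\int_\Gamma q\,\operatorname{div}_\Gamma\mathbf v_T\,ds,\qquad s_h(q,q)=\rho_p\int_{\Omega_h^\Gamma}(\mathbf n\cdot\nabla q)^2\,dx,$$ $$\|q\|_{1,h}^2=\sum_{T\in\mathcal T_h^\Gamma}h_T\|\nabla q\|_{L^2(T)}^2,\qquad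 \|q\|_{1,\rm reg}^2=\sum_{T\in\mathcal T_{\rm reg}^\Gamma}h_T\|\nabla q\|_{L^2(T)}^2 .$$ **Statement.** For every $\sigma>0$ there is $\hat c_0>0$, depending only on $\sigma$, such that for every $\hat c\in(0,\hat c_0]$, all $D$, $\Omega$ as above, every $k\ge1$, all real numbers $C_{qu},C_{res}$, and all $c_\tau,c_p,c_u,C_u>0$ there is $h_0>0$ with the following property. Take any family of triangulations $\mathcal T_h$ of $\overline\Omega$, each with a parameter $\rho_u\in[c_uh,C_uh^{-1}]$, such that every member satisfies $h\le h_0$ and - shape regularity: each $T\in\mathcal T_h$ contains a ball of radius $h_T/\sigma$; - quasi-uniformity: $h\le C_{qu}h_T$ for all $T\in\mathcal T_h^\Gamma$; - for all $T\in\mathcal T_h^\Gamma$ the set $T\cap\Gamma$ is simply connected and the length of $\partial T\cap\Gamma$ is at most $C_{res}h_T$. Then the following two conditions are equivalent: - (LBB2) there is a constant $c>0$ such that, for every member of the family, $$\|q\|_{1,h}\le c\Big(\sup_{\mathbf v\in\mathbf U_h}\frac{b_T(\mathbf v,q)}{\|\mathbf v\|_A}+s_h(q,q)^{1/2}\Big)\quad\text{for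 all }q\in Q_h;$$ - (LBB3) there is a constant $c>0$ such that, for every member of the family, $$\|q\|_{1,\rm reg}\le c\Big(\sup_{\mathbf v\in\mathbf U_h}\frac{b_T(\mathbf v,q)}{\|\mathbf v\|_A}+s_h(q,q)^{1/2}\Big)\quad\text{for all }q\in Q_h.$$ -/

import Mathlib

open MeasureTheory Topology

namespace TraceFEM

noncomputable section

/-- Three-dimensional Euclidean space. -/
abbrev E3 : Type := EuclideanSpace ℝ (Fin 3)

/-! ### The surface -/

/-- `D` is a nonempty bounded open set with boundary of class `C²`: near each boundary point, `D` is
the sublevel set `{φ < 0}` of a `C²` function `φ` with nonvanishing derivative. The closed surfaces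
`Γ` under consideration are the boundaries `frontier D` of such sets. -/
structure IsC2Domain (D : Set E3) : Prop where
  isOpen : IsOpen D
  isBounded : Bornology.IsBounded D
  nonempty : D.Nonempty
  exists_local : ∀ x ∈ frontier D, ∃ φ : E3 → ℝ, ContDiffAt ℝ 2 φ x ∧ fderiv ℝ φ x ≠ 0 ∧
    ∀ᶠ y in 𝓝 x, (y ∈ D ↔ φ y < 0)

open Classical in
/-- Signed distance to `Γ = frontier D`, negative in `D`. -/
def bdrySignedDist (D : Set E3) (x : E3) : ℝ :=
  if x ∈ D then -Metric.infDist x (frontier D) else Metric.infDist x (frontier D)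

/-- The gradient of the signed distance. On `Γ = frontier D` this is the outward unit normal, and in
a small neighbourhood of `Γ` it is the extension of the normal that is constant along normals. -/
def normal (D : Set E3) (x : E3) : E3 := gradient (bdrySignedDist D) x

/-- Surface (two-dimensional Hausdorff) measure on `Γ = frontier D`. -/
def surf (D : Set E3) : Measure E3 := (μHE[2]).restrict (frontier D)

/-! ### Tangential calculus -/

/-- The tangential projection `P = I - n nᵀ`. -/
def tproj (D : Set E3) (x : E3) : Matrix (Fin 3) (Fin 3) ℝ :=
  1 - Matrix.vecMulVec (normal D x).ofLp (normal D x).ofLp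

/-- The Jacobian matrix `(∇u)ᵢⱼ = ∂ⱼuᵢ`. -/
def jac (u : E3 → E3) (x : E3) : Matrix (Fin 3) (Fin 3) ℝ :=
  Matrix.of fun i j => fderiv ℝ u x (EuclideanSpace.single j 1) i

/-- Covariant derivative `∇_Γ u = P ∇u P`. -/
def covGrad (D : Set E3) (u : E3 → E3) (x : E3) : Matrix (Fin 3) (Fin 3) ℝ :=
  tproj D x * jac u x * tproj D x

/-- Surface divergence `tr (∇_Γ u)`. -/
def surfDiv (D : Set E3) (u : E3 → E3) (x : E3) : ℝ := (covGrad D u x).trace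

/-- Surface rate-of-strain tensor `E_s(u) = ½ (∇_Γ u + (∇_Γ u)ᵀ)`. -/
def strain (D : Set E3) (u : E3 → E3) (x : E3) : Matrix (Fin 3) (Fin 3) ℝ :=
  (1 / 2 : ℝ) • (covGrad D u x + (covGrad D u x).transpose)

/-- Normal component `u_N = u · n`. -/
def normalPart (D : Set E3) (u : E3 → E3) (x : E3) : ℝ := inner ℝ (u x) (normal D x)

/-- Tangential part `u_T = u - u_N n`. -/
def tangPart (D : Set E3) (u : E3 → E3) (x : E3) : E3 := u x - normalPart D u x • normal D x

/-! ### Meshes -/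

/-- The (closed) tetrahedron with vertex set `T`. -/
def cell (T : Finset E3) : Set E3 := convexHull ℝ (T : Set E3)

/-- The diameter `h_T`. -/
def diam (T : Finset E3) : ℝ := Metric.diam (cell T)

/-- A (finite, conforming) tetrahedral triangulation of `Ω`: a simplicial complex consisting of the
tetrahedra in `tets` and their faces, whose tetrahedra cover exactly the closure of `Ω`. -/
structure Triangulation (Ω : Set E3) where
  complex : Geometry.SimplicialComplex ℝ E3
  tets : Finset (Finset E3)
  mem_tets : ∀ T, T ∈ tets ↔ T ∈ complex.faces ∧ T.card = 4
  exists_tet : ∀ S ∈ complex.faces, ∃ T ∈ tets, S ⊆ T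
  cover : ⋃ T ∈ tets, cell T = closure Ω

variable {Ω : Set E3}

open Classical in
/-- The active mesh: the tetrahedra that intersect `Γ = frontier D`. -/
def active (D : Set E3) (M : Triangulation Ω) : Finset (Finset E3) :=
  M.tets.filter fun T => (frontier D ∩ cell T).Nonempty

/-- The mesh size `h`, the largest diameter of an active tetrahedron. -/
def meshSize (D : Set E3) (M : Triangulation Ω) : ℝ :=
  sSup (diam '' (active D M : Set (Finset E3)))

/-- The domain formed by the active tetrahedra. -/
def activeDomain (D : Set E3) (M : Triangulation Ω) : Set E3 :=
  interior (⋃ T ∈ active D M, cell T)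

open Classical in
/-- The regular elements: active tetrahedra `T` with `|Γ ∩ T| ≥ ĉ h_T²`. -/
def regular (D : Set E3) (chat : ℝ) (M : Triangulation Ω) : Finset (Finset E3) :=
  (active D M).filter fun T => ENNReal.ofReal (chat * diam T ^ 2) ≤ μHE[2] (frontier D ∩ cell T)

/-- Shape regularity with constant `σ`: each tetrahedron contains a ball of radius `h_T / σ`. -/
def ShapeRegular (σ : ℝ) (M : Triangulation Ω) : Prop :=
  ∀ T ∈ M.tets, ∃ x, Metric.closedBall x (diam T / σ) ⊆ cell T

/-- Quasi-uniformity of the active mesh with constant `C`. -/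
def QuasiUniform (D : Set E3) (C : ℝ) (M : Triangulation Ω) : Prop :=
  ∀ T ∈ active D M, meshSize D M ≤ C * diam T

/-- The active mesh resolves `Γ`: for each active `T`, the set `T ∩ Γ` is simply connected and the
curve `∂T ∩ Γ` has length at most `C h_T`. -/
def Resolves (D : Set E3) (C : ℝ) (M : Triangulation Ω) : Prop :=
  ∀ T ∈ active D M, IsSimplyConnected (cell T ∩ frontier D) ∧
    μHE[1] (frontier (cell T) ∩ frontier D) ≤ ENNReal.ofReal (C * diam T)

/-! ### Finite element spaces

Functions on the active domain are represented by functions on the whole space; their values outside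
the active domain play no role. -/

/-- `V_h^k`: continuous functions on the active domain that are polynomials of degree at most `k` on
each active tetrahedron. -/
def IsFE (D : Set E3) (M : Triangulation Ω) (k : ℕ) (v : E3 → ℝ) : Prop :=
  ContinuousOn v (activeDomain D M) ∧
  ∀ T ∈ active D M, ∃ p : MvPolynomial (Fin 3) ℝ, p.totalDegree ≤ k ∧
    ∀ x ∈ cell T ∩ activeDomain D M, v x = MvPolynomial.eval x.ofLp p

/-- The velocity space `U_h = (V_h^{k+1})³`. -/
def velocitySpace (D : Set E3) (M : Triangulation Ω) (k : ℕ) : Set (E3 → E3) :=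
  {v | ∀ i : Fin 3, IsFE D M (k + 1) fun x => v x i}

/-- The pressure space `Q_h = V_h^k ∩ L²₀(Γ)`. -/
def pressureSpace (D : Set E3) (M : Triangulation Ω) (k : ℕ) : Set (E3 → ℝ) :=
  {q | IsFE D M k q ∧ ∫ x, q x ∂(surf D) = 0}

/-! ### Bilinear forms and norms -/

/-- The form `A_h` with penalty parameter `τ = cτ h⁻²` and stabilization parameter `ρᵤ`. -/
def formA (D : Set E3) (M : Triangulation Ω) (cτ ρu : ℝ) (u v : E3 → E3) : ℝ :=
  (∫ x, (2 * (strain D u x * (strain D v x).transpose).trace + inner ℝ (u x) (v x)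
      + cτ * (meshSize D M ^ 2)⁻¹ * (normalPart D u x * normalPart D v x)) ∂(surf D))
  + ρu * ∫ x in activeDomain D M,
      inner ℝ (fderiv ℝ u x (normal D x)) (fderiv ℝ v x (normal D x))

/-- The norm `‖v‖_A = A_h(v, v)^{1/2}`. -/
def normA (D : Set E3) (M : Triangulation Ω) (cτ ρu : ℝ) (v : E3 → E3) : ℝ :=
  Real.sqrt (formA D M cτ ρu v v)

/-- The form `b_T(v, q) = -∫_Γ q div_Γ v_T`. -/
def formB (D : Set E3) (v : E3 → E3) (q : E3 → ℝ) : ℝ :=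
  -∫ x, q x * surfDiv D (tangPart D v) x ∂(surf D)

/-- The form `s_h` with stabilization parameter `ρₚ = cp h`. -/
def formS (D : Set E3) (M : Triangulation Ω) (cp : ℝ) (p q : E3 → ℝ) : ℝ :=
  cp * meshSize D M * ∫ x in activeDomain D M,
    inner ℝ (normal D x) (gradient p x) * inner ℝ (normal D x) (gradient q x)

/-- `(∑_{T ∈ S} h_T ‖∇q‖²_{L²(T)})^{1/2}` for a finite set `S` of tetrahedra. -/
def gradNorm (S : Finset (Finset E3)) (q : E3 → ℝ) : ℝ :=
  Real.sqrt (∑ T ∈ S, diam T * ∫ x in cell T, ‖gradient q x‖ ^ 2)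

/-- The norm `‖q‖_{1,h}`. -/
def normOneH (D : Set E3) (M : Triangulation Ω) (q : E3 → ℝ) : ℝ := gradNorm (active D M) q

/-- The seminorm `‖q‖_{1,reg}`. -/
def normOneReg (D : Set E3) (chat : ℝ) (M : Triangulation Ω) (q : E3 → ℝ) : ℝ :=
  gradNorm (regular D chat M) q

/-- The set of quotients `b_T(v, q) / ‖v‖_A`, `v ∈ U_h`. (Where `‖v‖_A = 0` also `b_T(v, q) = 0`, and
the quotient is read as `0`; this does not change the supremum, which is nonnegative because `U_h` is
symmetric.) -/
def quotients (D : Set E3) (M : Triangulation Ω) (k : ℕ) (cτ ρu : ℝ) (q : E3 → ℝ) : Set ℝ :=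
  (fun v => formB D v q / normA D M cτ ρu v) '' velocitySpace D M k

/-- (LBB2) on one mesh with constant `c`:
`‖q‖_{1,h} ≤ c (sup_v b_T(v,q)/‖v‖_A + s_h(q,q)^{1/2})` for all `q ∈ Q_h`. -/
def LBB2 (D : Set E3) (M : Triangulation Ω) (k : ℕ) (cτ cp ρu c : ℝ) : Prop :=
  ∀ q ∈ pressureSpace D M k, ∃ S : ℝ, IsLUB (quotients D M k cτ ρu q) S ∧
    normOneH D M q ≤ c * (S + Real.sqrt (formS D M cp q q))

/-- (LBB3) on one mesh with constant `c`:
`‖q‖_{1,reg} ≤ c (sup_v b_T(v,q)/‖v‖_A + s_h(q,q)^{1/2})` for all `q ∈ Q_h`. -/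
def LBB3 (D : Set E3) (chat : ℝ) (M : Triangulation Ω) (k : ℕ) (cτ cp ρu c : ℝ) : Prop :=
  ∀ q ∈ pressureSpace D M k, ∃ S : ℝ, IsLUB (quotients D M k cτ ρu q) S ∧
    normOneReg D chat M q ≤ c * (S + Real.sqrt (formS D M cp q q))

end

end TraceFEM

namespace TraceFEM

/-! ### Polynomials on `E3` -/

/-! One implication is immediate because regular elements are active. The other rests on a
velocity-free bound, valid on fine meshes (`exists_gradient_estimate`): the squared norm of the
gradient over all active elements is at most a constant times its part on the regular elements plus
`h ∫ (n·∇q)²`. The last term is a multiple of `s_h(q,q)`, so the supremum over velocities is carried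
along unchanged.

Geometry. At scale `h` the surface is almost a plane. If an active tetrahedron `T` reaches a
distance comparable to `h_T` on both sides of this plane, it cuts the surface in a large area and is
regular (`area_of_two_sided`). Otherwise `T` lies essentially on one side. Then some face `S` of
`T`, possibly a vertex or an edge, is close to the surface and contains a point on it or beyond it.
Near the barycenter of `S` every tetrahedron contains `S` (`subset_of_mem_ball`), so columns that
start in `T` near that barycenter and run in the normal direction reach the surface while crossing
only active tetrahedra of one vertex star. The star has boundedly many members, so one of them,
`T'`, receives a fixed fraction of the columns. Projection along the columns does not increase area,
hence `T'` is regular (`exists_bundle_of_le`, `volume_le_of_columns`). All constants depend on `σ`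
alone, which fixes the threshold for `ĉ`.

Analysis. Along a column `q` changes by at most its length times a bound for the derivatives in the
column direction. So the polynomial pieces of `q` on `T` and `T'`, both extended to the columns,
differ there by little. The columns fill a set of volume comparable to `h³`, and a Remez inequality
(`exists_remez`) turns this into a bound for the difference of the gradients
(`exists_gradient_transfer`). Replacing the column direction by `n` costs a small multiple `δ` of
the full gradient on the neighbours. After summation over the mesh, with finite overlap and
comparable neighbouring diameters, this term is absorbed into the left-hand side; making `δ` small
is what forces `h ≤ h₀`. -/

/-- Evaluation of a polynomial in three variables at a point of `E3`. -/
noncomputable def polyEval (p : MvPolynomial (Fin 3) ℝ) (x : E3) : ℝ := MvPolynomial.eval x.ofLp p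

/-- The gradient of a polynomial. -/
noncomputable def polyGrad (p : MvPolynomial (Fin 3) ℝ) (x : E3) : E3 :=
  WithLp.toLp 2 fun i => polyEval (MvPolynomial.pderiv i p) x

/-- The derivative of a polynomial in the direction `ν`. -/
noncomputable def polyDir (ν : E3) (p : MvPolynomial (Fin 3) ℝ) : MvPolynomial (Fin 3) ℝ :=
  ∑ i, MvPolynomial.C (ν i) * MvPolynomial.pderiv i p

theorem polyEval_polyDir (ν : E3) (p : MvPolynomial (Fin 3) ℝ) (x : E3) :
    polyEval (polyDir ν p) x = inner ℝ ν (polyGrad p x) := by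
  simp [polyEval, polyDir, polyGrad, PiLp.inner_apply, Fin.sum_univ_three, mul_comm]

theorem continuous_polyEval (p : MvPolynomial (Fin 3) ℝ) : Continuous (polyEval p) := by
  unfold polyEval
  exact (MvPolynomial.continuous_eval p).comp (PiLp.continuous_ofLp 2 _)

theorem continuous_polyGrad (p : MvPolynomial (Fin 3) ℝ) : Continuous (polyGrad p) := by
  unfold polyGrad
  exact (PiLp.continuous_toLp 2 _).comp (continuous_pi fun i => continuous_polyEval _)

theorem totalDegree_pderiv_le (i : Fin 3) (p : MvPolynomial (Fin 3) ℝ) :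
    (MvPolynomial.pderiv i p).totalDegree ≤ p.totalDegree := by
  conv_lhs => rw [p.as_sum, map_sum]
  refine MvPolynomial.totalDegree_finsetSum_le fun α hα => ?_
  rw [MvPolynomial.pderiv_monomial]
  refine (MvPolynomial.totalDegree_monomial_le _ _).trans ?_
  refine le_trans ?_ (MvPolynomial.le_totalDegree hα)
  exact Finsupp.degree_mono tsub_le_self

theorem totalDegree_polyDir_le (ν : E3) (p : MvPolynomial (Fin 3) ℝ) :
    (polyDir ν p).totalDegree ≤ p.totalDegree := by
  refine MvPolynomial.totalDegree_finsetSum_le fun i _ => ?_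
  refine (MvPolynomial.totalDegree_mul _ _).trans ?_
  simpa using totalDegree_pderiv_le i p

theorem hasFDerivAt_polyEval (p : MvPolynomial (Fin 3) ℝ) (x : E3) :
    HasFDerivAt (polyEval p) (innerSL ℝ (polyGrad p x)) x := by
  induction p using MvPolynomial.induction_on with
  | C a =>
    have h1 : polyEval (MvPolynomial.C a) = fun _ => a := by ext; simp [polyEval]
    have h2 : polyGrad (MvPolynomial.C a) x = 0 := by ext; simp [polyGrad, polyEval]
    rw [h1, h2, map_zero]
    exact hasFDerivAt_const a x
  | add p q hp hq =>
    have h1 : polyEval (p + q) = polyEval p + polyEval q := by ext; simp [polyEval]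
    have h2 : polyGrad (p + q) x = polyGrad p x + polyGrad q x := by
      ext; simp [polyGrad, polyEval]
    rw [h1, h2, map_add]
    exact hp.add hq
  | mul_X p i hp =>
    have h1 : polyEval (p * MvPolynomial.X i) = fun y => polyEval p y * y i := by
      ext; simp [polyEval]
    have h2 : polyGrad (p * MvPolynomial.X i) x =
        polyEval p x • EuclideanSpace.single i 1 + x i • polyGrad p x := by
      ext j
      rcases eq_or_ne j i with rfl | hij
      · simp [polyGrad, polyEval]
      · simp [polyGrad, polyEval, hij, MvPolynomial.pderiv_X, Pi.single_apply, hij.symm]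
    rw [h1, h2]
    have h3 : HasFDerivAt (fun y : E3 => y i) (EuclideanSpace.proj i : E3 →L[ℝ] ℝ) x :=
      (EuclideanSpace.proj i : E3 →L[ℝ] ℝ).hasFDerivAt
    convert! hp.mul h3 using 1
    ext y
    simp [EuclideanSpace.inner_single_left]

theorem gradient_eq_polyGrad {q : E3 → ℝ} {p : MvPolynomial (Fin 3) ℝ} {x : E3}
    (h : q =ᶠ[𝓝 x] polyEval p) : gradient q x = polyGrad p x := by
  apply HasGradientAt.gradient
  rw [hasGradientAt_iff_hasFDerivAt]
  exact (hasFDerivAt_polyEval p x).congr_of_eventuallyEq h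

theorem exists_affine_subst {k : ℕ} (p : MvPolynomial (Fin 3) ℝ) (hp : p.totalDegree ≤ k)
    (a : E3) (h : ℝ) : ∃ q : MvPolynomial (Fin 3) ℝ, q.totalDegree ≤ k ∧
      ∀ y, polyEval q y = polyEval p (a + h • y) := by
  let f : Fin 3 → MvPolynomial (Fin 3) ℝ := fun i =>
    MvPolynomial.C (a i) + MvPolynomial.C h * MvPolynomial.X i
  have hf : ∀ i, (f i).totalDegree ≤ 1 := by
    intro i
    refine (MvPolynomial.totalDegree_add _ _).trans (max_le (by simp) ?_)
    refine (MvPolynomial.totalDegree_mul _ _).trans ?_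
    simp
  refine ⟨MvPolynomial.aeval f p, le_trans ?_ hp, fun y => ?_⟩
  · conv_lhs => rw [p.as_sum, map_sum]
    refine MvPolynomial.totalDegree_finsetSum_le fun α hα => ?_
    rw [MvPolynomial.aeval_monomial]
    refine (MvPolynomial.totalDegree_mul _ _).trans ?_
    rw [MvPolynomial.algebraMap_eq, MvPolynomial.totalDegree_C, zero_add]
    refine le_trans ?_ (MvPolynomial.le_totalDegree hα)
    rw [Finsupp.prod, Finsupp.sum]
    refine (MvPolynomial.totalDegree_finsetProd _ _).trans (Finset.sum_le_sum fun i _ => ?_)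
    refine (MvPolynomial.totalDegree_pow _ _).trans ?_
    nlinarith [hf i]
  · unfold polyEval
    rw [MvPolynomial.aeval_def, MvPolynomial.eval_eval₂, MvPolynomial.eval]
    simp only [MvPolynomial.coe_eval₂Hom]
    congr 1
    · ext; simp
    · ext i; simp [f]

/-! ### Zero sets of polynomials are null -/

/-- Induction on the number of variables with Fubini. As a polynomial in the first variable, `p` has
a coefficient that is not the zero polynomial; for almost every value of the other variables it does
not vanish, and then only finitely many roots remain. -/
theorem volume_zeros_eq_zero : ∀ {n : ℕ} (p : MvPolynomial (Fin n) ℝ), p ≠ 0 →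
    volume {x : Fin n → ℝ | MvPolynomial.eval x p = 0} = 0 := by
  intro n
  induction n with
  | zero =>
    intro p hp
    convert measure_empty (μ := (volume : Measure (Fin 0 → ℝ)))
    ext x
    simp only [Set.mem_ofPred_eq, Set.mem_empty_iff_false, iff_false]
    intro h
    apply hp
    rw [MvPolynomial.eq_C_of_isEmpty p] at h ⊢
    rw [MvPolynomial.eval_C] at h
    rw [h, map_zero]
  | succ n ih =>
    intro p hp
    have hq : MvPolynomial.finSuccEquiv ℝ n p ≠ 0 := by simpa using hp
    obtain ⟨j, hj⟩ : ∃ j, (MvPolynomial.finSuccEquiv ℝ n p).coeff j ≠ 0 := by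
      by_contra! h
      exact hq (Polynomial.ext (by simpa using h))
    have hcont : Continuous fun x : Fin (n + 1) → ℝ => MvPolynomial.eval x p :=
      MvPolynomial.continuous_eval p
    have hmeas : MeasurableSet {x : Fin (n + 1) → ℝ | MvPolynomial.eval x p = 0} :=
      (isClosed_eq hcont continuous_const).measurableSet
    have hmp : MeasurePreserving (fun z : (Fin n → ℝ) × ℝ => (Fin.cons z.2 z.1 : Fin (n + 1) → ℝ))
        ((volume : Measure (Fin n → ℝ)).prod (volume : Measure ℝ)) volume := by
      have := (volume_preserving_piFinSuccAbove (fun _ : Fin (n + 1) => ℝ) 0).symm.comp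
        (Measure.measurePreserving_swap (μ := (volume : Measure (Fin n → ℝ)))
          (ν := (volume : Measure ℝ)))
      have heq : (fun z : (Fin n → ℝ) × ℝ => (Fin.cons z.2 z.1 : Fin (n + 1) → ℝ)) =
          (MeasurableEquiv.piFinSuccAbove (fun _ : Fin (n + 1) => ℝ) 0).symm ∘ Prod.swap := by
        funext z
        exact (Fin.insertNth_zero' (β := ℝ) z.2 z.1).symm
      rw [heq]
      exact this
    rw [← hmp.measure_preimage hmeas.nullMeasurableSet,
      Measure.measure_prod_null (hmp.measurable hmeas)]
    have hae : ∀ᵐ y : Fin n → ℝ,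
        MvPolynomial.eval y ((MvPolynomial.finSuccEquiv ℝ n p).coeff j) ≠ 0 := by
      rw [ae_iff]
      simpa using ih _ hj
    filter_upwards [hae] with y hy
    have hpoly : ((MvPolynomial.finSuccEquiv ℝ n p).map (MvPolynomial.eval y)) ≠ 0 := by
      intro h0
      apply hy
      rw [← Polynomial.coeff_map, h0, Polynomial.coeff_zero]
    refine Set.Finite.measure_zero ?_ _
    refine (Polynomial.rootSet_finite
      ((MvPolynomial.finSuccEquiv ℝ n p).map (MvPolynomial.eval y)) ℝ).subset fun t ht => ?_
    rw [Polynomial.mem_rootSet]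
    refine ⟨hpoly, ?_⟩
    have h1 : MvPolynomial.eval (Fin.cons t y : Fin (n + 1) → ℝ) p = 0 := ht
    rw [MvPolynomial.eval_eq_eval_mv_eval'] at h1
    simpa using h1

theorem volume_zeros_polyEval {p : MvPolynomial (Fin 3) ℝ} (hp : p ≠ 0) :
    volume {x : E3 | polyEval p x = 0} = 0 := by
  have := (PiLp.volume_preserving_ofLp (Fin 3)).measure_preimage
    (s := {x : Fin 3 → ℝ | MvPolynomial.eval x p = 0})
    (isClosed_eq (MvPolynomial.continuous_eval p) continuous_const).measurableSet.nullMeasurableSet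
  rw [volume_zeros_eq_zero p hp] at this
  exact this

/-! ### A Remez inequality -/

/-- The exponents of degree at most `k` in each variable. -/
noncomputable def boxExps (k : ℕ) : Finset (Fin 3 →₀ ℕ) :=
  Finset.univ.finsupp fun _ => Finset.range (k + 1)

theorem mem_boxExps {k : ℕ} {α : Fin 3 →₀ ℕ} : α ∈ boxExps k ↔ ∀ i, α i ≤ k := by
  simp [boxExps, Finset.mem_finsupp_iff]

/-- The polynomial with given coefficients. -/
noncomputable def polyOfCoeffs {k : ℕ} (c : boxExps k → ℝ) : MvPolynomial (Fin 3) ℝ :=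
  ∑ α, MvPolynomial.monomial α.1 (c α)

theorem polyOfCoeffs_coeff {k : ℕ} {p : MvPolynomial (Fin 3) ℝ} (hp : p.totalDegree ≤ k) :
    polyOfCoeffs (fun α : boxExps k => p.coeff α) = p := by
  have hs : p.support ⊆ boxExps k := fun α hα => mem_boxExps.2 fun i =>
    ((Finsupp.le_degree i α).trans (MvPolynomial.le_totalDegree hα)).trans hp
  unfold polyOfCoeffs
  rw [Finset.univ_eq_attach, Finset.sum_attach (boxExps k) fun α =>
    MvPolynomial.monomial α (p.coeff α)]
  conv_rhs => rw [p.as_sum]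
  refine (Finset.sum_subset hs fun α _ hα => ?_).symm
  rw [MvPolynomial.notMem_support_iff.1 hα, map_zero]

theorem polyOfCoeffs_ne_zero {k : ℕ} {c : boxExps k → ℝ} (hc : c ≠ 0) : polyOfCoeffs c ≠ 0 := by
  contrapose! hc
  ext α
  have := congrArg (MvPolynomial.coeff α.1) hc
  rw [polyOfCoeffs, MvPolynomial.coeff_sum] at this
  simp only [MvPolynomial.coeff_monomial, MvPolynomial.coeff_zero, SetLike.coe_eq_coe] at this
  simpa using this

theorem polyEval_polyOfCoeffs {k : ℕ} (c : boxExps k → ℝ) (x : E3) :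
    polyEval (polyOfCoeffs c) x = ∑ α, c α * ∏ i, x i ^ α.1 i := by
  simp only [polyEval, polyOfCoeffs, map_sum, MvPolynomial.eval_monomial]
  refine Finset.sum_congr rfl fun α _ => ?_
  rw [Finsupp.prod_fintype _ _ (by simp)]

theorem abs_polyEval_polyOfCoeffs_le {k : ℕ} (c : boxExps k → ℝ) {R : ℝ} (hR : 1 ≤ R) {x : E3}
    (hx : ‖x‖ ≤ R) :
    |polyEval (polyOfCoeffs c) x| ≤ Fintype.card (boxExps k) * R ^ (3 * k) * ‖c‖ := by
  rw [polyEval_polyOfCoeffs]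
  refine (Finset.abs_sum_le_sum_abs _ _).trans ?_
  refine (Finset.sum_le_card_nsmul _ _ (R ^ (3 * k) * ‖c‖) fun α _ => ?_).trans ?_
  · rw [abs_mul, mul_comm]
    refine mul_le_mul ?_ (norm_le_pi_norm c α) (abs_nonneg _) (by positivity)
    rw [Finset.abs_prod]
    calc ∏ i, |x i ^ α.1 i| ≤ ∏ _i : Fin 3, R ^ k := by
          refine Finset.prod_le_prod (fun _ _ => abs_nonneg _) fun i _ => ?_
          rw [abs_pow]
          exact (pow_le_pow_left₀ (abs_nonneg _) ((PiLp.norm_apply_le x i).trans hx) _).trans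
            (pow_le_pow_right₀ hR (mem_boxExps.1 α.2 i))
      _ = R ^ (3 * k) := by simp [← pow_mul, mul_comm]
  · simp [mul_assoc]

/-- A nonzero polynomial is small only on a small set, uniformly in the polynomial. -/
theorem exists_sublevel_lt (k : ℕ) (R : ℝ) {ε : ℝ} (hε : 0 < ε) :
    ∃ s > 0, ∀ c : boxExps k → ℝ, ‖c‖ = 1 →
      volume {x : E3 | ‖x‖ ≤ R ∧ |polyEval (polyOfCoeffs c) x| ≤ s} < ENNReal.ofReal ε := by
  -- Compactness: counterexamples at levels `1/(n+1)` have coefficients on the unit sphere, so a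
  -- subsequence converges to some `c₀ ≠ 0`. Every sublevel set of the limit polynomial then has
  -- measure at least `ε`, although these sets decrease to its null zero set.
  by_contra! hcon
  have hpos : ∀ n : ℕ, (0 : ℝ) < 1 / (n + 1) := fun n => Nat.one_div_pos_of_nat
  choose c hc1 hc2 using fun n : ℕ => hcon (1 / (n + 1)) (hpos n)
  obtain ⟨c₀, hc₀, φ, hφ, hlim⟩ := (isCompact_sphere (0 : boxExps k → ℝ) 1).tendsto_subseq
    (fun n => (mem_sphere_zero_iff_norm.2 (hc1 n)))
  have hc₀1 : ‖c₀‖ = 1 := mem_sphere_zero_iff_norm.1 hc₀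
  have hc₀0 : c₀ ≠ 0 := by rintro rfl; simp at hc₀1
  let S : ℕ → Set E3 := fun m =>
    {x | ‖x‖ ≤ R ∧ |polyEval (polyOfCoeffs c₀) x| ≤ 1 / ((m : ℝ) + 1)}
  have hSm : ∀ m, MeasurableSet (S m) := fun m =>
    ((isClosed_le continuous_norm continuous_const).inter
      (isClosed_le (continuous_polyEval _).abs continuous_const)).measurableSet
  have hSanti : Antitone S := fun m n hmn x hx =>
    ⟨hx.1, hx.2.trans (Nat.one_div_le_one_div hmn)⟩
  have hge : ∀ m, ENNReal.ofReal ε ≤ volume (S m) := by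
    intro m
    have hdiff : Filter.Tendsto (fun n => ‖c (φ n) - c₀‖) Filter.atTop (𝓝 0) :=
      tendsto_iff_norm_sub_tendsto_zero.1 hlim
    -- Convergence of coefficients is uniform convergence on the ball, so a small sublevel set of an
    -- approximant lies in the `m`-th sublevel set of the limit.
    have h1 : Filter.Tendsto (fun n => Fintype.card (boxExps k) * (max R 1) ^ (3 * k) *
        ‖c (φ n) - c₀‖ + 1 / ((φ n : ℝ) + 1)) Filter.atTop (𝓝 0) := by
      have := (hdiff.const_mul (Fintype.card (boxExps k) * (max R 1) ^ (3 * k) : ℝ)).add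
        (tendsto_one_div_add_atTop_nhds_zero_nat.comp hφ.tendsto_atTop)
      simpa using this
    obtain ⟨n, hn⟩ := (h1.eventually_lt_const (hpos m)).exists
    refine (hc2 (φ n)).trans (measure_mono fun x hx => ⟨hx.1, ?_⟩)
    have h2 : polyEval (polyOfCoeffs c₀) x =
        polyEval (polyOfCoeffs (c (φ n))) x - polyEval (polyOfCoeffs (c (φ n) - c₀)) x := by
      simp only [polyEval_polyOfCoeffs, ← Finset.sum_sub_distrib]
      refine Finset.sum_congr rfl fun α _ => ?_
      simp only [Pi.sub_apply]; ring
    have h3 := abs_polyEval_polyOfCoeffs_le (c (φ n) - c₀) (le_max_right R 1)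
      (hx.1.trans (le_max_left R 1))
    rw [h2]
    have h4 := abs_sub (polyEval (polyOfCoeffs (c (φ n))) x)
      (polyEval (polyOfCoeffs (c (φ n) - c₀)) x)
    linarith [hx.2]
  have hfin : volume (S 0) ≠ ⊤ := by
    refine ((measure_mono fun x hx => ?_).trans_lt
      (measure_closedBall_lt_top (μ := (volume : Measure E3)) (x := 0) (r := R))).ne
    exact mem_closedBall_zero_iff.2 hx.1
  have hinter : volume (⋂ m, S m) = 0 := by
    refine measure_mono_null (fun x hx => ?_) (volume_zeros_polyEval (polyOfCoeffs_ne_zero hc₀0))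
    have h1 : ∀ m : ℕ, |polyEval (polyOfCoeffs c₀) x| ≤ 1 / ((m : ℝ) + 1) := fun m =>
      (Set.mem_iInter.1 hx m).2
    exact abs_eq_zero.1 (le_antisymm
      (ge_of_tendsto' tendsto_one_div_add_atTop_nhds_zero_nat h1) (abs_nonneg _))
  have hlim2 := tendsto_measure_iInter_atTop (μ := (volume : Measure E3))
    (fun m => (hSm m).nullMeasurableSet) hSanti ⟨0, hfin⟩
  rw [hinter] at hlim2
  have := ge_of_tendsto' hlim2 hge
  simp [hε.not_ge] at this

/-- Remez inequality for the coefficients. -/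
theorem exists_coeff_bound (k : ℕ) (R : ℝ) {ε : ℝ} (hε : 0 < ε) :
    ∃ C > 0, ∀ c : boxExps k → ℝ, ∀ Y : Set E3, (∀ y ∈ Y, ‖y‖ ≤ R) →
      ENNReal.ofReal ε ≤ volume Y → ∀ M : ℝ, (∀ y ∈ Y, |polyEval (polyOfCoeffs c) y| ≤ M) →
      ‖c‖ ≤ C * M := by
  obtain ⟨s, hs, H⟩ := exists_sublevel_lt k R hε
  -- By homogeneity: if `‖c‖` exceeded `M / s`, the normalized polynomial would be at most `s` on
  -- all of `Y`, whose measure is too large for that.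
  refine ⟨1 / s, by positivity, fun c Y hY hvol M hM => ?_⟩
  by_contra! hlt
  have hYne : Y.Nonempty := by
    rw [Set.nonempty_iff_ne_empty]
    rintro rfl
    simp [hε.not_ge] at hvol
  have hM0 : 0 ≤ M := (abs_nonneg _).trans (hM _ hYne.some_mem)
  have hc : 0 < ‖c‖ := lt_of_le_of_lt (by positivity) hlt
  have h1 := H (‖c‖⁻¹ • c) (by rw [norm_smul, norm_inv, norm_norm, inv_mul_cancel₀ hc.ne'])
  refine absurd h1 (not_lt.2 (hvol.trans (measure_mono fun y hy => ⟨hY y hy, ?_⟩)))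
  have h2 : polyEval (polyOfCoeffs (‖c‖⁻¹ • c)) y = ‖c‖⁻¹ * polyEval (polyOfCoeffs c) y := by
    simp only [polyEval_polyOfCoeffs, Finset.mul_sum]
    refine Finset.sum_congr rfl fun α _ => ?_
    simp only [Pi.smul_apply, smul_eq_mul]; ring
  rw [h2, abs_mul, abs_inv, abs_norm, inv_mul_le_iff₀ hc]
  have := hM y hy
  rw [one_div, inv_mul_lt_iff₀ hs] at hlt
  linarith

theorem abs_pderiv_polyOfCoeffs_le {k : ℕ} (c : boxExps k → ℝ) {R : ℝ} (hR : 1 ≤ R) {x : E3}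
    (hx : ‖x‖ ≤ R) (i : Fin 3) :
    |polyEval (MvPolynomial.pderiv i (polyOfCoeffs c)) x| ≤
      Fintype.card (boxExps k) * (k * R ^ (3 * k)) * ‖c‖ := by
  simp only [polyEval, polyOfCoeffs, map_sum, MvPolynomial.pderiv_monomial,
    MvPolynomial.eval_monomial]
  refine (Finset.abs_sum_le_sum_abs _ _).trans ?_
  refine (Finset.sum_le_card_nsmul _ _ (k * R ^ (3 * k) * ‖c‖) fun α _ => ?_).trans ?_
  · have hα := mem_boxExps.1 α.2
    rw [abs_mul, abs_mul, mul_assoc, mul_comm (k * R ^ (3 * k) : ℝ)]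
    refine mul_le_mul (norm_le_pi_norm c α) ?_ (by positivity) (norm_nonneg _)
    refine mul_le_mul ?_ ?_ (abs_nonneg _) (by positivity)
    · rw [Nat.abs_cast]; exact_mod_cast hα i
    · rw [Finsupp.prod_fintype _ _ (by simp), Finset.abs_prod]
      calc ∏ j, |x j ^ (α.1 - Finsupp.single i 1 : Fin 3 →₀ ℕ) j| ≤ ∏ _j : Fin 3, R ^ k := by
            refine Finset.prod_le_prod (fun _ _ => abs_nonneg _) fun j _ => ?_
            rw [abs_pow]
            refine (pow_le_pow_left₀ (abs_nonneg _) ((PiLp.norm_apply_le x j).trans hx) _).trans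
              (pow_le_pow_right₀ hR ?_)
            exact le_trans (by simp) (hα j)
        _ = R ^ (3 * k) := by simp [← pow_mul, mul_comm]
  · simp [mul_assoc]

/-- Remez inequality with control of the gradient, on a ball of radius `R h`. -/
theorem exists_remez (k : ℕ) (R : ℝ) {ε : ℝ} (hε : 0 < ε) :
    ∃ C > 0, ∀ p : MvPolynomial (Fin 3) ℝ, p.totalDegree ≤ k → ∀ (a : E3) (h : ℝ), 0 < h →
      ∀ Y ⊆ Metric.closedBall a (R * h), ENNReal.ofReal (ε * h ^ 3) ≤ volume Y →
      ∀ M, (∀ y ∈ Y, |polyEval p y| ≤ M) → ∀ x ∈ Metric.closedBall a (R * h),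
        |polyEval p x| ≤ C * M ∧ ‖polyGrad p x‖ ≤ C * M / h := by
  obtain ⟨C, hC, H⟩ := exists_coeff_bound k R hε
  set R' := max R 1
  set N : ℝ := (Fintype.card (boxExps k) : ℝ)
  have hR' : 1 ≤ R' := le_max_right _ _
  refine ⟨(N * R' ^ (3 * k) + 3 * (N * (k * R' ^ (3 * k))) + 1) * C, by positivity,
    fun p hp a h hh Y hY hvol M hM x hx => ?_⟩
  -- Rescaling by `y ↦ a + h y` reduces to unit size; undoing it yields the factor `1/h` for the
  -- gradient, and `h³` in the volume hypothesis.
  obtain ⟨q, hq, hqp⟩ := exists_affine_subst p hp a h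
  have hqc := polyOfCoeffs_coeff hq
  set c : boxExps k → ℝ := fun α => q.coeff α
  have hM0 : 0 ≤ M := by
    have hYne : Y.Nonempty := by
      rw [Set.nonempty_iff_ne_empty]
      rintro rfl
      simp [(by positivity : 0 < ε * h ^ 3).not_ge] at hvol
    exact (abs_nonneg _).trans (hM _ hYne.some_mem)
  have hinv : ∀ z : E3, a + h • (h⁻¹ • (z - a)) = z := fun z => by
    rw [smul_inv_smul₀ hh.ne']; abel
  have hnorm : ∀ z ∈ Metric.closedBall a (R * h), ‖h⁻¹ • (z - a)‖ ≤ R := by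
    intro z hz
    rw [norm_smul, norm_inv, Real.norm_of_nonneg hh.le, inv_mul_le_iff₀ hh, mul_comm]
    simpa [dist_eq_norm] using hz
  let Y' : Set E3 := (fun y => a + h • y) ⁻¹' Y
  have hc : ‖c‖ ≤ C * M := by
    refine H c Y' (fun y hy => ?_) ?_ M fun y hy => ?_
    · have := hnorm _ (hY hy)
      simpa [smul_smul, inv_mul_cancel₀ hh.ne'] using this
    · have h1 : volume Y' = ENNReal.ofReal ((h ^ 3)⁻¹) * volume Y := by
        have : Y' = (fun y => h • y) ⁻¹' ((fun y => a + y) ⁻¹' Y) := rfl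
        rw [this, Measure.addHaar_preimage_smul _ hh.ne', measure_preimage_add]
        simp [abs_of_pos hh]
      rw [h1]
      calc ENNReal.ofReal ε = ENNReal.ofReal ((h ^ 3)⁻¹) * ENNReal.ofReal (ε * h ^ 3) := by
            rw [← ENNReal.ofReal_mul (by positivity)]
            congr 1
            field_simp
        _ ≤ _ := by gcongr
    · rw [hqc, hqp]; exact hM _ hy
  have hq1 := abs_polyEval_polyOfCoeffs_le c hR' ((hnorm x hx).trans (le_max_left _ _))
  have hq2 := fun i =>
    abs_pderiv_polyOfCoeffs_le c hR' ((hnorm x hx).trans (le_max_left _ _)) i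
  rw [hqc] at hq1 hq2
  rw [hqp, hinv] at hq1
  have hgrad : polyGrad q (h⁻¹ • (x - a)) = h • polyGrad p x := by
    have h1 := hasFDerivAt_polyEval q (h⁻¹ • (x - a))
    have h2 : HasFDerivAt (fun y : E3 => a + h • y) (h • ContinuousLinearMap.id ℝ E3)
        (h⁻¹ • (x - a)) := ((hasFDerivAt_id _).const_smul h).const_add a
    have h3 : HasFDerivAt (polyEval p) (innerSL ℝ (polyGrad p x)) (a + h • (h⁻¹ • (x - a))) := by
      rw [hinv]; exact hasFDerivAt_polyEval p x
    have h4 : HasFDerivAt (polyEval p ∘ fun y : E3 => a + h • y)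
        ((innerSL ℝ (polyGrad p x)).comp (h • ContinuousLinearMap.id ℝ E3)) (h⁻¹ • (x - a)) :=
      HasFDerivAt.comp (g := polyEval p) (f := fun y : E3 => a + h • y) _ h3 h2
    have h5 : polyEval p ∘ (fun y : E3 => a + h • y) = polyEval q := by
      ext y; exact (hqp y).symm
    rw [h5] at h4
    have h6 := h1.unique h4
    refine ext_inner_right ℝ fun v => ?_
    have := congrArg (fun L => L v) h6
    simpa [inner_smul_left, inner_smul_right] using this
  constructor
  · refine hq1.trans ?_
    calc N * R' ^ (3 * k) * ‖c‖ ≤ N * R' ^ (3 * k) * (C * M) := by gcongr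
      _ = (N * R' ^ (3 * k)) * C * M := by ring
      _ ≤ _ := by gcongr; nlinarith [show 0 ≤ 3 * (N * (k * R' ^ (3 * k))) by positivity]
  · rw [le_div_iff₀ hh, mul_comm]
    have h7 : h * ‖polyGrad p x‖ = ‖polyGrad q (h⁻¹ • (x - a))‖ := by
      rw [hgrad, norm_smul, Real.norm_of_nonneg hh.le]
    rw [h7]
    have h8 : ‖polyGrad q (h⁻¹ • (x - a))‖ ≤
        ∑ i, |polyEval (MvPolynomial.pderiv i q) (h⁻¹ • (x - a))| := by
      rw [EuclideanSpace.norm_eq]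
      refine Real.sqrt_le_iff.2 ⟨by positivity, ?_⟩
      simp only [polyGrad, Real.norm_eq_abs]
      exact Finset.sum_sq_le_sq_sum_of_nonneg fun i _ => abs_nonneg _
    refine h8.trans ((Finset.sum_le_sum fun i _ => hq2 i).trans ?_)
    simp only [Finset.sum_const, Finset.card_univ, Fintype.card_fin, nsmul_eq_mul]
    calc ((3 : ℕ) : ℝ) * (N * (k * R' ^ (3 * k)) * ‖c‖)
        ≤ ((3 : ℕ) : ℝ) * (N * (k * R' ^ (3 * k)) * (C * M)) := by gcongr
      _ = (3 * (N * (k * R' ^ (3 * k)))) * C * M := by push_cast; ring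
      _ ≤ _ := by gcongr; nlinarith [show 0 ≤ N * R' ^ (3 * k) by positivity]

/-! ### Ball volumes and local `L²` control of polynomials -/

/-- The volume of the unit ball of `E3`. -/
noncomputable def ballVol : ℝ := (volume : Measure E3).real (Metric.ball 0 1)

theorem ballVol_pos : 0 < ballVol :=
  ENNReal.toReal_pos (Metric.measure_ball_pos _ _ one_pos).ne' measure_ball_lt_top.ne

theorem volume_closedBall_eq (x : E3) {r : ℝ} (hr : 0 ≤ r) :
    volume (Metric.closedBall x r) = ENNReal.ofReal (ballVol * r ^ 3) := by
  have h1 : volume (Metric.ball (0 : E3) 1) = ENNReal.ofReal ballVol :=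
    (ENNReal.ofReal_toReal measure_ball_lt_top.ne).symm
  have h3 : Module.finrank ℝ E3 = 3 := by simp
  rw [Measure.addHaar_closedBall _ _ hr, h1, h3, ← ENNReal.ofReal_mul (by positivity), mul_comm]

/-- A polynomial on a ball of radius `R h` is controlled by its `L²` norm on a smaller ball. -/
theorem exists_sq_le_integral (k : ℕ) (R : ℝ) {ρ : ℝ} (hρ : 0 < ρ) :
    ∃ C > 0, ∀ p : MvPolynomial (Fin 3) ℝ, p.totalDegree ≤ k → ∀ (a : E3) (h : ℝ), 0 < h →
      ∀ b, Metric.closedBall b (ρ * h) ⊆ Metric.closedBall a (R * h) →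
      ∀ x ∈ Metric.closedBall a (R * h),
        polyEval p x ^ 2 ≤ C / h ^ 3 * ∫ y in Metric.closedBall b (ρ * h), polyEval p y ^ 2 := by
  set ω := ballVol
  have hω0 : 0 < ω := ballVol_pos
  obtain ⟨C, hC, H⟩ := exists_remez k R (ε := ω * ρ ^ 3 / 2) (by positivity)
  refine ⟨C ^ 2 * (2 / (ω * ρ ^ 3)), by positivity, fun p hp a h hh b hb x hx => ?_⟩
  set B := Metric.closedBall b (ρ * h)
  have hvolB : volume B = ENNReal.ofReal (ω * ρ ^ 3 * h ^ 3) := by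
    rw [volume_closedBall_eq _ (by positivity), mul_pow, mul_assoc]
  set A := ∫ y in B, polyEval p y ^ 2
  have hA0 : 0 ≤ A := integral_nonneg fun _ => sq_nonneg _
  have hint : IntegrableOn (fun y => polyEval p y ^ 2) B :=
    ((continuous_polyEval p).pow 2).continuousOn.integrableOn_compact
      (isCompact_closedBall _ _)
  -- `L` is twice the mean of `p²` over `B`, so by Chebyshev `p² ≤ L` on at least half of `B`; the
  -- Remez inequality is applied on that half.
  set L := 2 * A / (ω * ρ ^ 3 * h ^ 3)
  have hL0 : 0 ≤ L := by positivity
  have key : ENNReal.ofReal (ω * ρ ^ 3 / 2 * h ^ 3) ≤ volume {y ∈ B | polyEval p y ^ 2 ≤ L} := by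
    by_contra! hlt
    have hmeas : MeasurableSet {y ∈ B | polyEval p y ^ 2 ≤ L} :=
      (Metric.isClosed_closedBall.inter
        (isClosed_le ((continuous_polyEval p).pow 2) continuous_const)).measurableSet
    set G := {y ∈ B | polyEval p y ^ 2 ≤ L}
    have hGB : G ⊆ B := fun y hy => hy.1
    have h1 : (volume : Measure E3).real G < ω * ρ ^ 3 / 2 * h ^ 3 := by
      rw [Measure.real]
      exact (ENNReal.lt_ofReal_iff_toReal_lt (hlt.trans_le le_top).ne).1 hlt
    have h2 : (volume : Measure E3).real (B \ G) =
        ω * ρ ^ 3 * h ^ 3 - (volume : Measure E3).real G := by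
      rw [measureReal_sdiff hGB hmeas (measure_closedBall_lt_top).ne, Measure.real, hvolB,
        ENNReal.toReal_ofReal (by positivity)]
    have hBG : MeasurableSet (B \ G) := Metric.isClosed_closedBall.measurableSet.diff hmeas
    have hfinBG : volume (B \ G) ≠ ⊤ :=
      ((measure_mono Set.sdiff_subset).trans_lt measure_closedBall_lt_top).ne
    have h3 : ∫ y in B \ G, L ≤ ∫ y in B \ G, polyEval p y ^ 2 := by
      refine setIntegral_mono_on (integrableOn_const hfinBG) (hint.mono_set Set.sdiff_subset) hBG
        fun y hy => ?_
      by_contra! hy2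
      exact hy.2 ⟨hy.1, hy2.le⟩
    have h4 : ∫ y in B \ G, polyEval p y ^ 2 ≤ A :=
      setIntegral_mono_set hint (Filter.Eventually.of_forall fun _ => sq_nonneg _)
        Set.sdiff_subset.eventuallyLE
    rw [setIntegral_const, smul_eq_mul, h2] at h3
    have hLA : L * (ω * ρ ^ 3 * h ^ 3) = 2 * A := by
      simp only [L]; field_simp
    -- If the integral vanishes then `L = 0` and Chebyshev's strict inequality is lost; here `p²`
    -- vanishes almost everywhere on `B` instead.
    rcases hA0.eq_or_lt with hA | hA
    · have hz : ∀ᵐ y ∂volume.restrict B, polyEval p y ^ 2 = 0 :=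
        (integral_eq_zero_iff_of_nonneg (fun _ => sq_nonneg _) hint).1 hA.symm
      have : volume (B \ G) = 0 := by
        rw [ae_restrict_iff' Metric.isClosed_closedBall.measurableSet] at hz
        refine measure_mono_null (fun y hy => ?_) (ae_iff.1 hz)
        simp only [Set.mem_ofPred_eq, Classical.not_imp]
        refine ⟨hy.1, fun h0 => hy.2 ⟨hy.1, ?_⟩⟩
        rw [h0]; exact hL0
      rw [Measure.real, this, ENNReal.toReal_zero] at h2
      nlinarith [show 0 < ω * ρ ^ 3 * h ^ 3 by positivity]
    · have hL : 0 < L := by positivity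
      nlinarith
  have h5 := (H p hp a h hh _ (fun y hy => hb hy.1) key (Real.sqrt L) (fun y hy => by
    rw [← Real.sqrt_sq_eq_abs]; exact Real.sqrt_le_sqrt hy.2) x hx).1
  calc polyEval p x ^ 2 = |polyEval p x| ^ 2 := (sq_abs _).symm
    _ ≤ (C * Real.sqrt L) ^ 2 := pow_le_pow_left₀ (abs_nonneg _) h5 2
    _ = C ^ 2 * L := by rw [mul_pow, Real.sq_sqrt hL0]
    _ = _ := by simp only [L]; field_simp

end TraceFEM

namespace TraceFEM

/-! ### Surface measure and projections -/

theorem euclideanHausdorffMeasure_image_le {X Y : Type*} [EMetricSpace X] [MeasurableSpace X]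
    [BorelSpace X] [EMetricSpace Y] [MeasurableSpace Y] [BorelSpace Y] {f : X → Y}
    (hf : LipschitzWith 1 f) (d : ℕ) (s : Set X) :
    (μHE[d] : Measure Y) (f '' s) ≤ (μHE[d] : Measure X) s := by
  have h := hf.hausdorffMeasure_image_le (d := d) (by positivity) s
  simp only [ENNReal.coe_one, ENNReal.one_rpow, one_mul] at h
  simp only [Measure.euclideanHausdorffMeasure_def, Measure.smul_apply]
  gcongr

open scoped Pointwise in
/-- If every point of a subset `Y` of a ball of radius `ρ` can be moved into the compact set `A` in
the direction `ν`, then the area of `A` is at least `|Y| / (2 ρ)`. -/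
theorem volume_le_of_columns {Y A : Set E3} {y₀ ν : E3} {ρ : ℝ} (hν : ‖ν‖ = 1)
    (hA : IsCompact A) (hY : Y ⊆ Metric.closedBall y₀ ρ) (h : ∀ y ∈ Y, ∃ t : ℝ, y + t • ν ∈ A) :
    volume Y ≤ ENNReal.ofReal (2 * ρ) * μHE[2] A := by
  have hν0 : ν ≠ 0 := by rintro rfl; simp at hν
  -- `Y` need not be measurable. It is enlarged to the part of the ball on lines through `A`, which
  -- is closed because `A` is compact.
  let S : Set E3 := Metric.closedBall y₀ ρ ∩ (A + ((ℝ ∙ ν : Submodule ℝ E3) : Set E3))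
  have hYS : Y ⊆ S := by
    intro y hy
    obtain ⟨t, ht⟩ := h y hy
    refine ⟨hY hy, Set.mem_add.2 ⟨_, ht, -t • ν, Submodule.smul_mem _ _
      (Submodule.mem_span_singleton_self ν), by simp⟩⟩
  have hSmeas : MeasurableSet S :=
    (Metric.isClosed_closedBall.inter
      ((Submodule.closed_of_finiteDimensional (ℝ ∙ ν)).add_left_of_isCompact hA)).measurableSet
  refine (measure_mono hYS).trans ?_
  have hvol : volume S = (μHE[Module.finrank ℝ E3] : Measure E3) S := by
    rw [InnerProductSpace.euclideanHausdorffMeasure_eq_volume]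
  rw [hvol, EuclideanGeometry.euclideanHausdorffMeasure_eq_lintegral y₀ hν0 hSmeas]
  have hfin3 : Module.finrank ℝ E3 - 1 = 2 := by simp
  rw [hfin3, ← ofReal_norm, hν, ENNReal.ofReal_one, one_mul]
  have hinn : (inner ℝ ν ν : ℝ) = 1 := by rw [real_inner_self_eq_norm_sq, hν, one_pow]
  -- Each slice orthogonal to `ν` lies in the orthogonal projection of `A` to that plane, a
  -- 1-Lipschitz image. Only heights in an interval of length `2ρ` meet the ball.
  have hslice : ∀ x : ℝ, μHE[2] (S ∩ (AffineSubspace.mk' (x • ν +ᵥ y₀) (ℝ ∙ ν)ᗮ : Set E3)) ≤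
      (Set.Icc (-ρ) ρ).indicator (fun _ => μHE[2] A) x := by
    intro x
    have hmem : ∀ z, z ∈ (AffineSubspace.mk' (x • ν +ᵥ y₀) (ℝ ∙ ν)ᗮ : Set E3) ↔
        inner ℝ ν (z - y₀) = x := by
      intro z
      rw [SetLike.mem_coe, AffineSubspace.mem_mk', Submodule.mem_orthogonal_singleton_iff_inner_right]
      simp only [vsub_eq_sub, vadd_eq_add, inner_sub_right, inner_add_right, inner_smul_right, hinn]
      constructor <;> intro h <;> linarith
    by_cases hx : x ∈ Set.Icc (-ρ) ρ
    · rw [Set.indicator_of_mem hx]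
      let f : E3 → E3 := fun z => z - (inner ℝ ν (z - y₀) - x) • ν
      have hf : LipschitzWith 1 f := by
        refine LipschitzWith.of_dist_le_mul fun z w => ?_
        rw [NNReal.coe_one, one_mul, dist_eq_norm, dist_eq_norm]
        have h1 : f z - f w = (z - w) - (inner ℝ ν (z - w) : ℝ) • ν := by
          simp only [f, inner_sub_right, sub_smul]; abel
        rw [h1]
        refine le_of_sq_le_sq ?_ (norm_nonneg _)
        rw [norm_sub_sq_real, inner_smul_right, norm_smul, hν, real_inner_comm, Real.norm_eq_abs,
          mul_one, sq_abs]
        nlinarith [sq_nonneg (inner ℝ ν (z - w) : ℝ)]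
      refine le_trans (measure_mono ?_) (euclideanHausdorffMeasure_image_le hf 2 A)
      rintro z ⟨⟨-, hz⟩, hzx⟩
      obtain ⟨a, ha, w, hw, rfl⟩ := Set.mem_add.1 hz
      obtain ⟨t, rfl⟩ := Submodule.mem_span_singleton.1 hw
      refine ⟨a, ha, ?_⟩
      have := (hmem _).1 hzx
      simp only [f, ← this, inner_sub_right, inner_add_right, inner_smul_right, hinn]
      module
    · rw [Set.indicator_of_notMem hx]
      refine le_of_eq ?_
      convert measure_empty (μ := (μHE[2] : Measure E3))
      rw [Set.eq_empty_iff_forall_notMem]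
      rintro z ⟨⟨hz, -⟩, hzx⟩
      apply hx
      rw [← (hmem z).1 hzx, Set.mem_Icc, ← abs_le]
      refine (abs_real_inner_le_norm _ _).trans ?_
      rw [hν, one_mul]
      simpa [dist_eq_norm] using hz
  refine (lintegral_mono hslice).trans ?_
  rw [lintegral_indicator measurableSet_Icc, setLIntegral_const, Real.volume_Icc, mul_comm]
  gcongr
  linarith

/-! ### Boundaries -/

/-- Off the frontier, `s` would be split by the disjoint open sets `interior U` and the complement
of `closure U`. -/
theorem IsPreconnected.inter_frontier_nonempty_of_mem {X : Type*} [TopologicalSpace X]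
    {s U : Set X} (hs : IsPreconnected s)
    (h1 : (s ∩ U).Nonempty) (h2 : (s ∩ Uᶜ).Nonempty) : (s ∩ frontier U).Nonempty := by
  by_contra! hne
  obtain ⟨x, hxs, hxU⟩ := h1
  obtain ⟨y, hys, hyU⟩ := h2
  have hcov : s ⊆ interior U ∪ (closure U)ᶜ := by
    intro z hz
    by_contra hz'
    rw [Set.mem_union, not_or, Set.mem_compl_iff, not_not] at hz'
    exact (hne ▸ (⟨hz, hz'.2, hz'.1⟩ : z ∈ s ∩ frontier U) : z ∈ (∅ : Set X))
  obtain ⟨z, -, hz1, hz2⟩ := hs _ _ isOpen_interior isClosed_closure.isOpen_compl hcov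
    ⟨x, hxs, (hcov hxs).resolve_right fun h => h (subset_closure hxU)⟩
    ⟨y, hys, (hcov hys).resolve_left fun h => hyU (interior_subset h)⟩
  exact hz2 (subset_closure (interior_subset hz1))

theorem exists_mem_segment_frontier {U : Set E3} {x y : E3} (hx : x ∈ U) (hy : y ∉ U) :
    ∃ c ∈ frontier U, dist x c + dist c y = dist x y := by
  obtain ⟨c, hc, hcU⟩ := IsPreconnected.inter_frontier_nonempty_of_mem
    (convex_segment (𝕜 := ℝ) x y).isPreconnected
    ⟨x, left_mem_segment ℝ x y, hx⟩ ⟨y, right_mem_segment ℝ x y, hy⟩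
  exact ⟨c, hcU, dist_add_dist_of_mem_segment hc⟩

/-! ### The signed distance and its gradient -/

/-- For points on opposite sides, the segment between them crosses the frontier, so the two
distances to it add up to at most the distance of the points. The Lipschitz bound gives
differentiability almost everywhere and `|n| ≤ 1`, so no smoothness theory of the distance function
is needed. -/
theorem lipschitzWith_bdrySignedDist (D : Set E3) : LipschitzWith 1 (bdrySignedDist D) := by
  have hmix : ∀ x ∈ D, ∀ y ∉ D,
      Metric.infDist x (frontier D) + Metric.infDist y (frontier D) ≤ dist x y := by
    intro x hx y hy
    obtain ⟨c, hc, hd⟩ := exists_mem_segment_frontier hx hy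
    have h1 := Metric.infDist_le_dist_of_mem (x := x) hc
    have h2 := Metric.infDist_le_dist_of_mem (x := y) hc
    rw [dist_comm y c] at h2
    linarith
  refine LipschitzWith.of_dist_le_mul fun x y => ?_
  rw [NNReal.coe_one, one_mul, Real.dist_eq, abs_le]
  have hsame := Metric.infDist_le_infDist_add_dist (s := frontier D) (x := x) (y := y)
  have hsame' := Metric.infDist_le_infDist_add_dist (s := frontier D) (x := y) (y := x)
  have hx0 := Metric.infDist_nonneg (s := frontier D) (x := x)
  have hy0 := Metric.infDist_nonneg (s := frontier D) (x := y)
  have hd := dist_nonneg (x := x) (y := y)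
  rw [dist_comm y x] at hsame'
  unfold bdrySignedDist
  by_cases hx : x ∈ D <;> by_cases hy : y ∈ D
  · simp only [hx, hy, if_true]; constructor <;> linarith
  · simp only [hx, hy, if_true, if_false]
    have := hmix x hx y hy
    constructor <;> linarith
  · simp only [hx, hy, if_true, if_false]
    have := hmix y hy x hx
    rw [dist_comm] at this
    constructor <;> linarith
  · simp only [hx, hy, if_false]; constructor <;> linarith

theorem norm_normal_le (D : Set E3) (x : E3) : ‖normal D x‖ ≤ 1 := by
  rw [normal, gradient, LinearIsometryEquiv.norm_map]
  simpa using norm_fderiv_le_of_lipschitz ℝ (lipschitzWith_bdrySignedDist D) (x₀ := x)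

theorem measurable_normal (D : Set E3) : Measurable (normal D) := by
  unfold normal gradient
  exact (LinearIsometryEquiv.continuous _).measurable.comp (measurable_fderiv ℝ _)

/-! ### Uniform flatness of the boundary -/

/-- `U` is close to the half space `{⟪ν, · - x₀⟫ < 0}` near `x₀`: at every boundary point of `U` in
the ball of radius `r` around `x₀`, the cone with axis `ν` and slope `δ` separates `U` from its
complement within this ball. -/
def FlatAt (U : Set E3) (δ r : ℝ) (x₀ ν : E3) : Prop :=
  ‖ν‖ = 1 ∧ ∀ y ∈ frontier U, dist y x₀ < r → ∀ z, dist z x₀ < r →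
    (δ * ‖z - y‖ < inner ℝ ν (z - y) → z ∉ U) ∧ (inner ℝ ν (z - y) < -(δ * ‖z - y‖) → z ∈ U)

/-- With this symmetry every one-sided argument also applies on the other side of the surface. -/
theorem FlatAt.compl {U : Set E3} {δ r : ℝ} {x₀ ν : E3} (h : FlatAt U δ r x₀ ν) :
    FlatAt Uᶜ δ r x₀ (-ν) := by
  refine ⟨by rw [norm_neg, h.1], fun y hy hyr z hz => ?_⟩
  rw [frontier_compl] at hy
  have := h.2 y hy hyr z hz
  rw [inner_neg_left]
  exact ⟨fun h1 h2 => h2 (this.2 (by linarith)), fun h1 => this.1 (by linarith)⟩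

theorem IsC2Domain.isCompact_frontier {D : Set E3} (hD : IsC2Domain D) : IsCompact (frontier D) :=
  Metric.isCompact_of_isClosed_isBounded isClosed_frontier
    (hD.isBounded.closure.subset frontier_subset_closure)

/-- Strict differentiability of the defining function at `x` linearizes its differences between any
two nearby points, not only differences from `x`. It vanishes at nearby frontier points, so its sign
is that of the linear part outside a cone; the axis is the normalized gradient. -/
theorem IsC2Domain.exists_flatAt_local {D : Set E3} (hD : IsC2Domain D) {δ : ℝ} (hδ : 0 < δ)
    {x : E3} (hx : x ∈ frontier D) : ∃ r > 0, ∃ ν, FlatAt D δ r x ν := by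
  obtain ⟨φ, hφ, hφ', hev⟩ := hD.exists_local x hx
  have hstrict : HasStrictFDerivAt φ (fderiv ℝ φ x) x := hφ.hasStrictFDerivAt (by norm_num)
  set g : E3 := (InnerProductSpace.toDual ℝ E3).symm (fderiv ℝ φ x) with hg
  have hgL : ∀ v, fderiv ℝ φ x v = inner ℝ g v := fun v => by
    rw [hg, InnerProductSpace.toDual_symm_apply]
  have hg0 : 0 < ‖g‖ := by
    rw [norm_pos_iff, hg]
    simpa using hφ'
  have hlin := hstrict.isLittleO.bound (c := δ * ‖g‖) (by positivity)
  have hcont : ∀ᶠ y in 𝓝 x, ContinuousAt φ y := by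
    filter_upwards [hφ.eventually (by simp)] with y hy using hy.continuousAt
  obtain ⟨r₁, hr₁, H₁⟩ := Metric.eventually_nhds_iff.1 hlin
  obtain ⟨r₂, hr₂, H₂⟩ := Metric.eventually_nhds_iff.1 (hev.eventually_nhds.and hcont)
  refine ⟨min r₁ r₂, lt_min hr₁ hr₂, ‖g‖⁻¹ • g, ?_, fun y hy hyr z hz => ?_⟩
  · rw [norm_smul, norm_inv, norm_norm, inv_mul_cancel₀ hg0.ne']
  have hy2 := H₂ (hyr.trans_le (min_le_right _ _))
  have hz2 := (H₂ (hz.trans_le (min_le_right _ _))).1.self_of_nhds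
  have hφy : φ y = 0 := by
    refine le_antisymm ?_ ?_
    · have hcl : y ∈ closure D := frontier_subset_closure hy
      rw [mem_closure_iff_frequently] at hcl
      by_contra! hpos
      have h1 : ∀ᶠ w in 𝓝 y, 0 < φ w := hy2.2.eventually_const_lt hpos
      obtain ⟨w, hw1, hw2, hw3⟩ := (hcl.and_eventually (h1.and hy2.1)).exists
      exact (hw3.1 hw1).not_gt hw2
    · by_contra! hneg
      have : y ∈ D := hy2.1.self_of_nhds.2 hneg
      rw [hD.isOpen.frontier_eq] at hy
      exact hy.2 this
  have hb : ‖φ z - φ y - fderiv ℝ φ x (z - y)‖ ≤ δ * ‖g‖ * ‖z - y‖ := by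
    have : dist (z, y) (x, x) < r₁ := by
      rw [Prod.dist_eq]
      exact max_lt (hz.trans_le (min_le_left _ _)) (hyr.trans_le (min_le_left _ _))
    exact H₁ this
  rw [hφy, hgL, sub_zero, Real.norm_eq_abs, abs_le] at hb
  rw [inner_smul_left, hz2]
  simp only [conj_trivial]
  constructor
  · intro h1
    rw [lt_inv_mul_iff₀ hg0] at h1
    nlinarith
  · intro h1
    rw [inv_mul_lt_iff₀ hg0] at h1
    nlinarith

/-- The boundary of a `C²` domain is uniformly flat. -/
theorem IsC2Domain.exists_flatAt {D : Set E3} (hD : IsC2Domain D) {δ : ℝ} (hδ : 0 < δ) :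
    ∃ r > 0, ∀ x ∈ frontier D, ∃ ν, FlatAt D δ r x ν := by
  choose! r hr ν hν using fun x (hx : x ∈ frontier D) => hD.exists_flatAt_local hδ hx
  -- A Lebesgue number of the cover by local balls serves as a uniform radius, since flatness passes
  -- to smaller balls.
  obtain ⟨s, hs, H⟩ := lebesgue_number_lemma_of_metric (c := fun x : frontier D => Metric.ball x.1 (r x))
    hD.isCompact_frontier (fun _ => Metric.isOpen_ball) fun x hx =>
      Set.mem_iUnion.2 ⟨⟨x, hx⟩, Metric.mem_ball_self (hr x hx)⟩
  refine ⟨s, hs, fun x hx => ?_⟩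
  obtain ⟨i, hi⟩ := H x hx
  refine ⟨ν i, (hν i i.2).1, fun y hy hyx z hz => ?_⟩
  exact (hν i i.2).2 y hy (hi hyx) z (hi hz)

/-- Moving away from `U` in the direction `ν` increases the distance to the boundary. -/
theorem FlatAt.infDist_add_le {U : Set E3} {δ r : ℝ} {x₀ ν : E3} (h : FlatAt U δ r x₀ ν)
    (hδ : 0 < δ) (hδ' : δ < 1 / 2) (hU : IsCompact (frontier U)) (hx₀ : x₀ ∈ frontier U) {x : E3}
    (hx : x ∉ U) {t : ℝ} (ht : 0 < t) (hxt : 2 * (dist x x₀ + t) + 2 * t < r) :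
    Metric.infDist x (frontier U) + t * (1 - 2 * δ) ≤ Metric.infDist (x + t • ν) (frontier U) := by
  obtain ⟨p, hp, hpd⟩ := hU.exists_infDist_eq_dist ⟨x₀, hx₀⟩ (x + t • ν)
  have hνt : ‖t • ν‖ = t := by rw [norm_smul, h.1, mul_one, Real.norm_of_nonneg ht.le]
  have hxx : dist (x + t • ν) x ≤ t := by rw [dist_eq_norm, add_sub_cancel_left, hνt]
  have hpx₀ : dist p x₀ ≤ 2 * (dist x x₀ + t) := by
    have h1 := Metric.infDist_le_dist_of_mem (x := x + t • ν) hx₀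
    have h2 := dist_triangle (x + t • ν) x x₀
    have h3 := dist_triangle_left p x₀ (x + t • ν)
    linarith
  -- With `p` the nearest frontier point to `x + tν`, the ball of radius `s` about `p - tν` lies in
  -- `U`: its points `z` satisfy `⟪ν, z - p⟫ ≤ s - t = -2δt`, while `‖z - p‖ ≤ t + s < 2t`.
  set s := t * (1 - 2 * δ) with hs
  have hs0 : 0 < s := mul_pos ht (by linarith)
  have hin : ∀ z, dist z (p - t • ν) ≤ s → z ∈ U := by
    intro z hz
    have hz1 : ‖z - p‖ ≤ t + s := by
      have : z - p = (z - (p - t • ν)) - t • ν := by abel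
      rw [this]
      refine (norm_sub_le _ _).trans ?_
      rw [hνt, ← dist_eq_norm]; linarith
    refine (h.2 p hp (by linarith) z ?_).2 ?_
    · have := dist_triangle z p x₀
      rw [dist_eq_norm z p] at this
      have : s < t := by nlinarith
      linarith
    · have h1 : inner ℝ ν (z - p) = inner ℝ ν (z - (p - t • ν)) - t := by
        have : z - p = (z - (p - t • ν)) - t • ν := by abel
        rw [this, inner_sub_right, inner_smul_right, real_inner_self_eq_norm_sq, h.1]; ring
      have h2 := real_inner_le_norm ν (z - (p - t • ν))
      rw [h.1, one_mul, ← dist_eq_norm] at h2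
      rw [h1]
      have : s < t := by nlinarith
      nlinarith
  have hl : dist x (p - t • ν) = dist (x + t • ν) p := by
    rw [dist_eq_norm, dist_eq_norm]; congr 1; abel
  rw [hpd, ← hl]
  set l := dist x (p - t • ν) with hldef
  have hls : s < l := by
    by_contra! hle
    exact hx (hin x hle)
  have hl0 : 0 < l := hs0.trans hls
  -- `w` is the point of this ball nearest to `x` on the segment from its centre, at distance `l -
  -- s` from `x`. As `w ∈ U` and `x ∉ U`, the frontier is met within `l - s` of `x`, where `l` is
  -- the distance from `x + tν` to the frontier.
  set w := (p - t • ν) + (s / l) • (x - (p - t • ν)) with hw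
  have hlnorm : ‖x - (p - t • ν)‖ = l := by rw [hldef, dist_eq_norm]
  have hwU : w ∈ U := by
    apply hin
    rw [hw, dist_eq_norm, add_sub_cancel_left, norm_smul, hlnorm,
      Real.norm_of_nonneg (by positivity), div_mul_cancel₀ _ hl0.ne']
  have hwx : dist w x = l - s := by
    have h1 : w - x = (s / l - 1) • (x - (p - t • ν)) := by rw [hw]; module
    rw [dist_eq_norm, h1, norm_smul, hlnorm, Real.norm_eq_abs, abs_of_nonpos]
    · field_simp; ring
    · rw [sub_nonpos, div_le_one hl0]; exact hls.le
  obtain ⟨c, hc, hcd⟩ := exists_mem_segment_frontier hwU hx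
  have h1 := Metric.infDist_le_dist_of_mem (x := x) hc
  rw [dist_comm x c] at h1
  have := dist_nonneg (x := w) (y := c)
  linarith

theorem le_inner_gradient_of_slope {f : E3 → ℝ} {x v : E3} {a : ℝ} (hf : DifferentiableAt ℝ f x)
    (h : ∀ᶠ t in 𝓝[>] (0 : ℝ), f x + t * a ≤ f (x + t • v)) : a ≤ inner ℝ (gradient f x) v := by
  have h1 : HasDerivAt (fun t : ℝ => f (x + t • v)) (fderiv ℝ f x v) 0 := by
    have h2 : HasDerivAt (fun t : ℝ => x + t • v) v 0 := by
      simpa using ((hasDerivAt_id (0 : ℝ)).smul_const v).const_add x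
    have h3 : HasFDerivAt f (fderiv ℝ f x) (x + (0 : ℝ) • v) := by simpa using hf.hasFDerivAt
    exact h3.comp_hasDerivAt 0 h2
  have h4 := (hasDerivAt_iff_tendsto_slope.1 h1).mono_left
    (nhdsWithin_mono 0 (fun t (ht : 0 < t) => ht.ne') : 𝓝[>] (0 : ℝ) ≤ 𝓝[≠] 0)
  rw [gradient, InnerProductSpace.toDual_symm_apply]
  refine ge_of_tendsto h4 ?_
  filter_upwards [h, self_mem_nhdsWithin] with t ht ht0
  have ht0' : 0 < t := ht0
  rw [slope_def_field, sub_zero, zero_smul, add_zero, le_div_iff₀ ht0']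
  linarith

/-- Near a boundary point where `D` is flat, the normal field is close to the axis. -/
theorem FlatAt.norm_normal_sub_sq_le {D : Set E3} {δ r : ℝ} {x₀ ν : E3} (h : FlatAt D δ r x₀ ν)
    (hδ : 0 < δ) (hδ' : δ < 1 / 2) (hD : IsOpen D) (hΓ : IsCompact (frontier D))
    (hx₀ : x₀ ∈ frontier D) {x : E3} (hxr : dist x x₀ < r / 2)
    (hx : DifferentiableAt ℝ (bdrySignedDist D) x) : ‖normal D x - ν‖ ^ 2 ≤ 4 * δ := by
  have hsmall : ∀ᶠ t in 𝓝[>] (0 : ℝ), 2 * (dist x x₀ + t) + 2 * t < r := by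
    refine nhdsWithin_le_nhds (Filter.Tendsto.eventually_lt_const (v := 2 * (dist x x₀ + 0) + 2 * 0)
      (by linarith) (Continuous.tendsto (by fun_prop) 0))
  have hpath : ∀ v : E3, Filter.Tendsto (fun t : ℝ => x + t • v) (𝓝[>] 0) (𝓝 x) := by
    intro v
    have : Continuous fun t : ℝ => x + t • v := by fun_prop
    simpa using (this.tendsto 0).mono_left nhdsWithin_le_nhds
  -- The signed distance grows at rate at least `1 - 2δ` along `ν`; with `|n| ≤ 1` this gives `|n -
  -- ν|² ≤ 2 - 2(1 - 2δ) = 4δ`. Inside `D` the growth lemma is applied to the complement and `-ν`.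
  have hinner : 1 - 2 * δ ≤ inner ℝ (normal D x) ν := by
    by_cases hxD : x ∈ D
    · have h1 : 1 - 2 * δ ≤ inner ℝ (gradient (fun y => -bdrySignedDist D y) x) (-ν) := by
        refine le_inner_gradient_of_slope hx.neg ?_
        filter_upwards [hsmall, self_mem_nhdsWithin, (hpath (-ν)).eventually_mem (hD.mem_nhds hxD)]
          with t ht ht0 htD
        have := h.compl.infDist_add_le hδ hδ' (by rwa [frontier_compl]) (by rwa [frontier_compl])
          (x := x) (by simpa using hxD) ht0 ht
        rw [frontier_compl] at this
        unfold bdrySignedDist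
        rw [if_pos hxD, if_pos htD]
        linarith
      have h2 : gradient (fun y => -bdrySignedDist D y) x = -normal D x := by
        rw [normal, gradient, gradient, fderiv_fun_neg, map_neg]
      rwa [h2, inner_neg_neg] at h1
    · refine le_inner_gradient_of_slope hx ?_
      have hout : ∀ᶠ t in 𝓝[>] (0 : ℝ), x + t • ν ∉ D := by
        by_cases hxc : x ∈ closure D
        · have hxf : x ∈ frontier D := ⟨hxc, fun h' => hxD (interior_subset h')⟩
          filter_upwards [hsmall, self_mem_nhdsWithin] with t ht ht0
          have ht0' : 0 < t := ht0
          have hνt : ‖t • ν‖ = t := by rw [norm_smul, h.1, mul_one, Real.norm_of_nonneg ht0'.le]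
          refine (h.2 x hxf (by have := dist_nonneg (x := x) (y := x₀); linarith) (x + t • ν) ?_).1 ?_
          · have := dist_triangle (x + t • ν) x x₀
            rw [dist_eq_norm (x + t • ν) x, add_sub_cancel_left, hνt] at this
            have := dist_nonneg (x := x) (y := x₀)
            linarith
          · rw [add_sub_cancel_left, hνt, inner_smul_right, real_inner_self_eq_norm_sq, h.1]
            nlinarith
        · filter_upwards [(hpath ν).eventually_mem (isClosed_closure.isOpen_compl.mem_nhds hxc)]
            with t ht using fun h' => ht (subset_closure h')
      filter_upwards [hsmall, self_mem_nhdsWithin, hout] with t ht ht0 htD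
      unfold bdrySignedDist
      rw [if_neg hxD, if_neg htD]
      exact h.infDist_add_le hδ hδ' hΓ hx₀ hxD ht0 ht
  rw [norm_sub_sq_real, h.1]
  have := norm_normal_le D x
  have := norm_nonneg (normal D x)
  nlinarith

/-- Rademacher's theorem removes the differentiability hypothesis; an almost everywhere bound is
enough for volume integrals. -/
theorem FlatAt.ae_norm_normal_sub_sq_le {D : Set E3} {δ r : ℝ} {x₀ ν : E3}
    (h : FlatAt D δ r x₀ ν) (hδ : 0 < δ) (hδ' : δ < 1 / 2) (hD : IsOpen D)
    (hΓ : IsCompact (frontier D)) (hx₀ : x₀ ∈ frontier D) :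
    ∀ᵐ x : E3, dist x x₀ < r / 2 → ‖normal D x - ν‖ ^ 2 ≤ 4 * δ := by
  filter_upwards [(lipschitzWith_bdrySignedDist D).ae_differentiableAt (μ := volume)]
    with x hx hxr using h.norm_normal_sub_sq_le hδ hδ' hD hΓ hx₀ hxr hx

end TraceFEM

namespace TraceFEM

variable {Ω : Set E3}

/-! ### Barycentric coordinates -/

/-- `ℓ v`, for `v ∈ T`, are the barycentric coordinates of the tetrahedron with vertex set `T`. -/
structure IsBary (T : Finset E3) (ℓ : E3 → E3 →ᵃ[ℝ] ℝ) : Prop where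
  apply_self : ∀ v ∈ T, ℓ v v = 1
  apply_ne : ∀ v ∈ T, ∀ w ∈ T, w ≠ v → ℓ v w = 0
  sum_eq_one : ∀ x, ∑ v ∈ T, ℓ v x = 1
  sum_smul_eq : ∀ x, ∑ v ∈ T, ℓ v x • v = x

open Classical in
theorem exists_isBary {T : Finset E3} (hT : AffineIndependent ℝ ((↑) : T → E3))
    (hcard : T.card = 4) : ∃ ℓ, IsBary T ℓ := by
  have htop : affineSpan ℝ (Set.range ((↑) : T → E3)) = ⊤ := by
    rw [hT.affineSpan_eq_top_iff_card_eq_finrank_add_one]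
    simp [hcard]
  let b : AffineBasis T ℝ E3 := ⟨(↑), hT, htop⟩
  have hb : ∀ i : T, b i = i := fun i => rfl
  refine ⟨fun v => if hv : v ∈ T then b.coord ⟨v, hv⟩ else 0, ?_, ?_, ?_, ?_⟩
  · intro v hv
    simp only [hv, dif_pos]
    exact b.coord_apply_eq ⟨v, hv⟩
  · intro v hv w hw hwv
    simp only [hv, dif_pos]
    exact b.coord_apply_ne (i := ⟨v, hv⟩) (j := ⟨w, hw⟩) (by simpa using hwv.symm)
  · intro x
    rw [← Finset.sum_attach]
    simpa using b.sum_coord_apply_eq_one x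
  · intro x
    rw [← Finset.sum_attach]
    simpa [hb] using b.linear_combination_coord_eq_self x

theorem subset_cell (T : Finset E3) : (T : Set E3) ⊆ cell T := subset_convexHull ℝ _

theorem convex_cell (T : Finset E3) : Convex ℝ (cell T) := convex_convexHull ℝ _

theorem isCompact_cell (T : Finset E3) : IsCompact (cell T) := T.finite_toSet.isCompact_convexHull ℝ

theorem cell_mono {S T : Finset E3} (h : S ⊆ T) : cell S ⊆ cell T :=
  convexHull_mono (by exact_mod_cast h)

theorem dist_le_diam {T : Finset E3} {x y : E3} (hx : x ∈ cell T) (hy : y ∈ cell T) :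
    dist x y ≤ diam T := Metric.dist_le_diam_of_mem (isCompact_cell T).isBounded hx hy

namespace IsBary

variable {T : Finset E3} {ℓ : E3 → E3 →ᵃ[ℝ] ℝ}

theorem mem_cell_iff (h : IsBary T ℓ) {x : E3} : x ∈ cell T ↔ ∀ v ∈ T, 0 ≤ ℓ v x := by
  constructor
  · intro hx v hv
    have : cell T ⊆ {y | 0 ≤ ℓ v y} := by
      refine convexHull_min (fun w hw => ?_) ((convex_Ici (0 : ℝ)).affine_preimage (ℓ v))
      rw [Set.mem_ofPred_eq]
      rcases eq_or_ne w v with rfl | hwv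
      · rw [h.apply_self w hv]; exact zero_le_one
      · rw [h.apply_ne v hv w hw hwv]
    exact this hx
  · intro hx
    rw [← h.sum_smul_eq x]
    exact (convex_cell T).sum_mem hx (h.sum_eq_one x) fun v hv => subset_cell T hv

theorem le_one (h : IsBary T ℓ) {x : E3} (hx : x ∈ cell T) {v : E3} (hv : v ∈ T) : ℓ v x ≤ 1 := by
  rw [← h.sum_eq_one x]
  exact Finset.single_le_sum (f := fun v => ℓ v x) (h.mem_cell_iff.1 hx) hv

/-- An affine function with values in `[0,1]` on a ball of radius `ρ` changes by at most 1 across a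
diameter, which bounds its slope by `1/(2ρ)`. -/
theorem abs_sub_le (h : IsBary T ℓ) {b : E3} {ρ : ℝ} (hρ : 0 < ρ)
    (hb : Metric.closedBall b ρ ⊆ cell T) {v : E3} (hv : v ∈ T) (x y : E3) :
    |ℓ v x - ℓ v y| ≤ ‖x - y‖ / (2 * ρ) := by
  rcases eq_or_ne x y with rfl | hxy
  · simp
  have hn : 0 < ‖x - y‖ := norm_pos_iff.2 (sub_ne_zero.2 hxy)
  set u := ‖x - y‖⁻¹ • (x - y) with hu
  have hu1 : ‖u‖ = 1 := by rw [hu, norm_smul, norm_inv, norm_norm, inv_mul_cancel₀ hn.ne']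
  have hmem : ∀ s : ℝ, |s| = ρ → b + s • u ∈ cell T := by
    intro s hs
    apply hb
    rw [mem_closedBall_iff_norm, add_sub_cancel_left, norm_smul, hu1, mul_one, Real.norm_eq_abs, hs]
  have h1 := hmem ρ (abs_of_pos hρ)
  have h2 := hmem (-ρ) (by rw [abs_neg, abs_of_pos hρ])
  have hlin : ∀ s : ℝ, ℓ v (b + s • u) = ℓ v b + s * (ℓ v).linear u := by
    intro s
    have := (ℓ v).map_vadd b (s • u)
    simp only [vadd_eq_add, map_smul, smul_eq_mul] at this
    rw [add_comm, this, add_comm]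
  have hxy' : ℓ v x - ℓ v y = ‖x - y‖ * (ℓ v).linear u := by
    rw [hu, map_smul, smul_eq_mul, ← mul_assoc, mul_inv_cancel₀ hn.ne', one_mul]
    exact ((ℓ v).linearMap_vsub x y).symm
  have h3 := h.mem_cell_iff.1 h1 v hv
  have h4 := h.mem_cell_iff.1 h2 v hv
  have h5 := h.le_one h1 hv
  have h6 := h.le_one h2 hv
  rw [hlin] at h3 h4 h5 h6
  have h7 : |(ℓ v).linear u| ≤ 1 / (2 * ρ) := by
    rw [le_div_iff₀ (by positivity), ← abs_of_pos (by positivity : 0 < 2 * ρ), ← abs_mul, abs_le]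
    constructor <;> linarith
  rw [hxy', abs_mul, abs_of_pos hn, div_eq_mul_one_div]
  gcongr

theorem two_mul_le_dist (h : IsBary T ℓ) {b : E3} {ρ : ℝ} (hρ : 0 < ρ)
    (hb : Metric.closedBall b ρ ⊆ cell T) {v w : E3} (hv : v ∈ T) (hw : w ∈ T) (hvw : v ≠ w) :
    2 * ρ ≤ dist v w := by
  have := h.abs_sub_le hρ hb hv v w
  rwa [h.apply_self v hv, h.apply_ne v hv w hw hvw.symm, sub_zero, abs_one,
    le_div_iff₀ (by positivity), one_mul, ← dist_eq_norm] at this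

/-- A small step from `x` away from `v` stays in the cell, but would make a vanishing coordinate
negative. -/
theorem pos_of_mem_interior (h : IsBary T ℓ) {x : E3} (hx : x ∈ interior (cell T)) {v : E3}
    (hv : v ∈ T) : 0 < ℓ v x := by
  have hc : Continuous fun s : ℝ => x + s • (x - v) := by fun_prop
  have h1 : ∀ᶠ s in 𝓝 (0 : ℝ), x + s • (x - v) ∈ cell T := by
    refine hc.tendsto 0 |>.eventually_mem ?_
    simpa using mem_interior_iff_mem_nhds.1 hx
  obtain ⟨s, hs, hs0⟩ := ((h1.filter_mono nhdsWithin_le_nhds).and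
    (self_mem_nhdsWithin : Set.Ioi (0 : ℝ) ∈ 𝓝[>] 0)).exists
  have hs0' : 0 < s := hs0
  have h2 := h.mem_cell_iff.1 hs v hv
  have h3 := (ℓ v).map_vadd x (s • (x - v))
  simp only [vadd_eq_add, map_smul, smul_eq_mul] at h3
  have h4 : (ℓ v).linear (x - v) = ℓ v x - ℓ v v := (ℓ v).linearMap_vsub x v
  rw [add_comm, h3, h4, h.apply_self v hv] at h2
  have h5 := h.mem_cell_iff.1 (interior_subset hx) v hv
  rcases h5.eq_or_lt with h6 | h6
  · rw [← h6] at h2; linarith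
  · exact h6

end IsBary

/-! ### Conforming triangulations -/

namespace Triangulation

variable (M : Triangulation Ω)

theorem exists_bary {T : Finset E3} (hT : T ∈ M.tets) : ∃ ℓ, IsBary T ℓ :=
  exists_isBary (M.complex.indep ((M.mem_tets T).1 hT).1) ((M.mem_tets T).1 hT).2

variable {M}

/-- Conformity puts `x` in the convex hull of the common vertices; if `v` were not one of them, its
coordinate would vanish on this hull. -/
theorem mem_of_bary_pos {T T' : Finset E3} (hT : T ∈ M.tets) (hT' : T' ∈ M.tets)
    {ℓ : E3 → E3 →ᵃ[ℝ] ℝ} (hℓ : IsBary T ℓ) {x : E3} (hx : x ∈ cell T) (hx' : x ∈ cell T') {v : E3}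
    (hv : v ∈ T) (hpos : 0 < ℓ v x) : v ∈ T' := by
  by_contra hvT'
  have h1 := M.complex.inter_subset_convexHull ((M.mem_tets T).1 hT).1 ((M.mem_tets T').1 hT').1
    ⟨hx, hx'⟩
  have h2 : convexHull ℝ ((T : Set E3) ∩ T') ⊆ {y | ℓ v y ≤ 0} := by
    refine convexHull_min (fun w hw => ?_) ((convex_Iic (0 : ℝ)).affine_preimage (ℓ v))
    rw [Set.mem_ofPred_eq, hℓ.apply_ne v hv w hw.1]
    rintro rfl
    exact hvT' hw.2
  exact (h2 h1).not_gt hpos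

theorem vertex_mem {T T' : Finset E3} (hT : T ∈ M.tets) (hT' : T' ∈ M.tets) {v : E3}
    (hv : v ∈ T) (hv' : v ∈ cell T') : v ∈ T' := by
  obtain ⟨ℓ, hℓ⟩ := M.exists_bary hT
  exact mem_of_bary_pos hT hT' hℓ (subset_cell T hv) hv' hv (by rw [hℓ.apply_self v hv]; exact one_pos)

theorem eq_of_mem_interior {T T' : Finset E3} (hT : T ∈ M.tets) (hT' : T' ∈ M.tets) {x : E3}
    (hx : x ∈ interior (cell T)) (hx' : x ∈ cell T') : T = T' := by
  obtain ⟨ℓ, hℓ⟩ := M.exists_bary hT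
  refine Finset.eq_of_subset_of_card_le (fun v hv => mem_of_bary_pos hT hT' hℓ
    (interior_subset hx) hx' hv (hℓ.pos_of_mem_interior hx hv)) ?_
  rw [((M.mem_tets T).1 hT).2, ((M.mem_tets T').1 hT').2]

theorem diam_pos {T : Finset E3} (hT : T ∈ M.tets) : 0 < diam T := by
  have h1 : 1 < T.card := by rw [((M.mem_tets T).1 hT).2]; norm_num
  obtain ⟨v, hv, w, hw, hvw⟩ := Finset.one_lt_card.1 h1
  exact (dist_pos.2 hvw).trans_le (dist_le_diam (subset_cell T hv) (subset_cell T hw))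

theorem exists_tet_mem (M : Triangulation Ω) {x : E3} (hx : x ∈ Ω) : ∃ T ∈ M.tets, x ∈ cell T := by
  have := subset_closure hx
  rw [← M.cover] at this
  simpa using this

/-- Near a point `x`, only tetrahedra that contain `x` are present. -/
theorem eventually_mem_imp (M : Triangulation Ω) (x : E3) :
    ∀ᶠ y in 𝓝 x, ∀ T ∈ M.tets, y ∈ cell T → x ∈ cell T := by
  rw [Filter.eventually_all_finset]
  intro T _
  by_cases hx : x ∈ cell T
  · exact Filter.Eventually.of_forall fun _ _ => hx
  · filter_upwards [(isCompact_cell T).isClosed.isOpen_compl.mem_nhds hx] with y hy h using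
      absurd h hy

/-- Near `x` only tetrahedra containing `x` occur, so if these are all active they fill a
neighbourhood. -/
theorem mem_activeDomain {D : Set E3} (hΩ : IsOpen Ω) {x : E3} (hx : x ∈ Ω)
    (h : ∀ T ∈ M.tets, x ∈ cell T → T ∈ active D M) : x ∈ activeDomain D M := by
  rw [activeDomain, mem_interior_iff_mem_nhds]
  filter_upwards [M.eventually_mem_imp x, hΩ.mem_nhds hx] with y hy hyΩ
  obtain ⟨T, hT, hyT⟩ := M.exists_tet_mem hyΩ
  exact Set.mem_biUnion (h T hT (hy T hT hyT)) hyT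

open Classical in
/-- The tetrahedra with vertex `v`. -/
noncomputable def star (M : Triangulation Ω) (v : E3) : Finset (Finset E3) :=
  M.tets.filter fun T => v ∈ T

theorem mem_star {v : E3} {T : Finset E3} : T ∈ M.star v ↔ T ∈ M.tets ∧ v ∈ T := by
  simp [star]

end Triangulation

/-! ### Vertex stars under shape regularity -/

variable {M : Triangulation Ω} {σ : ℝ}

theorem ShapeRegular.mono {σ' : ℝ} (hM : ShapeRegular σ M) (hσ : 0 < σ) (h : σ ≤ σ') :
    ShapeRegular σ' M := by
  intro T hT
  obtain ⟨x, hx⟩ := hM T hT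
  refine ⟨x, (Metric.closedBall_subset_closedBall ?_).trans hx⟩
  have := Triangulation.diam_pos hT
  gcongr

/-- The inscribed ball makes every edge of `T` at least `2 h_T / σ` long, and a common edge is no
longer than the diameter of `T'`. -/
theorem ShapeRegular.diam_le_of_edge (hM : ShapeRegular σ M) (hσ : 0 < σ) {T T' : Finset E3}
    (hT : T ∈ M.tets) {v w : E3} (hv : v ∈ T) (hw : w ∈ T)
    (hvw : v ≠ w) (hv' : v ∈ T') (hw' : w ∈ T') : diam T ≤ σ / 2 * diam T' := by
  obtain ⟨ℓ, hℓ⟩ := M.exists_bary hT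
  obtain ⟨b, hb⟩ := hM T hT
  have h1 := hℓ.two_mul_le_dist (div_pos (Triangulation.diam_pos hT) hσ) hb hv hw hvw
  have h2 := dist_le_diam (subset_cell T' hv') (subset_cell T' hw')
  have h3 : 2 * (diam T / σ) ≤ diam T' := h1.trans h2
  rw [mul_div_assoc', div_le_iff₀ hσ] at h3
  linarith

theorem volume_ball_eq (x : E3) {r : ℝ} (hr : 0 ≤ r) :
    volume (Metric.ball x r) = ENNReal.ofReal (ballVol * r ^ 3) := by
  rw [← volume_closedBall_eq x hr, Measure.addHaar_closedBall_eq_addHaar_ball]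

theorem closedBall_homothety_subset {C : Set E3} (hC : Convex ℝ C) {z x : E3} {ρ s : ℝ} (hz : z ∈ C)
    (hx : Metric.closedBall x ρ ⊆ C) (hs0 : 0 < s) (hs1 : s ≤ 1) :
    Metric.closedBall (z + s • (x - z)) (s * ρ) ⊆ C := by
  intro y hy
  have h1 : x + s⁻¹ • (y - (z + s • (x - z))) ∈ C := by
    apply hx
    rw [mem_closedBall_iff_norm, add_sub_cancel_left, norm_smul, norm_inv,
      Real.norm_of_nonneg hs0.le, inv_mul_le_iff₀ hs0]
    exact mem_closedBall_iff_norm.1 hy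
  have h2 : y = (1 - s) • z + s • (x + s⁻¹ • (y - (z + s • (x - z)))) := by
    rw [smul_add, smul_inv_smul₀ hs0.ne']; module
  rw [h2]
  exact hC hz h1 (by linarith) hs0.le (by ring)

theorem ShapeRegular.exists_small_ball (hM : ShapeRegular σ M) (hσ : 0 < σ) {T : Finset E3}
    (hT : T ∈ M.tets) {z : E3} (hz : z ∈ cell T) {s : ℝ} (hs : 0 < s) (hs1 : s ≤ 1) :
    ∃ b, dist b z ≤ s * diam T ∧ Metric.closedBall b (s * (diam T / σ)) ⊆ cell T := by
  obtain ⟨x, hx⟩ := hM T hT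
  have hd := Triangulation.diam_pos hT
  have hxT : x ∈ cell T := hx (Metric.mem_closedBall_self (by positivity))
  refine ⟨z + s • (x - z), ?_, closedBall_homothety_subset (convex_cell T) hz hx hs hs1⟩
  rw [dist_eq_norm, add_sub_cancel_left, norm_smul, Real.norm_of_nonneg hs.le, ← dist_eq_norm]
  exact mul_le_mul_of_nonneg_left (dist_le_diam hxT hz) hs.le

/-- Volume packing: shrink every member of the star towards `v` to the smallest diameter `s`. The
images of the inscribed balls contain disjoint balls of radius `s/σ` inside the ball of radius `s`
about `v`. -/
theorem ShapeRegular.card_star_le (hM : ShapeRegular σ M) (hσ : 0 < σ) (v : E3) :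
    ((M.star v).card : ℝ) ≤ σ ^ 3 := by
  rcases (M.star v).eq_empty_or_nonempty with he | hne
  · rw [he]; simp; positivity
  obtain ⟨T₀, hT₀, hmin⟩ := (M.star v).exists_min_image diam hne
  have hT₀' := Triangulation.mem_star.1 hT₀
  set s := diam T₀
  have hs : 0 < s := Triangulation.diam_pos hT₀'.1
  have hball : ∀ T ∈ M.star v, ∃ b, Metric.ball b (s / σ) ⊆ cell T ∩ Metric.closedBall v s := by
    intro T hT
    have hT' := Triangulation.mem_star.1 hT
    have hd := Triangulation.diam_pos hT'.1
    have hr : s / diam T ≤ 1 := (div_le_one hd).2 (hmin T hT)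
    have hr0 : 0 < s / diam T := div_pos hs hd
    have hrs : s / diam T * diam T = s := div_mul_cancel₀ _ hd.ne'
    have hvT : v ∈ cell T := subset_cell T hT'.2
    obtain ⟨b, hb⟩ := hM T hT'.1
    refine ⟨v + (s / diam T) • (b - v), fun y hy => ?_⟩
    have h2 : v + (s / diam T)⁻¹ • (y - v) ∈ cell T := by
      apply hb
      have h3 : v + (s / diam T)⁻¹ • (y - v) - b =
          (s / diam T)⁻¹ • (y - (v + (s / diam T) • (b - v))) := by
        rw [smul_sub, smul_sub, smul_add, inv_smul_smul₀ hr0.ne']; abel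
      rw [mem_closedBall_iff_norm, h3, norm_smul, norm_inv, Real.norm_of_nonneg hr0.le,
        inv_mul_le_iff₀ hr0, ← mul_div_assoc, hrs]
      exact (mem_ball_iff_norm.1 hy).le
    constructor
    · have h4 := (convex_cell T).add_smul_sub_mem hvT h2 ⟨hr0.le, hr⟩
      rwa [add_sub_cancel_left, smul_inv_smul₀ hr0.ne', add_sub_cancel] at h4
    · have h4 := dist_le_diam h2 hvT
      rw [dist_eq_norm, add_sub_cancel_left, norm_smul, norm_inv, Real.norm_of_nonneg hr0.le,
        inv_mul_le_iff₀ hr0, hrs] at h4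
      exact mem_closedBall_iff_norm.2 h4
  choose! b hb using hball
  have hdisj : Set.PairwiseDisjoint (M.star v : Set (Finset E3)) fun T => Metric.ball (b T) (s / σ) := by
    intro T hT T' hT' hne
    refine Set.disjoint_left.2 fun x hx hx' => hne ?_
    refine Triangulation.eq_of_mem_interior (Triangulation.mem_star.1 hT).1
      (Triangulation.mem_star.1 hT').1 (x := x) ?_ (hb T' hT' hx').1
    exact interior_maximal (fun y hy => (hb T hT hy).1) Metric.isOpen_ball hx
  have h1 : ∑ _T ∈ M.star v, ENNReal.ofReal (ballVol * (s / σ) ^ 3) ≤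
      ENNReal.ofReal (ballVol * s ^ 3) := by
    rw [← volume_closedBall_eq v hs.le]
    calc ∑ _T ∈ M.star v, ENNReal.ofReal (ballVol * (s / σ) ^ 3)
        = ∑ T ∈ M.star v, volume (Metric.ball (b T) (s / σ)) :=
          Finset.sum_congr rfl fun T _ => (volume_ball_eq _ (by positivity)).symm
      _ = volume (⋃ T ∈ M.star v, Metric.ball (b T) (s / σ)) :=
          (measure_biUnion_finset hdisj fun _ _ => Metric.isOpen_ball.measurableSet).symm
      _ ≤ _ := measure_mono (Set.iUnion₂_subset fun T hT y hy => (hb T hT hy).2)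
  have hω := ballVol_pos
  rw [Finset.sum_const, nsmul_eq_mul, ← ENNReal.ofReal_natCast, ← ENNReal.ofReal_mul (by positivity),
    ENNReal.ofReal_le_ofReal_iff (by positivity), div_pow] at h1
  have h2 : ((M.star v).card : ℝ) * (ballVol * (s ^ 3 / σ ^ 3)) =
      (ballVol * s ^ 3) * ((M.star v).card / σ ^ 3) := by ring
  rw [h2] at h1
  have h3 : ((M.star v).card : ℝ) / σ ^ 3 ≤ 1 := by
    have : 0 < ballVol * s ^ 3 := by positivity
    nlinarith
  rwa [div_le_one (by positivity)] at h3

/-- The tetrahedra at an interior vertex are connected through common edges. -/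
theorem Triangulation.exists_common_edge (hΩ : IsOpen Ω) {v : E3} (hv : v ∈ Ω)
    {A : Finset (Finset E3)} (hA : A ⊆ M.star v) (hne : A.Nonempty) (hne' : A ≠ M.star v) :
    ∃ T ∈ A, ∃ T' ∈ M.star v, T' ∉ A ∧ ∃ w ≠ v, w ∈ T ∧ w ∈ T' := by
  classical
  obtain ⟨T₂, hT₂, hT₂A⟩ : ∃ T ∈ M.star v, T ∉ A := by
    by_contra! h
    exact hne' (Finset.Subset.antisymm hA h)
  obtain ⟨T₁, hT₁⟩ := hne
  -- The argument takes place on a sphere around `v` so small that it stays in `Ω`, encloses no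
  -- other vertex and meets only the star of `v`; every edge from `v` then crosses it.
  set W : Finset E3 := (M.tets.biUnion id).erase v with hW
  have hev : ∀ᶠ y in 𝓝 v, (y ∈ Ω ∧ y ∉ W) ∧ ∀ T ∈ M.tets, y ∈ cell T → v ∈ cell T := by
    refine ((hΩ.eventually_mem hv).and ?_).and (M.eventually_mem_imp v)
    exact W.finite_toSet.isClosed.isOpen_compl.mem_nhds (by simp [hW])
  obtain ⟨ρ, hρ, H⟩ := Metric.eventually_nhds_iff.1 hev
  set S := Metric.sphere v (ρ / 2) with hS
  have hpre : IsPreconnected S := isPreconnected_sphere (by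
    rw [← Module.finrank_eq_rank]; norm_cast; simp) v (ρ / 2)
  have hSv : ∀ y ∈ S, dist y v < ρ := fun y hy => by
    rw [Metric.mem_sphere.1 hy]; linarith
  have hcl : ∀ B : Finset (Finset E3), IsClosed (⋃ T ∈ B, cell T) := fun B =>
    B.finite_toSet.isClosed_biUnion fun T _ => (isCompact_cell T).isClosed
  have hmeet : ∀ T ∈ M.star v, (S ∩ cell T).Nonempty := by
    intro T hT
    have hT' := mem_star.1 hT
    have h1 : 1 < T.card := by rw [((M.mem_tets T).1 hT'.1).2]; norm_num
    obtain ⟨w, hw, hwv⟩ := Finset.exists_mem_ne h1 v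
    have hfar : ρ ≤ dist w v := by
      by_contra! hlt
      exact (H hlt).1.2 (by
        rw [hW, Finset.mem_erase, Finset.mem_biUnion]
        exact ⟨hwv, T, hT'.1, hw⟩)
    have hd : 0 < dist w v := hρ.trans_le hfar
    refine ⟨v + (ρ / 2 / dist w v) • (w - v), ?_, ?_⟩
    · rw [hS, mem_sphere_iff_norm, add_sub_cancel_left, norm_smul, ← dist_eq_norm,
        Real.norm_of_nonneg (by positivity), div_mul_cancel₀ _ hd.ne']
    · exact (convex_cell T).add_smul_sub_mem (subset_cell T hT'.2) (subset_cell T hw)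
        ⟨by positivity, (div_le_one hd).2 (by linarith)⟩
  -- The cells of `A` and those of the rest of the star are two closed sets covering the connected
  -- sphere, so they share a point. By conformity it lies in the hull of the common vertices, which
  -- cannot be `v` alone.
  obtain ⟨x, hxS, hx1, hx2⟩ := (isPreconnected_closed_iff.1 hpre) _ _ (hcl A) (hcl (M.star v \ A))
    (by
      intro y hy
      obtain ⟨⟨hyΩ, -⟩, hyT⟩ := H (hSv y hy)
      obtain ⟨T, hT, hyT'⟩ := M.exists_tet_mem hyΩ
      have hTs : T ∈ M.star v := mem_star.2 ⟨hT, vertex_mem (mem_star.1 hT₂).1 hT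
        (mem_star.1 hT₂).2 (hyT T hT hyT')⟩
      by_cases hTA : T ∈ A
      · exact Or.inl (Set.mem_biUnion hTA hyT')
      · exact Or.inr (Set.mem_biUnion (x := T) (by simp [hTs, hTA]) hyT'))
    ((hmeet T₁ (hA hT₁)).mono fun y hy => ⟨hy.1, Set.mem_biUnion hT₁ hy.2⟩)
    ((hmeet T₂ hT₂).mono fun y hy => ⟨hy.1, Set.mem_biUnion (x := T₂) (by simp [hT₂, hT₂A]) hy.2⟩)
  simp only [Set.mem_iUnion, exists_prop] at hx1 hx2
  obtain ⟨T, hT, hxT⟩ := hx1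
  obtain ⟨T', hT', hxT'⟩ := hx2
  rw [Finset.mem_sdiff] at hT'
  refine ⟨T, hT, T', hT'.1, hT'.2, ?_⟩
  by_contra! hno
  have h1 := M.complex.inter_subset_convexHull ((M.mem_tets T).1 (mem_star.1 (hA hT)).1).1
    ((M.mem_tets T').1 (mem_star.1 hT'.1).1).1 ⟨hxT, hxT'⟩
  have h2 : (T : Set E3) ∩ T' ⊆ {v} := by
    intro w hw
    by_contra hwv
    exact hno w hwv hw.1 hw.2
  have h3 := convexHull_mono h2 h1
  rw [convexHull_singleton] at h3
  rw [Set.mem_singleton_iff.1 h3, hS, Metric.mem_sphere, dist_self] at hxS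
  linarith

/-- The factor by which the diameters of two tetrahedra with a common vertex can differ. -/
noncomputable def sizeRatio (σ : ℝ) : ℝ := (2 / σ) ^ ⌈σ ^ 3⌉₊

theorem sizeRatio_pos (hσ : 0 < σ) : 0 < sizeRatio σ := by unfold sizeRatio; positivity

theorem sizeRatio_le_one (hσ : 2 ≤ σ) : sizeRatio σ ≤ 1 :=
  pow_le_one₀ (by positivity) ((div_le_one (by linarith)).2 hσ)

/-- Each passage through a common edge costs at most a factor `σ/2`, the star is connected through
common edges, and it has at most `σ³` members; hence the exponent in `sizeRatio`. -/
theorem ShapeRegular.sizeRatio_mul_diam_le (hM : ShapeRegular σ M) (hσ : 2 ≤ σ) (hΩ : IsOpen Ω)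
    {v : E3} (hv : v ∈ Ω) {T T' : Finset E3} (hT : T ∈ M.star v) (hT' : T' ∈ M.star v) :
    sizeRatio σ * diam T ≤ diam T' := by
  classical
  have hσ0 : 0 < σ := by linarith
  have hσ1 : 1 ≤ σ / 2 := by linarith
  let A : ℕ → Finset (Finset E3) := fun j =>
    (M.star v).filter fun S => diam T ≤ (σ / 2) ^ j * diam S
  have hAsub : ∀ j, A j ⊆ M.star v := fun j => Finset.filter_subset _ _
  have hTA : ∀ j, T ∈ A j := fun j => by
    refine Finset.mem_filter.2 ⟨hT, le_mul_of_one_le_left ?_ (one_le_pow₀ hσ1)⟩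
    exact (Triangulation.diam_pos (Triangulation.mem_star.1 hT).1).le
  have hAmono : ∀ j, A j ⊆ A (j + 1) := fun j S hS => by
    rw [Finset.mem_filter] at hS ⊢
    refine ⟨hS.1, hS.2.trans ?_⟩
    have := (Triangulation.diam_pos (Triangulation.mem_star.1 hS.1).1).le
    gcongr
    omega
  -- As long as `A j` is not the whole star, a common edge leads to a new member of `A (j + 1)`, so
  -- the cardinality grows by at least one per step.
  have key : ∀ j, j + 1 ≤ (A j).card ∨ A j = M.star v := by
    intro j
    induction j with
    | zero => exact Or.inl (Finset.card_pos.2 ⟨T, hTA 0⟩)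
    | succ j ih =>
      by_cases hj : A j = M.star v
      · exact Or.inr (Finset.Subset.antisymm (hAsub _) (hj ▸ hAmono j))
      · left
        have h1 := ih.resolve_right hj
        obtain ⟨T₁, hT₁, T₂, hT₂, hT₂A, w, hwv, hw1, hw2⟩ :=
          Triangulation.exists_common_edge hΩ hv (hAsub j) ⟨T, hTA j⟩ hj
        have hT₁' := Finset.mem_filter.1 hT₁
        have h2 : T₂ ∈ A (j + 1) := by
          refine Finset.mem_filter.2 ⟨hT₂, hT₁'.2.trans ?_⟩
          have := hM.diam_le_of_edge hσ0 (Triangulation.mem_star.1 hT₁'.1).1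
            (Triangulation.mem_star.1 hT₁'.1).2 hw1 hwv.symm (Triangulation.mem_star.1 hT₂).2 hw2
          rw [pow_succ, mul_assoc]
          gcongr
        have h3 : (A j).card < (A (j + 1)).card :=
          Finset.card_lt_card ((Finset.ssubset_iff_of_subset (hAmono j)).2 ⟨T₂, h2, hT₂A⟩)
        omega
  have hN : A ⌈σ ^ 3⌉₊ = M.star v := by
    refine (key _).resolve_left fun h => ?_
    have h1 := (Finset.card_le_card (hAsub ⌈σ ^ 3⌉₊))
    have h2 : ((M.star v).card : ℝ) ≤ ⌈σ ^ 3⌉₊ :=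
      (hM.card_star_le hσ0 v).trans (Nat.le_ceil _)
    have h3 : (M.star v).card ≤ ⌈σ ^ 3⌉₊ := by exact_mod_cast h2
    omega
  have h4 := (Finset.mem_filter.1 (hN.symm ▸ hT' : T' ∈ A ⌈σ ^ 3⌉₊)).2
  have h5 : sizeRatio σ * (σ / 2) ^ ⌈σ ^ 3⌉₊ = 1 := by
    rw [sizeRatio, ← mul_pow, div_mul_div_comm, mul_comm, div_self (by positivity), one_pow]
  calc sizeRatio σ * diam T ≤ sizeRatio σ * ((σ / 2) ^ ⌈σ ^ 3⌉₊ * diam T') := by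
        have := sizeRatio_pos hσ0
        gcongr
    _ = diam T' := by rw [← mul_assoc, h5, one_mul]

/-! ### Stars of faces near their barycenters -/

/-- The barycenter of a finite set of points. -/
noncomputable def barycenter (S : Finset E3) : E3 := (S.card : ℝ)⁻¹ • ∑ v ∈ S, v

theorem barycenter_mem_cell {S : Finset E3} (hS : S.Nonempty) : barycenter S ∈ cell S := by
  have hc : (0 : ℝ) < S.card := by exact_mod_cast hS.card_pos
  rw [barycenter, Finset.smul_sum]
  refine (convex_cell S).sum_mem (fun _ _ => by positivity) ?_ fun v hv => subset_cell S hv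
  rw [Finset.sum_const, nsmul_eq_mul, mul_inv_cancel₀ hc.ne']

theorem affineMap_barycenter {S : Finset E3} (hS : S.Nonempty) (f : E3 →ᵃ[ℝ] ℝ) :
    f (barycenter S) = (S.card : ℝ)⁻¹ * ∑ v ∈ S, f v := by
  have hc : (0 : ℝ) < S.card := by exact_mod_cast hS.card_pos
  have h : ∀ x, f x = f.linear x + f 0 := fun x => congrFun f.decomp x
  rw [h, barycenter, map_smul, map_sum, Finset.sum_congr rfl fun v _ => h v, Finset.sum_add_distrib,
    Finset.sum_const, nsmul_eq_mul, smul_eq_mul, mul_add, inv_mul_cancel_left₀ hc.ne']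

/-- Around the barycenter of a face `S`, only tetrahedra with the face `S` are present. -/
theorem ShapeRegular.subset_of_mem_ball (hM : ShapeRegular σ M) (hσ : 2 ≤ σ) (hΩ : IsOpen Ω)
    {T S : Finset E3} (hT : T ∈ M.tets) (hS : S.Nonempty) (hST : S ⊆ T)
    (hball : Metric.ball (barycenter S) (sizeRatio σ / (4 * σ) * diam T) ⊆ Ω)
    (hSΩ : (S : Set E3) ⊆ Ω) {x : E3}
    (hx : x ∈ Metric.ball (barycenter S) (sizeRatio σ / (4 * σ) * diam T)) {T' : Finset E3}
    (hT' : T' ∈ M.tets) (hxT' : x ∈ cell T') : S ⊆ T' := by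
  classical
  have hσ0 : 0 < σ := by linarith
  have hd := Triangulation.diam_pos hT
  have ha := sizeRatio_pos hσ0
  set B := Metric.ball (barycenter S) (sizeRatio σ / (4 * σ) * diam T) with hB
  have hcl : ∀ B : Finset (Finset E3), IsOpen (⋃ T ∈ B, cell T)ᶜ := fun B =>
    (B.finite_toSet.isClosed_biUnion fun T _ => (isCompact_cell T).isClosed).isOpen_compl
  -- At the barycenter the coordinates belonging to `S` are at least `1/4`, and within the ball they
  -- change by at most `1/8`. They stay positive, so any other cell through `y` contains `S` as
  -- well.
  have hpos : ∀ y ∈ B, ∀ T₁ ∈ M.tets, y ∈ cell T₁ → S ⊆ T₁ → ∀ T₂ ∈ M.tets, y ∈ cell T₂ →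
      S ⊆ T₂ := by
    intro y hy T₁ hT₁ hy1 hS1 T₂ hT₂ hy2 v hv
    obtain ⟨ℓ, hℓ⟩ := M.exists_bary hT₁
    obtain ⟨b, hb⟩ := hM T₁ hT₁
    have hd1 := Triangulation.diam_pos hT₁
    refine Triangulation.mem_of_bary_pos hT₁ hT₂ hℓ hy1 hy2 (hS1 hv) ?_
    have h1 := hℓ.abs_sub_le (div_pos hd1 hσ0) hb (hS1 hv) (barycenter S) y
    have h2 : ℓ v (barycenter S) = (S.card : ℝ)⁻¹ := by
      rw [affineMap_barycenter hS, Finset.sum_eq_single_of_mem v hv, hℓ.apply_self v (hS1 hv),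
        mul_one]
      exact fun w hw hwv => hℓ.apply_ne v (hS1 hv) w (hS1 hw) hwv
    have h3 : (1 / 4 : ℝ) ≤ (S.card : ℝ)⁻¹ := by
      have hc : (0 : ℝ) < S.card := by exact_mod_cast hS.card_pos
      have hc4 : (S.card : ℝ) ≤ 4 := by
        have := Finset.card_le_card hST
        rw [((M.mem_tets T).1 hT).2] at this
        exact_mod_cast this
      rw [one_div]
      exact inv_anti₀ hc hc4
    have h4 : sizeRatio σ * diam T ≤ diam T₁ :=
      hM.sizeRatio_mul_diam_le hσ hΩ (hSΩ hv) (Triangulation.mem_star.2 ⟨hT, hST hv⟩)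
        (Triangulation.mem_star.2 ⟨hT₁, hS1 hv⟩)
    have h5 : ‖barycenter S - y‖ / (2 * (diam T₁ / σ)) ≤ 1 / 8 := by
      rw [div_le_iff₀ (by positivity)]
      have h6 : ‖barycenter S - y‖ < sizeRatio σ / (4 * σ) * diam T := by
        rw [norm_sub_rev]; exact mem_ball_iff_norm.1 hy
      have h7 : sizeRatio σ / (4 * σ) * diam T = (sizeRatio σ * diam T) / (4 * σ) := by ring
      have h8 : (sizeRatio σ * diam T) / (4 * σ) ≤ diam T₁ / (4 * σ) := by gcongr
      have h9 : diam T₁ / (4 * σ) = 1 / 8 * (2 * (diam T₁ / σ)) := by field_simp; norm_num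
      linarith
    have h6 := (abs_le.1 (h1.trans h5)).2
    linarith
  -- `U₁` is where only cells containing `S` occur, `U₂` where none does. Both are open, they cover
  -- the ball, and they are disjoint within `Ω`; connectedness of the ball then leaves only `U₁`.
  set U₁ : Set E3 := (⋃ T' ∈ M.tets.filter (fun T' => ¬ S ⊆ T'), cell T')ᶜ
  set U₂ : Set E3 := (⋃ T' ∈ M.tets.filter (fun T' => S ⊆ T'), cell T')ᶜ
  have hU₁ : ∀ y, y ∈ U₁ ↔ ∀ T' ∈ M.tets, y ∈ cell T' → S ⊆ T' := by
    intro y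
    simp only [U₁, Set.mem_compl_iff, Set.mem_iUnion, Finset.mem_filter, exists_prop, not_exists,
      not_and]
    exact ⟨fun h T' hT' hy => by_contra fun hn => h T' ⟨hT', hn⟩ hy,
      fun h T' hT' hy => hT'.2 (h T' hT'.1 hy)⟩
  have hU₂ : ∀ y, y ∈ U₂ ↔ ∀ T' ∈ M.tets, S ⊆ T' → y ∉ cell T' := by
    intro y
    simp only [U₂, Set.mem_compl_iff, Set.mem_iUnion, Finset.mem_filter, exists_prop, not_exists,
      not_and]
    exact ⟨fun h T' hT' hS => h T' ⟨hT', hS⟩, fun h T' hT' => h T' hT'.1 hT'.2⟩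
  have hcov : B ⊆ U₁ ∪ U₂ := by
    intro y hy
    by_cases h2 : y ∈ U₂
    · exact Or.inr h2
    · left
      rw [hU₂] at h2
      push Not at h2
      obtain ⟨T₁, hT₁, hS1, hy1⟩ := h2
      exact (hU₁ y).2 (hpos y hy T₁ hT₁ hy1 hS1)
  have hc : barycenter S ∈ B := Metric.mem_ball_self (by positivity)
  have hcS := barycenter_mem_cell hS
  by_contra hSx
  have hx1 : x ∉ U₁ := fun h => hSx ((hU₁ x).1 h T' hT' hxT')
  obtain ⟨y, hy, hy1, hy2⟩ := (convex_ball _ _).isPreconnected U₁ U₂ (hcl _) (hcl _) hcov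
    ⟨_, hc, (hU₁ _).2 (hpos _ hc T hT (cell_mono hST hcS) hST)⟩
    ⟨x, hx, (hcov hx).resolve_left hx1⟩
  obtain ⟨T₁, hT₁, hyT₁⟩ := M.exists_tet_mem (hball hy)
  exact (hU₂ y).1 hy2 T₁ hT₁ ((hU₁ y).1 hy1 T₁ hT₁ hyT₁) hyT₁

end TraceFEM

namespace TraceFEM

variable {Ω : Set E3} {M : Triangulation Ω} {σ : ℝ}

/-! ### Flat boundary pieces inside a tetrahedron -/

/-- The cone condition is used only with apex `x₀`: up to distance `2h'` the undecided region lies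
in a slab of half-width `2δh'`. -/
theorem FlatAt.notMem_of_lt {U : Set E3} {δ r : ℝ} {x₀ ν : E3} (h : FlatAt U δ r x₀ ν) (hδ : 0 < δ)
    (hx₀ : x₀ ∈ frontier U) {h' : ℝ} (hr : 2 * h' < r) {z : E3} (hz : dist z x₀ ≤ 2 * h')
    (hlt : 2 * δ * h' < inner ℝ ν (z - x₀)) : z ∉ U := by
  have h0 := dist_nonneg (x := z) (y := x₀)
  refine (h.2 x₀ hx₀ (by rw [dist_self]; linarith) z (by linarith)).1 (lt_of_le_of_lt ?_ hlt)
  rw [← dist_eq_norm]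
  nlinarith

theorem FlatAt.mem_of_lt {U : Set E3} {δ r : ℝ} {x₀ ν : E3} (h : FlatAt U δ r x₀ ν) (hδ : 0 < δ)
    (hx₀ : x₀ ∈ frontier U) {h' : ℝ} (hr : 2 * h' < r) {z : E3} (hz : dist z x₀ ≤ 2 * h')
    (hlt : inner ℝ ν (z - x₀) < -(2 * δ * h')) : z ∈ U := by
  have h0 := dist_nonneg (x := z) (y := x₀)
  refine (h.2 x₀ hx₀ (by rw [dist_self]; linarith) z (by linarith)).2 (lt_of_lt_of_le hlt ?_)
  rw [← dist_eq_norm]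
  nlinarith

/-- On a line through a point of `U` and a point outside there is a boundary point. -/
theorem exists_frontier_on_line {U : Set E3} {y ν : E3} {s t : ℝ} (hst : s ≤ t)
    (h1 : y + s • ν ∈ U) (h2 : y + t • ν ∉ U) : ∃ τ ∈ Set.Icc s t, y + τ • ν ∈ frontier U := by
  have hc : Continuous fun τ : ℝ => y + τ • ν := by fun_prop
  obtain ⟨_, ⟨τ, hτ, rfl⟩, hz⟩ := IsPreconnected.inter_frontier_nonempty_of_mem
    (U := U) (isPreconnected_Icc.image _ hc.continuousOn (s := Set.Icc s t))
    ⟨_, ⟨s, Set.left_mem_Icc.2 hst, rfl⟩, h1⟩ ⟨_, ⟨t, Set.right_mem_Icc.2 hst, rfl⟩, h2⟩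
  exact ⟨τ, hτ, hz⟩

theorem ofReal_le_of_mul_le {p q : ℝ} {μ : ENNReal} (hq : 0 < q)
    (h : ENNReal.ofReal (p * q) ≤ ENNReal.ofReal q * μ) : ENNReal.ofReal p ≤ μ := by
  rw [mul_comm, ENNReal.ofReal_mul hq.le] at h
  exact (ENNReal.mul_le_mul_iff_right (by simpa using hq) ENNReal.ofReal_ne_top).1 h

/-- If a tetrahedron has points on both sides of the boundary, at distance comparable to its
diameter, then the boundary has a large intersection with it. -/
theorem ShapeRegular.area_of_two_sided (hM : ShapeRegular σ M) (hσ : 0 < σ) {U : Set E3}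
    {δ r ε : ℝ} {x₀ ν : E3} (hflat : FlatAt U δ r x₀ ν) (hδ : 0 < δ) (hε : 0 < ε)
    (hδε : 2 * δ < ε / (4 * σ)) {T : Finset E3} (hT : T ∈ M.tets) (hx₀ : x₀ ∈ frontier U)
    (hx₀T : x₀ ∈ cell T) (hr : 2 * diam T < r) {a b : E3} (ha : a ∈ cell T) (hb : b ∈ cell T)
    (haη : ε * diam T ≤ inner ℝ ν (a - x₀)) (hbη : inner ℝ ν (b - x₀) ≤ -(ε * diam T)) :
    ENNReal.ofReal (ballVol * (ε * diam T / (4 * σ)) ^ 2 / 2) ≤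
      μHE[2] (frontier U ∩ cell T) := by
  have hd := Triangulation.diam_pos hT
  have hνν : (inner ℝ ν ν : ℝ) = 1 := by rw [real_inner_self_eq_norm_sq, hflat.1, one_pow]
  obtain ⟨q, hq⟩ := hM T hT
  have hqT : q ∈ cell T := hq (Metric.mem_closedBall_self (by positivity))
  have hosc : ∀ y ∈ cell T, ∀ z ∈ cell T, inner ℝ ν (y - x₀) - inner ℝ ν (z - x₀) ≤ diam T := by
    intro y hy z hz
    rw [← inner_sub_right, sub_sub_sub_cancel_right]
    refine (real_inner_le_norm _ _).trans ?_
    rw [hflat.1, one_mul, ← dist_eq_norm]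
    exact dist_le_diam hy hz
  -- Shrink the inscribed ball towards `a` or `b`, whichever is opposite to its centre `q`, until
  -- the centre lies on the plane. The ratio is at least `ε`, since that point is at height at least
  -- `ε h_T` and heights in `T` vary by at most `h_T`.
  obtain ⟨c, hc0, hc⟩ : ∃ c, inner ℝ ν (c - x₀) = 0 ∧
      Metric.closedBall c (ε * (diam T / σ)) ⊆ cell T := by
    have main : ∀ p ∈ cell T, ∀ s : ℝ, ε ≤ s → s ≤ 1 →
        s * (inner ℝ ν (p - x₀) - inner ℝ ν (q - x₀)) = inner ℝ ν (p - x₀) →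
        ∃ c, inner ℝ ν (c - x₀) = 0 ∧ Metric.closedBall c (ε * (diam T / σ)) ⊆ cell T := by
      intro p hp s hs hs1 heq
      refine ⟨p + s • (q - p), ?_, ?_⟩
      · have : p + s • (q - p) - x₀ = (p - x₀) - s • ((p - x₀) - (q - x₀)) := by module
        rw [this, inner_sub_right (x := ν) (y := p - x₀), inner_smul_right,
          inner_sub_right (x := ν) (y := p - x₀), heq, sub_self]
      · refine (Metric.closedBall_subset_closedBall ?_).trans
          (closedBall_homothety_subset (convex_cell T) hp hq (hε.trans_le hs) hs1)
        gcongr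
    have hεd : 0 < ε * diam T := by positivity
    rcases le_total (inner ℝ ν (q - x₀)) 0 with hq0 | hq0
    · have hpos : 0 < inner ℝ ν (a - x₀) - inner ℝ ν (q - x₀) := by linarith
      refine main a ha (inner ℝ ν (a - x₀) / (inner ℝ ν (a - x₀) - inner ℝ ν (q - x₀))) ?_ ?_
        (div_mul_cancel₀ _ hpos.ne')
      · rw [le_div_iff₀ hpos]
        nlinarith [hosc a ha q hqT]
      · rw [div_le_one hpos]; linarith
    · have hpos : 0 < inner ℝ ν (q - x₀) - inner ℝ ν (b - x₀) := by linarith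
      refine main b hb (-inner ℝ ν (b - x₀) / (inner ℝ ν (q - x₀) - inner ℝ ν (b - x₀))) ?_ ?_ ?_
      · rw [le_div_iff₀ hpos]
        nlinarith [hosc q hqT b hb]
      · rw [div_le_one hpos]; linarith
      · rw [div_mul_eq_mul_div, div_eq_iff hpos.ne']; ring
  -- A quarter of the radius just found: columns of half-length `2ρ` over the ball of radius `ρ`
  -- stay in `T`, and their ends are at height at least `ρ > 2δh_T`, beyond the slab.
  set ρ := ε * diam T / (4 * σ) with hρ
  have hρ4 : ε * (diam T / σ) = 4 * ρ := by rw [hρ]; field_simp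
  have hρ0 : 0 < ρ := by positivity
  have hρδ : 2 * δ * diam T < ρ := by
    have : ρ = ε / (4 * σ) * diam T := by rw [hρ]; ring
    rw [this]; gcongr
  rw [hρ4] at hc
  have hcol : ∀ y ∈ Metric.closedBall c ρ, ∃ t : ℝ, y + t • ν ∈ frontier U ∩ cell T := by
    intro y hy
    have hin : ∀ t : ℝ, |t| ≤ 2 * ρ → y + t • ν ∈ cell T := by
      intro t ht
      apply hc
      have hy' := mem_closedBall_iff_norm.1 hy
      rw [mem_closedBall_iff_norm, add_sub_right_comm]
      refine (norm_add_le _ _).trans ?_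
      rw [norm_smul, hflat.1, mul_one, Real.norm_eq_abs]
      linarith
    have hval : ∀ t : ℝ, inner ℝ ν (y + t • ν - x₀) = inner ℝ ν (y - c) + t := by
      intro t
      have : y + t • ν - x₀ = (y - c) + (c - x₀) + t • ν := by abel
      rw [this, inner_add_right, inner_add_right, hc0, inner_smul_right, hνν]; ring
    have hyc : |inner ℝ ν (y - c)| ≤ ρ := by
      refine (abs_real_inner_le_norm _ _).trans ?_
      rw [hflat.1, one_mul]
      exact mem_closedBall_iff_norm.1 hy
    rw [abs_le] at hyc
    have hdist : ∀ z ∈ cell T, dist z x₀ ≤ 2 * diam T := fun z hz => by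
      linarith [dist_le_diam hz hx₀T]
    have h1 : y + (-(2 * ρ)) • ν ∈ U := by
      refine hflat.mem_of_lt hδ hx₀ hr (hdist _ (hin _ ?_)) ?_
      · rw [abs_neg, abs_of_pos (by positivity)]
      · rw [hval]; linarith
    have h2 : y + (2 * ρ) • ν ∉ U := by
      refine hflat.notMem_of_lt hδ hx₀ hr (hdist _ (hin _ ?_)) ?_
      · rw [abs_of_pos (by positivity)]
      · rw [hval]; linarith
    obtain ⟨t, ht, hz⟩ := exists_frontier_on_line (by linarith) h1 h2
    exact ⟨t, hz, hin t (abs_le.2 ht)⟩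
  have key := volume_le_of_columns hflat.1 ((isCompact_cell T).inter_left isClosed_frontier)
    (subset_refl (Metric.closedBall c ρ)) hcol
  rw [volume_closedBall_eq _ hρ0.le] at key
  refine ofReal_le_of_mul_le (q := 2 * ρ) (by positivity) (le_trans (le_of_eq ?_) key)
  congr 1; ring

/-! ### Moving from an arbitrary to a regular tetrahedron -/

/-- The radius, relative to the diameter, of the balls around barycenters of faces that are
contained in the star of the face. -/
noncomputable def starRadius (σ : ℝ) : ℝ := sizeRatio σ / (4 * σ)

theorem starRadius_pos (hσ : 0 < σ) : 0 < starRadius σ :=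
  div_pos (sizeRatio_pos hσ) (by positivity)

theorem starRadius_le (hσ : 2 ≤ σ) : starRadius σ ≤ 1 / 8 := by
  have hσ0 : 0 < σ := by linarith
  rw [starRadius, div_le_iff₀ (by positivity)]
  linarith [sizeRatio_le_one hσ]

/-- The radius, relative to the diameter, of the bundles of lines used to connect tetrahedra. -/
noncomputable def columnRadius (σ : ℝ) : ℝ := starRadius σ / (16 * σ)

theorem columnRadius_pos (hσ : 0 < σ) : 0 < columnRadius σ :=
  div_pos (starRadius_pos hσ) (by positivity)

theorem columnRadius_le (hσ : 2 ≤ σ) : columnRadius σ ≤ starRadius σ / 32 := by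
  have := starRadius_pos (σ := σ) (by linarith)
  unfold columnRadius
  gcongr
  linarith

/-- A face of a tetrahedron `T` lying essentially on the side `U`: it consists of vertices close to
the boundary, and every tetrahedron containing it and meeting `U` meets the boundary. -/
theorem exists_face_near_frontier {U : Set E3} {δ r m : ℝ} {x₀ ν : E3}
    (hflat : FlatAt U δ r x₀ ν) (hδ : 0 < δ) (hδm : δ < m) {T : Finset E3} (hT : T ∈ M.tets)
    (hx₀ : x₀ ∈ frontier U) (hx₀T : x₀ ∈ cell T) (hr : 2 * diam T < r) :
    ∃ S : Finset E3, S.Nonempty ∧ S ⊆ T ∧ (∀ z ∈ cell S, -(m * diam T) ≤ inner ℝ ν (z - x₀)) ∧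
      ∃ z ∈ cell S, z ∉ U ∨ z ∈ frontier U := by
  classical
  have hd := Triangulation.diam_pos hT
  have hm : 0 < m := hδ.trans hδm
  obtain ⟨ℓ, hℓ⟩ := M.exists_bary hT
  have hpos := hℓ.mem_cell_iff.1 hx₀T
  -- The vertices that are not deep below the plane. As `x₀` is a convex combination of the vertices
  -- of `T`, they have to balance the deep ones.
  set S := T.filter fun v => -(m * diam T) ≤ inner ℝ ν (v - x₀) with hS
  have hST : S ⊆ T := Finset.filter_subset _ _
  have hsplit : ∀ f : E3 → E3, ∑ v ∈ T, f v = ∑ v ∈ S, f v + ∑ v ∈ T \ S, f v := fun f => by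
    rw [add_comm, Finset.sum_sdiff hST]
  have hsplit1 : ∑ v ∈ S, ℓ v x₀ + ∑ v ∈ T \ S, ℓ v x₀ = 1 := by
    rw [add_comm, Finset.sum_sdiff hST, hℓ.sum_eq_one]
  have hzero : ∑ v ∈ T, ℓ v x₀ • (v - x₀) = 0 := by
    simp only [smul_sub, Finset.sum_sub_distrib]
    rw [← Finset.sum_smul, hℓ.sum_eq_one, hℓ.sum_smul_eq, one_smul, sub_self]
  set Λ := ∑ v ∈ S, ℓ v x₀ with hΛ
  have hΛc : ∑ v ∈ T \ S, ℓ v x₀ = 1 - Λ := by linarith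
  have hΛc0 : 0 ≤ 1 - Λ := by
    rw [← hΛc]; exact Finset.sum_nonneg fun v hv => hpos v (Finset.mem_sdiff.1 hv).1
  have hΛ0 : 0 ≤ Λ := Finset.sum_nonneg fun v hv => hpos v (hST hv)
  -- `w` is minus the contribution of the deep vertices. Hence `‖w‖ ≤ (1 - Λ) h_T` and `⟪ν, w⟫ ≥ (1
  -- - Λ) m h_T`, so `w` lies in the cone of slope `m > δ`. The point `x₀ + w/Λ` of the face is then
  -- outside `U`, or equals `x₀`.
  set w := ∑ v ∈ S, ℓ v x₀ • (v - x₀) with hw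
  have hw' : w = -∑ v ∈ T \ S, ℓ v x₀ • (v - x₀) := by
    rw [hsplit] at hzero
    exact eq_neg_of_add_eq_zero_left hzero
  have hwnorm : ‖w‖ ≤ (1 - Λ) * diam T := by
    rw [hw', norm_neg, ← hΛc, Finset.sum_mul]
    refine (norm_sum_le _ _).trans (Finset.sum_le_sum fun v hv => ?_)
    have hvT := (Finset.mem_sdiff.1 hv).1
    rw [norm_smul, Real.norm_of_nonneg (hpos v hvT), ← dist_eq_norm]
    exact mul_le_mul_of_nonneg_left (dist_le_diam (subset_cell T hvT) hx₀T) (hpos v hvT)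
  have hwη : (1 - Λ) * (m * diam T) ≤ inner ℝ ν w := by
    rw [hw', inner_neg_right, inner_sum, ← Finset.sum_neg_distrib, ← hΛc, Finset.sum_mul]
    refine Finset.sum_le_sum fun v hv => ?_
    have hv' := Finset.mem_sdiff.1 hv
    have h1 : inner ℝ ν (v - x₀) < -(m * diam T) := by
      by_contra! h
      exact hv'.2 (Finset.mem_filter.2 ⟨hv'.1, h⟩)
    rw [inner_smul_right]
    nlinarith [hpos v hv'.1]
  have hΛpos : 0 < Λ := by
    refine hΛ0.lt_of_ne fun h0 => ?_
    have h1 : w = 0 := by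
      rw [hw]
      refine Finset.sum_eq_zero fun v hv => ?_
      rw [(Finset.sum_eq_zero_iff_of_nonneg fun v hv => hpos v (hST hv)).1 (hΛ ▸ h0.symm) v hv,
        zero_smul]
    rw [h1, inner_zero_right, ← h0] at hwη
    nlinarith
  have hSne : S.Nonempty := by
    rw [Finset.nonempty_iff_ne_empty]
    intro h
    rw [hΛ, h, Finset.sum_empty] at hΛpos
    exact lt_irrefl _ hΛpos
  refine ⟨S, hSne, hST, ?_, ?_⟩
  · have hlin : IsLinearMap ℝ fun z : E3 => (inner ℝ ν z : ℝ) :=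
      ⟨fun a b => inner_add_right _ _ _, fun a b => inner_smul_right _ _ _⟩
    have : cell S ⊆ {z | -(m * diam T) + inner ℝ ν x₀ ≤ inner ℝ ν z} := by
      refine convexHull_min (fun v hv => ?_) (convex_halfSpace_ge hlin _)
      have := (Finset.mem_filter.1 (Finset.mem_coe.1 hv)).2
      rw [inner_sub_right] at this
      rw [Set.mem_ofPred_eq]; linarith
    intro z hz
    have h1 : -(m * diam T) + inner ℝ ν x₀ ≤ inner ℝ ν z := this hz
    rw [inner_sub_right]; linarith
  · set z := ∑ v ∈ S, (Λ⁻¹ * ℓ v x₀) • v with hz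
    have hzS : z ∈ cell S := by
      refine (convex_cell S).sum_mem (fun v hv => mul_nonneg (inv_nonneg.2 hΛ0) (hpos v (hST hv)))
        ?_ fun v hv => subset_cell S hv
      rw [← Finset.mul_sum, ← hΛ, inv_mul_cancel₀ hΛpos.ne']
    have hzw : z - x₀ = Λ⁻¹ • w := by
      rw [hw, hz]
      simp only [smul_sub, Finset.sum_sub_distrib, mul_smul, ← Finset.smul_sum]
      rw [← Finset.sum_smul, ← hΛ, inv_smul_smul₀ hΛpos.ne']
    refine ⟨z, hzS, ?_⟩
    rcases eq_or_ne z x₀ with h0 | h0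
    · exact Or.inr (h0 ▸ hx₀)
    left
    have hzd : dist z x₀ ≤ diam T := dist_le_diam (cell_mono hST hzS) hx₀T
    refine (hflat.2 x₀ hx₀ (by rw [dist_self]; linarith) z (by linarith)).1 ?_
    have hn : 0 < ‖z - x₀‖ := norm_pos_iff.2 (sub_ne_zero.2 h0)
    have h1 : m * ‖z - x₀‖ ≤ inner ℝ ν (z - x₀) := by
      rw [hzw, norm_smul, norm_inv, Real.norm_of_nonneg hΛ0, inner_smul_right, mul_left_comm]
      refine mul_le_mul_of_nonneg_left ?_ (inv_nonneg.2 hΛ0)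
      nlinarith
    nlinarith

/-! ### Bundles of columns ending in a regular element -/

/-- A bundle of line segments in the direction `e` that start in the tetrahedron `T`, end in the
tetrahedron `T'` and only pass through tetrahedra that contain `v` and meet the boundary of `U`. -/
structure IsBundle (U : Set E3) (M : Triangulation Ω) (T T' : Finset E3) (v e : E3) (Y : Set E3) :
    Prop where
  norm_eq_one : ‖e‖ = 1
  mem_star : T ∈ M.star v
  mem_star' : T' ∈ M.star v
  subset : Y ⊆ cell T
  exists_end : ∀ y ∈ Y, ∃ t ∈ Set.Icc 0 (diam T), y + t • e ∈ cell T' ∧ ∀ s ∈ Set.Icc 0 t,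
    y + s • e ∈ Ω ∧ ∀ T'' ∈ M.tets, y + s • e ∈ cell T'' →
      v ∈ T'' ∧ (frontier U ∩ cell T'').Nonempty

/-- Through a tetrahedron `T` lying essentially on the side `U` there is a bundle of segments in the
direction `ν` which end on the boundary and stay in the star of a face of `T`. -/
theorem ShapeRegular.exists_columns (hM : ShapeRegular σ M) (hσ : 2 ≤ σ) (hΩ : IsOpen Ω)
    {U : Set E3} {δ r : ℝ} {x₀ ν : E3} (hflat : FlatAt U δ r x₀ ν) (hδ : 0 < δ)
    (hδσ : δ < columnRadius σ / 4) {T : Finset E3} (hT : T ∈ M.tets) (hx₀ : x₀ ∈ frontier U)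
    (hx₀T : x₀ ∈ cell T) (hr : 2 * diam T < r) (hxΩ : Metric.closedBall x₀ (2 * diam T) ⊆ Ω)
    (hη : ∀ x ∈ cell T, inner ℝ ν (x - x₀) ≤ columnRadius σ / 2 * diam T) :
    ∃ v ∈ T, ∃ b, Metric.closedBall b (columnRadius σ * diam T) ⊆ cell T ∧
      ∀ y ∈ Metric.closedBall b (columnRadius σ * diam T), ∃ t ∈ Set.Icc 0 (diam T),
        y + t • ν ∈ frontier U ∧ ∀ s ∈ Set.Icc 0 t, y + s • ν ∈ Ω ∧ ∀ T'' ∈ M.tets,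
          y + s • ν ∈ cell T'' → v ∈ T'' ∧ (frontier U ∩ cell T'').Nonempty := by
  classical
  have hσ0 : 0 < σ := by linarith
  have hd := Triangulation.diam_pos hT
  set h := diam T
  set c₁ := starRadius σ with hc₁
  set c₂ := columnRadius σ with hc₂
  have hc₁0 : 0 < c₁ := starRadius_pos hσ0
  have hc₁8 : c₁ ≤ 1 / 8 := starRadius_le hσ
  have hc₂0 : 0 < c₂ := columnRadius_pos hσ0
  have hc₂1 : c₂ ≤ c₁ / 32 := columnRadius_le hσ
  have hνν : (inner ℝ ν ν : ℝ) = 1 := by rw [real_inner_self_eq_norm_sq, hflat.1, one_pow]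
  obtain ⟨S, hSne, hST, hSη, z', hz'S, hz'U⟩ := exists_face_near_frontier (m := c₁ / 8) hflat hδ
    (by linarith) hT hx₀ hx₀T hr
  obtain ⟨v, hv⟩ := hSne
  have hSne : S.Nonempty := ⟨v, hv⟩
  set z := barycenter S with hz
  have hzS : z ∈ cell S := barycenter_mem_cell hSne
  have hzT : z ∈ cell T := cell_mono hST hzS
  have hball : Metric.ball z (c₁ * h) ⊆ Ω := by
    refine Set.Subset.trans (fun y hy => ?_) hxΩ
    rw [Metric.mem_closedBall]
    have h1 := dist_triangle y z x₀
    have h2 := dist_le_diam hzT hx₀T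
    have h3 : dist y z < c₁ * h := hy
    nlinarith
  have hcellΩ : cell T ⊆ Ω := by
    refine Set.Subset.trans (fun y hy => ?_) hxΩ
    rw [Metric.mem_closedBall]
    linarith [dist_le_diam hy hx₀T]
  have hstar : ∀ x ∈ Metric.ball z (c₁ * h), ∀ T'' ∈ M.tets, x ∈ cell T'' → S ⊆ T'' :=
    fun x hx T'' hT'' hxT'' => hM.subset_of_mem_ball hσ hΩ hT hSne hST hball
      (fun w hw => hcellΩ (subset_cell T (hST hw))) hx hT'' hxT''
  obtain ⟨b, hbz, hbT⟩ := hM.exists_small_ball hσ0 hT hzT (s := c₁ / 8) (by positivity)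
    (by linarith)
  -- This determines `columnRadius`: the inscribed ball, shrunk towards the barycenter by `c₁/8`,
  -- has twice that radius, leaving a margin for moving in the direction `ν`.
  have hrad : c₁ / 8 * (h / σ) = 2 * (c₂ * h) := by
    rw [hc₂, columnRadius, ← hc₁]; field_simp; norm_num
  rw [hrad] at hbT
  set τ := c₁ / 2 * h with hτ
  have hτ0 : 0 < τ := by positivity
  set Y₀ := Metric.closedBall b (c₂ * h) with hY₀
  have hmemT : ∀ y ∈ Y₀, ∀ s : ℝ, |s| ≤ c₂ * h → y + s • ν ∈ cell T := by
    intro y hy s hs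
    apply hbT
    rw [mem_closedBall_iff_norm, add_sub_right_comm]
    refine (norm_add_le _ _).trans ?_
    rw [norm_smul, hflat.1, mul_one, Real.norm_eq_abs]
    linarith [mem_closedBall_iff_norm.1 hy]
  have hY₀T : Y₀ ⊆ cell T := fun y hy => by
    simpa using hmemT y hy 0 (by rw [abs_zero]; positivity)
  have hval : ∀ (y : E3) (s : ℝ), inner ℝ ν (y + s • ν - x₀) = inner ℝ ν (y - x₀) + s := by
    intro y s
    rw [add_sub_right_comm, inner_add_right, inner_smul_right, hνν, mul_one]
  have hdyz : ∀ y ∈ Y₀, dist y z ≤ c₁ / 4 * h := by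
    intro y hy
    have h1 := dist_triangle y b z
    have h2 : dist y b ≤ c₂ * h := hy
    nlinarith
  -- Since `y + c₂hν` is still in `T`, its height is at most `c₂h/2`; so `y` has height at most
  -- `-c₂h/2 < -2δh`.
  have hYU : ∀ y ∈ Y₀, y ∈ U := by
    intro y hy
    refine hflat.mem_of_lt hδ hx₀ hr (by linarith [dist_le_diam (hY₀T hy) hx₀T]) ?_
    have h1 := hη _ (hmemT y hy (c₂ * h) (by rw [abs_of_pos (by positivity)]))
    rw [hval] at h1
    nlinarith
  have hpath : ∀ y ∈ Y₀, ∀ s ∈ Set.Icc 0 τ, y + s • ν ∈ Metric.ball z (c₁ * h) := by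
    intro y hy s hs
    rw [mem_ball_iff_norm, add_sub_right_comm]
    refine lt_of_le_of_lt (norm_add_le _ _) ?_
    rw [norm_smul, hflat.1, mul_one, Real.norm_of_nonneg hs.1, ← dist_eq_norm]
    have := hdyz y hy
    have := hs.2
    nlinarith
  -- The height at the end is at least `-c₁h/8 - c₁h/4 + c₁h/2 = c₁h/8`, above the slab.
  have hYout : ∀ y ∈ Y₀, y + τ • ν ∉ U := by
    intro y hy
    refine hflat.notMem_of_lt hδ hx₀ hr ?_ ?_
    · have h1 := dist_triangle (y + τ • ν) z x₀
      have h2 : dist (y + τ • ν) z < c₁ * h := hpath y hy τ ⟨hτ0.le, le_rfl⟩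
      have h3 := dist_le_diam hzT hx₀T
      nlinarith
    · have h1 := hSη z hzS
      have h2 : inner ℝ ν (y - x₀) = inner ℝ ν (z - x₀) - inner ℝ ν (z - y) := by
        rw [← inner_sub_right]; congr 1; abel
      have h3 := real_inner_le_norm ν (z - y)
      rw [hflat.1, one_mul, ← dist_eq_norm, dist_comm] at h3
      have h4 := hdyz y hy
      rw [hval, h2, hτ]
      nlinarith
  -- The column is stopped at its first frontier point. Before that it is in `U`, so a cell it
  -- crosses contains a point of `U` and, through `S`, the point `z'` on or beyond the frontier; it
  -- therefore meets the frontier.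
  have hexit : ∀ y ∈ Y₀, ∃ t ∈ Set.Icc 0 τ, y + t • ν ∈ frontier U ∧
      ∀ s ∈ Set.Ico 0 t, y + s • ν ∈ U := by
    intro y hy
    have hc : Continuous fun s : ℝ => y + s • ν := by fun_prop
    have hcomp : IsCompact (Set.Icc 0 τ ∩ (fun s : ℝ => y + s • ν) ⁻¹' frontier U) :=
      isCompact_Icc.inter_right (isClosed_frontier.preimage hc)
    obtain ⟨t₀, ht₀, hft₀⟩ := exists_frontier_on_line (ν := ν) hτ0.le (by rw [zero_smul, add_zero]; exact hYU y hy)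
      (hYout y hy)
    obtain ⟨t, ⟨ht, hft⟩, hmin⟩ := hcomp.exists_isLeast ⟨t₀, ht₀, hft₀⟩
    refine ⟨t, ht, hft, fun s hs => ?_⟩
    by_contra hsU
    obtain ⟨t₁, ht₁, hft₁⟩ := exists_frontier_on_line (ν := ν) hs.1 (by rw [zero_smul, add_zero]; exact hYU y hy) hsU
    exact (hmin ⟨⟨ht₁.1, by linarith [ht₁.2, hs.2, ht.2]⟩, hft₁⟩).not_gt (ht₁.2.trans_lt hs.2)
  refine ⟨v, hST hv, b, hY₀T, fun y hy => ?_⟩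
  obtain ⟨t, ht, hft, htU⟩ := hexit y hy
  refine ⟨t, ⟨ht.1, ht.2.trans (by rw [hτ]; nlinarith)⟩, hft, fun s hs => ?_⟩
  have hs' := hpath y hy s ⟨hs.1, hs.2.trans ht.2⟩
  refine ⟨hball hs', fun T'' hT'' hyT'' => ?_⟩
  have hST'' := hstar _ hs' T'' hT'' hyT''
  refine ⟨hST'' hv, ?_⟩
  rcases hs.2.eq_or_lt with h1 | h1
  · exact ⟨_, h1 ▸ hft, hyT''⟩
  · rcases hz'U with h2 | h2
    · rw [Set.inter_comm]
      exact IsPreconnected.inter_frontier_nonempty_of_mem (convex_cell T'').isPreconnected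
        ⟨_, hyT'', htU s ⟨hs.1, h1⟩⟩ ⟨z', cell_mono hST'' hz'S, h2⟩
    · exact ⟨z', h2, cell_mono hST'' hz'S⟩

/-- Pigeonhole over the star: one of at most `σ³` cells receives the ends of a fraction `1/σ³` of
the columns by volume, and the column inequality turns this volume into surface area inside that
cell. -/
theorem ShapeRegular.exists_bundle_of_le (hM : ShapeRegular σ M) (hσ : 2 ≤ σ) (hΩ : IsOpen Ω)
    {U : Set E3} {δ r : ℝ} {x₀ ν : E3} (hflat : FlatAt U δ r x₀ ν) (hδ : 0 < δ)
    (hδσ : δ < columnRadius σ / 4) {T : Finset E3} (hT : T ∈ M.tets) (hx₀ : x₀ ∈ frontier U)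
    (hx₀T : x₀ ∈ cell T) (hr : 2 * diam T < r) (hxΩ : Metric.closedBall x₀ (2 * diam T) ⊆ Ω)
    (hη : ∀ x ∈ cell T, inner ℝ ν (x - x₀) ≤ columnRadius σ / 2 * diam T) :
    ∃ T' v Y, IsBundle U M T T' v ν Y ∧
      ENNReal.ofReal (ballVol * (columnRadius σ * diam T) ^ 3 / σ ^ 3) ≤ volume Y ∧
      ENNReal.ofReal (ballVol * (columnRadius σ * diam T) ^ 2 / (2 * σ ^ 3)) ≤
        μHE[2] (frontier U ∩ cell T') := by
  have hσ0 : 0 < σ := by linarith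
  have hd := Triangulation.diam_pos hT
  have hω := ballVol_pos
  obtain ⟨v, hv, b, hbT, hcol⟩ := hM.exists_columns hσ hΩ hflat hδ hδσ hT hx₀ hx₀T hr hxΩ hη
  obtain ⟨ρ, hρ⟩ : ∃ ρ, ρ = columnRadius σ * diam T := ⟨_, rfl⟩
  have hρ0 : 0 < ρ := hρ ▸ mul_pos (columnRadius_pos hσ0) hd
  rw [← hρ] at hbT hcol ⊢
  choose! t ht hft hpath using hcol
  -- The end points are chosen without measurability, so these sets may be non-measurable; only
  -- subadditivity of the outer measure is used.
  let Y : Finset E3 → Set E3 := fun T' => {y ∈ Metric.closedBall b ρ | y + t y • ν ∈ cell T'}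
  have hcov : Metric.closedBall b ρ ⊆ ⋃ T' ∈ M.star v, Y T' := by
    intro y hy
    obtain ⟨h1, h2⟩ := hpath y hy (t y) (Set.right_mem_Icc.2 (ht y hy).1)
    obtain ⟨T', hT', hyT'⟩ := M.exists_tet_mem h1
    exact Set.mem_biUnion (Triangulation.mem_star.2 ⟨hT', (h2 T' hT' hyT').1⟩) ⟨hy, hyT'⟩
  have hTv : T ∈ M.star v := Triangulation.mem_star.2 ⟨hT, hv⟩
  obtain ⟨T', hT', hvol⟩ : ∃ T' ∈ M.star v,
      ENNReal.ofReal (ballVol * ρ ^ 3 / σ ^ 3) ≤ volume (Y T') := by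
    by_contra! hlt
    have h1 : volume (Metric.closedBall b ρ) ≤ ∑ T' ∈ M.star v, volume (Y T') :=
      (measure_mono hcov).trans (measure_biUnion_finset_le _ _)
    have h2 : ∑ T' ∈ M.star v, volume (Y T') <
        ∑ _T' ∈ M.star v, ENNReal.ofReal (ballVol * ρ ^ 3 / σ ^ 3) :=
      ENNReal.sum_lt_sum_of_nonempty ⟨T, hTv⟩ hlt
    rw [Finset.sum_const, nsmul_eq_mul, ← ENNReal.ofReal_natCast,
      ← ENNReal.ofReal_mul (by positivity)] at h2
    have h3 := h1.trans_lt h2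
    rw [volume_closedBall_eq _ hρ0.le, ENNReal.ofReal_lt_ofReal_iff'] at h3
    have h4 := hM.card_star_le hσ0 v
    have h5 : ((M.star v).card : ℝ) * (ballVol * ρ ^ 3 / σ ^ 3) ≤
        σ ^ 3 * (ballVol * ρ ^ 3 / σ ^ 3) := by gcongr
    rw [mul_div_cancel₀ _ (by positivity)] at h5
    exact absurd h3.1 (not_lt.2 h5)
  refine ⟨T', v, Y T', ⟨hflat.1, hTv, hT', fun y hy => hbT hy.1, fun y hy =>
    ⟨t y, ht y hy.1, hy.2, hpath y hy.1⟩⟩, hvol, ?_⟩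
  have key := volume_le_of_columns hflat.1 ((isCompact_cell T').inter_left isClosed_frontier)
    (Y := Y T') (y₀ := b) (ρ := ρ) (fun y hy => hy.1) (fun y hy => ⟨t y, hft y hy.1, hy.2⟩)
  refine ofReal_le_of_mul_le (q := 2 * ρ) (by positivity) (le_trans (le_of_eq ?_)
    (hvol.trans key))
  congr 1; field_simp

/-- The threshold for the area of the intersections with regular elements. -/
noncomputable def areaThreshold (σ : ℝ) : ℝ :=
  -- The first entry comes from elements reaching both sides, with `ε = columnRadius σ / 2`; the
  -- second from receiving elements, whose diameter may be larger by the factor `1 / sizeRatio σ`.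
  min (ballVol * (columnRadius σ / 2 / (4 * σ)) ^ 2 / 2)
    (ballVol * (columnRadius σ * sizeRatio σ) ^ 2 / (2 * σ ^ 3))

theorem areaThreshold_pos (hσ : 0 < σ) : 0 < areaThreshold σ := by
  have := ballVol_pos
  have := columnRadius_pos hσ
  have := sizeRatio_pos hσ
  exact lt_min (by positivity) (by positivity)

theorem mem_active {D : Set E3} {T : Finset E3} :
    T ∈ active D M ↔ T ∈ M.tets ∧ (frontier D ∩ cell T).Nonempty := by simp [active]

theorem mem_regular {D : Set E3} {chat : ℝ} {T : Finset E3} : T ∈ regular D chat M ↔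
    T ∈ active D M ∧ ENNReal.ofReal (chat * diam T ^ 2) ≤ μHE[2] (frontier D ∩ cell T) := by
  simp [regular]

/-- Every active tetrahedron is regular, or it is connected to a regular one by a bundle of line
segments, nearly normal to the boundary, inside the active domain. -/
theorem ShapeRegular.regular_or_exists_bundle (hM : ShapeRegular σ M) (hσ : 2 ≤ σ) (hΩ : IsOpen Ω)
    {D : Set E3} {δ r chat : ℝ} (hchat : 0 < chat) (hchat' : chat ≤ areaThreshold σ) {x₀ ν : E3}
    (hflat : FlatAt D δ r x₀ ν) (hδ : 0 < δ) (hδσ : δ < columnRadius σ / (32 * σ)) {T : Finset E3}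
    (hT : T ∈ M.tets) (hx₀ : x₀ ∈ frontier D) (hx₀T : x₀ ∈ cell T) (hr : 2 * diam T < r)
    (hxΩ : Metric.closedBall x₀ (2 * diam T) ⊆ Ω) :
    T ∈ regular D chat M ∨ ∃ T' ∈ regular D chat M, ∃ v e Y, (e = ν ∨ e = -ν) ∧
      IsBundle D M T T' v e Y ∧
      ENNReal.ofReal (ballVol * (columnRadius σ * diam T) ^ 3 / σ ^ 3) ≤ volume Y := by
  have hσ0 : 0 < σ := by linarith
  have hc := columnRadius_pos hσ0
  have ha := sizeRatio_pos hσ0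
  have hω := ballVol_pos
  have hd := Triangulation.diam_pos hT
  have hcδ : columnRadius σ / (32 * σ) ≤ columnRadius σ / 4 := by gcongr; linarith
  have hreg : ∀ {U : Set E3}, frontier U = frontier D → ∀ {T' : Finset E3} {v e : E3} {Y : Set E3},
      IsBundle U M T T' v e Y →
      ENNReal.ofReal (ballVol * (columnRadius σ * diam T) ^ 2 / (2 * σ ^ 3)) ≤
        μHE[2] (frontier U ∩ cell T') → T' ∈ regular D chat M := by
    intro U hU T' v e Y hB harea
    rw [hU] at harea
    have hT' := Triangulation.mem_star.1 hB.mem_star'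
    have hd' := Triangulation.diam_pos hT'.1
    have hxv : v ∈ Ω := hxΩ (by
      rw [Metric.mem_closedBall]
      linarith [dist_le_diam (subset_cell T (Triangulation.mem_star.1 hB.mem_star).2) hx₀T])
    have hsize := hM.sizeRatio_mul_diam_le hσ hΩ hxv hB.mem_star' hB.mem_star
    have hle : ENNReal.ofReal (chat * diam T' ^ 2) ≤ μHE[2] (frontier D ∩ cell T') := by
      refine le_trans (ENNReal.ofReal_le_ofReal ?_) harea
      calc chat * diam T' ^ 2
          ≤ (ballVol * (columnRadius σ * sizeRatio σ) ^ 2 / (2 * σ ^ 3)) * diam T' ^ 2 := by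
            gcongr
            exact hchat'.trans (min_le_right _ _)
        _ = ballVol * (columnRadius σ * (sizeRatio σ * diam T')) ^ 2 / (2 * σ ^ 3) := by ring
        _ ≤ _ := by gcongr
    refine mem_regular.2 ⟨mem_active.2 ⟨hT'.1, ?_⟩, hle⟩
    rw [Set.nonempty_iff_ne_empty]
    intro h0
    rw [h0, measure_empty, nonpos_iff_eq_zero, ENNReal.ofReal_eq_zero] at hle
    nlinarith [show 0 < chat * diam T' ^ 2 by positivity]
  by_cases hup : ∀ x ∈ cell T, inner ℝ ν (x - x₀) ≤ columnRadius σ / 2 * diam T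
  · right
    obtain ⟨T', v, Y, hB, hvol, harea⟩ := hM.exists_bundle_of_le hσ hΩ hflat hδ
      (hδσ.trans_le hcδ) hT hx₀ hx₀T hr hxΩ hup
    exact ⟨T', hreg rfl hB harea, v, ν, Y, Or.inl rfl, hB, hvol⟩
  by_cases hdown : ∀ x ∈ cell T, inner ℝ (-ν) (x - x₀) ≤ columnRadius σ / 2 * diam T
  · right
    obtain ⟨T', v, Y, hB, hvol, harea⟩ := hM.exists_bundle_of_le hσ hΩ hflat.compl hδ
      (hδσ.trans_le hcδ) hT (by rwa [frontier_compl]) hx₀T hr hxΩ hdown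
    refine ⟨T', hreg (frontier_compl D) hB harea, v, -ν, Y, Or.inr rfl, ?_, hvol⟩
    refine ⟨hB.norm_eq_one, hB.mem_star, hB.mem_star', hB.subset, ?_⟩
    simpa only [frontier_compl] using hB.exists_end
  · left
    push Not at hup hdown
    obtain ⟨a, ha, haη⟩ := hup
    obtain ⟨b, hb, hbη⟩ := hdown
    rw [inner_neg_left] at hbη
    have harea := hM.area_of_two_sided hσ0 hflat hδ (ε := columnRadius σ / 2) (by positivity)
      (by
        have : columnRadius σ / 2 / (4 * σ) = 4 * (columnRadius σ / (32 * σ)) := by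
          field_simp; norm_num
        rw [this]
        have : 0 < columnRadius σ / (32 * σ) := by positivity
        linarith)
      hT hx₀ hx₀T hr ha hb haη.le (by linarith)
    refine mem_regular.2 ⟨mem_active.2 ⟨hT, x₀, hx₀, hx₀T⟩, le_trans (ENNReal.ofReal_le_ofReal ?_)
      harea⟩
    calc chat * diam T ^ 2 ≤ (ballVol * (columnRadius σ / 2 / (4 * σ)) ^ 2 / 2) * diam T ^ 2 := by
          gcongr
          exact hchat'.trans (min_le_left _ _)
      _ = _ := by ring

end TraceFEM

namespace TraceFEM

variable {Ω : Set E3} {M : Triangulation Ω} {σ : ℝ}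

/-! ### Finite element functions along segments -/

/-- `p` is a family of polynomials of degree at most `k` that represent `q` on the active mesh. -/
structure IsPieces (D : Set E3) (M : Triangulation Ω) (k : ℕ) (q : E3 → ℝ)
    (p : Finset E3 → MvPolynomial (Fin 3) ℝ) : Prop where
  totalDegree_le : ∀ T ∈ active D M, (p T).totalDegree ≤ k
  eq_polyEval : ∀ T ∈ active D M, ∀ x ∈ cell T, x ∈ activeDomain D M → q x = polyEval (p T) x

theorem IsFE.exists_isPieces {D : Set E3} {k : ℕ} {q : E3 → ℝ} (hq : IsFE D M k q) :
    ∃ p, IsPieces D M k q p := by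
  choose! p hp using hq.2
  exact ⟨p, fun T hT => (hp T hT).1, fun T hT x hx hxa => (hp T hT).2 x ⟨hx, hxa⟩⟩

theorem hasDerivAt_polyEval_line (p : MvPolynomial (Fin 3) ℝ) (y e : E3) (s : ℝ) :
    HasDerivAt (fun s : ℝ => polyEval p (y + s • e)) (polyEval (polyDir e p) (y + s • e)) s := by
  have h1 : HasDerivAt (fun s : ℝ => y + s • e) e s := by
    simpa using ((hasDerivAt_id s).smul_const e).const_add y
  have h2 := (hasFDerivAt_polyEval p (y + s • e)).comp_hasDerivAt s h1
  rw [polyEval_polyDir, real_inner_comm]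
  exact h2

theorem abs_polyEval_line_sub_le {p : MvPolynomial (Fin 3) ℝ} {y e : E3} {t L : ℝ}
    (hL : ∀ s ∈ Set.Icc 0 t, |polyEval (polyDir e p) (y + s • e)| ≤ L) {s s' : ℝ}
    (hs : s ∈ Set.Icc 0 t) (hs' : s' ∈ Set.Icc 0 t) :
    |polyEval p (y + s' • e) - polyEval p (y + s • e)| ≤ L * |s' - s| :=
  (convex_Icc 0 t).norm_image_sub_le_of_norm_hasDerivWithin_le
    (fun x _ => (hasDerivAt_polyEval_line p y e x).hasDerivWithinAt) hL hs hs'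

/-- A finite element function changes by at most `L t` along a segment of length `t` on which the
directional derivatives of its pieces are bounded by `L`. -/
theorem IsPieces.abs_sub_le {D : Set E3} {k : ℕ} {q : E3 → ℝ}
    {p : Finset E3 → MvPolynomial (Fin 3) ℝ} (hp : IsPieces D M k q p) (hΩ : IsOpen Ω)
    (hq : ContinuousOn q (activeDomain D M)) {y e : E3} {t L : ℝ} (ht : 0 ≤ t)
    {𝒮 : Finset (Finset E3)} (h𝒮 : 𝒮 ⊆ active D M)
    (hpath : ∀ s ∈ Set.Icc 0 t, y + s • e ∈ Ω ∧ ∀ T ∈ M.tets, y + s • e ∈ cell T → T ∈ 𝒮)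
    (hL : ∀ T ∈ 𝒮, ∀ s ∈ Set.Icc 0 t, |polyEval (polyDir e (p T)) (y + s • e)| ≤ L) :
    |q (y + t • e) - q y| ≤ L * t := by
  have hact : ∀ s ∈ Set.Icc 0 t, y + s • e ∈ activeDomain D M := fun s hs =>
    M.mem_activeDomain hΩ (hpath s hs).1 fun T hT hx => h𝒮 ((hpath s hs).2 T hT hx)
  have hc : Continuous fun s : ℝ => y + s • e := by fun_prop
  have hf : ContinuousOn (fun s : ℝ => |q (y + s • e) - q y| - L * s) (Set.Icc 0 t) :=
    ((hq.comp hc.continuousOn hact).sub continuousOn_const).abs.sub (by fun_prop)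
  have hsub : Set.Icc 0 t ⊆ {s : ℝ | |q (y + s • e) - q y| - L * s ≤ 0} := by
    -- Continuous induction along the segment. Just beyond `s`, any cell containing the new point
    -- also contains the point at `s`, so a single polynomial piece controls the increment.
    refine IsClosed.Icc_subset_of_forall_exists_gt ?_ (by simp) ?_
    · rw [Set.inter_comm]
      exact hf.preimage_isClosed_of_isClosed isClosed_Icc isClosed_Iic
    · rintro s ⟨hs, hs0, hst⟩ u hu
      have hsI : s ∈ Set.Icc 0 t := ⟨hs0, hst.le⟩
      have h1 : ∀ᶠ s' in 𝓝 s, ∀ T ∈ M.tets, y + s' • e ∈ cell T → y + s • e ∈ cell T :=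
        (hc.tendsto s).eventually (M.eventually_mem_imp _)
      have h2 : ∀ᶠ s' in 𝓝[>] s, s' ∈ Set.Ioc s (min u t) :=
        Ioc_mem_nhdsGT (lt_min hu hst)
      obtain ⟨s', hs'1, hs'2⟩ := ((h1.filter_mono nhdsWithin_le_nhds).and h2).exists
      have hs't : s' ∈ Set.Icc 0 t :=
        ⟨hs0.trans hs'2.1.le, hs'2.2.trans (min_le_right _ _)⟩
      refine ⟨s', ?_, hs'2.1, hs'2.2.trans (min_le_left _ _)⟩
      obtain ⟨T, hT, hxT⟩ := M.exists_tet_mem (hpath s' hs't).1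
      have hT𝒮 := (hpath s' hs't).2 T hT hxT
      have h3 := abs_polyEval_line_sub_le (hL T hT𝒮) hsI hs't
      rw [← hp.eq_polyEval T (h𝒮 hT𝒮) _ hxT (hact s' hs't),
        ← hp.eq_polyEval T (h𝒮 hT𝒮) _ (hs'1 T hT hxT) (hact s hsI),
        abs_of_pos (sub_pos.2 hs'2.1)] at h3
      have h4 := _root_.abs_sub_le (q (y + s' • e)) (q (y + s • e)) (q y)
      have hs'' : |q (y + s • e) - q y| - L * s ≤ 0 := hs
      change |q (y + s' • e) - q y| - L * s' ≤ 0
      linarith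
  have h5 : |q (y + t • e) - q y| - L * t ≤ 0 := hsub (Set.right_mem_Icc.2 ht)
  linarith

theorem norm_polyGrad_sq (p : MvPolynomial (Fin 3) ℝ) (x : E3) :
    ‖polyGrad p x‖ ^ 2 = ∑ i, polyEval (MvPolynomial.pderiv i p) x ^ 2 := by
  rw [EuclideanSpace.norm_eq, Real.sq_sqrt (by positivity)]
  simp [polyGrad]

theorem integrableOn_cell {f : E3 → ℝ} (hf : Continuous f) (T : Finset E3) :
    IntegrableOn f (cell T) := hf.continuousOn.integrableOn_compact (isCompact_cell T)

open Classical in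
/-- The active tetrahedra with vertex `v`. -/
noncomputable def activeStar (D : Set E3) (M : Triangulation Ω) (v : E3) : Finset (Finset E3) :=
  (M.star v).filter fun T => T ∈ active D M

theorem mem_activeStar {D : Set E3} {v : E3} {T : Finset E3} :
    T ∈ activeStar D M v ↔ T ∈ M.star v ∧ T ∈ active D M := by simp [activeStar]

/-- The gradient on a tetrahedron is controlled by the gradient on a tetrahedron to which it is
connected by a bundle of segments, and by the derivatives in the direction of these segments. -/
theorem exists_gradient_transfer (hσ : 2 ≤ σ) (k : ℕ) : ∃ C > 0, ∀ {Ω : Set E3}, IsOpen Ω →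
    ∀ {M : Triangulation Ω}, ShapeRegular σ M → ∀ {D : Set E3} {q : E3 → ℝ}
      {p : Finset E3 → MvPolynomial (Fin 3) ℝ}, IsPieces D M k q p →
      ContinuousOn q (activeDomain D M) →
    ∀ {T T' : Finset E3} {v e : E3} {Y : Set E3}, T ∈ active D M → T' ∈ active D M → v ∈ Ω →
      IsBundle D M T T' v e Y →
      ENNReal.ofReal (ballVol * (columnRadius σ * diam T) ^ 3 / σ ^ 3) ≤ volume Y →
      ∫ x in cell T, ‖polyGrad (p T) x‖ ^ 2 ≤ C * ((∫ x in cell T', ‖polyGrad (p T') x‖ ^ 2) +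
        ∑ S ∈ activeStar D M v, ∫ x in cell S, inner ℝ e (polyGrad (p S) x) ^ 2) := by
  have hσ0 : 0 < σ := by linarith
  obtain ⟨a, ha⟩ : ∃ a, a = sizeRatio σ := ⟨_, rfl⟩
  have ha0 : 0 < a := ha ▸ sizeRatio_pos hσ0
  have ha1 : a ≤ 1 := ha ▸ sizeRatio_le_one hσ
  -- Cells of the star have diameter at most `h/a` and columns stay within `2h` of `v`, so the ball
  -- of radius `Rh` about `v` contains them all.
  obtain ⟨R, hR⟩ : ∃ R, R = 2 / a := ⟨_, rfl⟩
  have hR2 : 2 ≤ R := by rw [hR, le_div_iff₀ ha0]; linarith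
  have hω := ballVol_pos
  have hc := columnRadius_pos hσ0
  obtain ⟨C₁, hC₁, H₁⟩ := exists_sq_le_integral k R (ρ := a / σ) (by positivity)
  obtain ⟨C₂, hC₂, H₂⟩ := exists_remez k R (ε := ballVol * columnRadius σ ^ 3 / σ ^ 3)
    (by positivity)
  refine ⟨ballVol * (2 * C₁ + 8 * C₂ ^ 2 * C₁), by positivity, ?_⟩
  intro Ω hΩ M hM D q p hp hq T T' v e Y hT hT' hv hB hvol
  have hTs := Triangulation.mem_star.1 hB.mem_star
  have hd := Triangulation.diam_pos hTs.1
  obtain ⟨h, hh⟩ : ∃ h, h = diam T := ⟨_, rfl⟩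
  rw [← hh] at hd hvol
  have hvT : v ∈ cell T := subset_cell T hTs.2
  have hsub : ∀ S ∈ M.star v, cell S ⊆ Metric.closedBall v (R * h) := by
    intro S hS x hx
    have h1 := hM.sizeRatio_mul_diam_le hσ hΩ hv hS hB.mem_star
    have h2 := dist_le_diam hx (subset_cell S (Triangulation.mem_star.1 hS).2)
    rw [← ha, ← hh] at h1
    rw [Metric.mem_closedBall, hR, div_mul_eq_mul_div, le_div_iff₀ ha0]
    nlinarith
  have hsup : ∀ S ∈ M.star v, ∀ g : MvPolynomial (Fin 3) ℝ, g.totalDegree ≤ k →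
      ∀ x ∈ Metric.closedBall v (R * h),
        polyEval g x ^ 2 ≤ C₁ / h ^ 3 * ∫ y in cell S, polyEval g y ^ 2 := by
    intro S hS g hg x hx
    obtain ⟨b, hb⟩ := hM S (Triangulation.mem_star.1 hS).1
    have h1 := hM.sizeRatio_mul_diam_le hσ hΩ hv hB.mem_star hS
    rw [← ha, ← hh] at h1
    have hb' : Metric.closedBall b (a / σ * h) ⊆ cell S := by
      refine (Metric.closedBall_subset_closedBall ?_).trans hb
      rw [div_mul_eq_mul_div]; gcongr
    refine (H₁ g hg v h hd b (hb'.trans (hsub S hS)) x hx).trans ?_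
    gcongr
    · exact Filter.Eventually.of_forall fun _ => sq_nonneg _
    · exact integrableOn_cell ((continuous_polyEval g).pow 2) S
  set I := ∑ S ∈ activeStar D M v, ∫ x in cell S, inner ℝ e (polyGrad (p S) x) ^ 2 with hI
  have hI0 : 0 ≤ I := Finset.sum_nonneg fun S _ => integral_nonneg fun _ => sq_nonneg _
  -- `L` bounds the derivatives along `e` of all active pieces at `v` on the whole ball, not only on
  -- their own cells; the return path below needs this.
  set L := Real.sqrt (C₁ / h ^ 3 * I) with hL
  have hL0 : 0 ≤ L := Real.sqrt_nonneg _
  have hLsq : L ^ 2 = C₁ / h ^ 3 * I := Real.sq_sqrt (by positivity)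
  have hdir : ∀ S ∈ activeStar D M v, ∀ x ∈ Metric.closedBall v (R * h),
      |polyEval (polyDir e (p S)) x| ≤ L := by
    intro S hS x hx
    have hS' := mem_activeStar.1 hS
    refine Real.abs_le_sqrt ((hsup S hS'.1 _
      ((totalDegree_polyDir_le e _).trans (hp.totalDegree_le S hS'.2)) x hx).trans ?_)
    simp only [polyEval_polyDir]
    gcongr
    exact Finset.single_le_sum (f := fun S => ∫ x in cell S, inner ℝ e (polyGrad (p S) x) ^ 2)
      (fun S _ => integral_nonneg fun _ => sq_nonneg _) hS
  have hT's : T' ∈ activeStar D M v := mem_activeStar.2 ⟨hB.mem_star', hT'⟩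
  -- Two contributions of `Lh`: `q` along the column from `y` in `T` to its end in `T'`, then the
  -- extended piece of `T'` back along the same column to `y`.
  have hw : ∀ y ∈ Y, |polyEval (p T' - p T) y| ≤ 2 * L * h := by
    intro y hy
    obtain ⟨t, ht, htT', hpath⟩ := hB.exists_end y hy
    rw [← hh] at ht
    have hyT := hB.subset hy
    have hball : ∀ s ∈ Set.Icc 0 t, y + s • e ∈ Metric.closedBall v (R * h) := by
      intro s hs
      have h1 := dist_le_diam hyT hvT
      rw [← hh, dist_eq_norm] at h1
      rw [mem_closedBall_iff_norm, add_sub_right_comm]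
      refine (norm_add_le _ _).trans ?_
      rw [norm_smul, hB.norm_eq_one, mul_one, Real.norm_of_nonneg hs.1]
      nlinarith [hs.2, ht.2]
    have hact : ∀ s ∈ Set.Icc 0 t, y + s • e ∈ activeDomain D M := fun s hs =>
      M.mem_activeDomain hΩ (hpath s hs).1 fun S hS hx =>
        mem_active.2 ⟨hS, ((hpath s hs).2 S hS hx).2⟩
    have h0 : (0 : ℝ) ∈ Set.Icc 0 t := Set.left_mem_Icc.2 ht.1
    have ht' : t ∈ Set.Icc 0 t := Set.right_mem_Icc.2 ht.1
    have h1 : |q (y + t • e) - q y| ≤ L * t := by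
      refine hp.abs_sub_le hΩ hq ht.1 (𝒮 := activeStar D M v)
        (fun S hS => (mem_activeStar.1 hS).2) (fun s hs => ⟨(hpath s hs).1, fun S hS hx => ?_⟩)
        fun S hS s hs => hdir S hS _ (hball s hs)
      have := (hpath s hs).2 S hS hx
      exact mem_activeStar.2 ⟨Triangulation.mem_star.2 ⟨hS, this.1⟩, mem_active.2 ⟨hS, this.2⟩⟩
    have hq1 := hp.eq_polyEval T' hT' _ htT' (hact t ht')
    have hq2 := hp.eq_polyEval T hT y hyT (by simpa using hact 0 h0)
    have h2 := abs_polyEval_line_sub_le (p := p T') (fun s hs => hdir T' hT's _ (hball s hs)) h0 ht'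
    rw [zero_smul, add_zero, sub_zero, abs_of_nonneg ht.1] at h2
    rw [hq1, hq2] at h1
    have h3 : polyEval (p T' - p T) y = polyEval (p T') y - polyEval (p T) y := by simp [polyEval]
    have h4 := abs_sub_le (polyEval (p T') y) (polyEval (p T') (y + t • e)) (polyEval (p T) y)
    rw [abs_sub_comm (polyEval (p T') y) (polyEval (p T') (y + t • e))] at h4
    rw [h3]
    have : L * t ≤ L * h := by gcongr; exact ht.2
    linarith
  have hgw : ∀ x ∈ Metric.closedBall v (R * h), ‖polyGrad (p T' - p T) x‖ ≤ 2 * C₂ * L := by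
    intro x hx
    have hdeg : (p T' - p T).totalDegree ≤ k :=
      (MvPolynomial.totalDegree_sub _ _).trans
        (max_le (hp.totalDegree_le _ hT') (hp.totalDegree_le _ hT))
    refine ((H₂ _ hdeg v h hd Y (hB.subset.trans (hsub T hB.mem_star)) ?_ _ hw x hx).2).trans_eq ?_
    · refine le_trans (le_of_eq ?_) hvol
      congr 1; ring
    · field_simp
  have hgT' : ∀ x ∈ Metric.closedBall v (R * h),
      ‖polyGrad (p T') x‖ ^ 2 ≤ C₁ / h ^ 3 * ∫ y in cell T', ‖polyGrad (p T') y‖ ^ 2 := by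
    intro x hx
    simp only [norm_polyGrad_sq]
    have hint : ∀ i, Integrable (fun y => polyEval (MvPolynomial.pderiv i (p T')) y ^ 2)
        (volume.restrict (cell T')) := fun i =>
      integrableOn_cell ((continuous_polyEval (MvPolynomial.pderiv i (p T'))).pow 2) T'
    rw [integral_finsetSum _ fun i _ => hint i, Finset.mul_sum]
    exact Finset.sum_le_sum fun i _ => hsup T' hB.mem_star' _
      ((totalDegree_pderiv_le i _).trans (hp.totalDegree_le _ hT')) x hx
  set E' := ∫ y in cell T', ‖polyGrad (p T') y‖ ^ 2
  have hE' : 0 ≤ E' := integral_nonneg fun _ => sq_nonneg _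
  -- From `|x - y|² ≤ 2|x|² + 2|y|²` with `|y| ≤ 2C₂L`. The powers of `h` cancel against the volume
  -- of `T`.
  set K := 2 * (C₁ / h ^ 3 * E') + 8 * C₂ ^ 2 * (C₁ / h ^ 3 * I) with hK
  have hK0 : 0 ≤ K := by positivity
  have hgT : ∀ x ∈ cell T, ‖polyGrad (p T) x‖ ^ 2 ≤ K := by
    intro x hx
    have hxB := hsub T hB.mem_star hx
    have h1 : polyGrad (p T) x = polyGrad (p T') x - polyGrad (p T' - p T) x := by
      ext i; simp [polyGrad, polyEval]
    have h2 := norm_sub_le (polyGrad (p T') x) (polyGrad (p T' - p T) x)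
    rw [← h1] at h2
    have h3 := hgT' x hxB
    have h4 := hgw x hxB
    rw [hK, ← hLsq]
    have h5 := norm_nonneg (polyGrad (p T' - p T) x)
    have h6 := norm_nonneg (polyGrad (p T) x)
    have h7 : ‖polyGrad (p T' - p T) x‖ ^ 2 ≤ (2 * C₂ * L) ^ 2 := pow_le_pow_left₀ h5 h4 2
    nlinarith [sq_nonneg (‖polyGrad (p T') x‖ - ‖polyGrad (p T' - p T) x‖)]
  have hcellvol : (volume : Measure E3).real (cell T) ≤ ballVol * h ^ 3 := by
    have h1 : cell T ⊆ Metric.closedBall v h := fun x hx => by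
      rw [hh]; exact dist_le_diam hx hvT
    refine (measureReal_mono h1 measure_closedBall_lt_top.ne).trans_eq ?_
    rw [Measure.real, volume_closedBall_eq v hd.le, ENNReal.toReal_ofReal (by positivity)]
  calc ∫ x in cell T, ‖polyGrad (p T) x‖ ^ 2 ≤ ∫ _x in cell T, K :=
        setIntegral_mono_on (integrableOn_cell ((continuous_polyGrad _).norm.pow 2) T)
          (integrableOn_cell continuous_const T) (isCompact_cell T).measurableSet hgT
    _ = (volume : Measure E3).real (cell T) * K := by rw [setIntegral_const, smul_eq_mul]
    _ ≤ ballVol * h ^ 3 * K := by gcongr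
    _ = ballVol * (2 * C₁) * E' + ballVol * (8 * C₂ ^ 2 * C₁) * I := by
        rw [hK]; field_simp
    _ ≤ _ := by
        have h1 : 0 ≤ ballVol * (8 * C₂ ^ 2 * C₁) * E' := by positivity
        have h2 : 0 ≤ ballVol * (2 * C₁) * I := by positivity
        linarith

end TraceFEM

namespace TraceFEM

variable {Ω : Set E3} {M : Triangulation Ω} {σ : ℝ}

/-! ### Integrals over the active mesh -/

theorem interior_cell_ae_eq (T : Finset E3) : (interior (cell T) : Set E3) =ᵐ[volume] cell T :=
  interior_ae_eq_of_null_frontier ((convex_cell T).addHaar_frontier volume)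

theorem interior_cell_subset_activeDomain {D : Set E3} {T : Finset E3} (hT : T ∈ active D M) :
    interior (cell T) ⊆ activeDomain D M :=
  interior_mono (Set.subset_biUnion_of_mem (u := fun T : Finset E3 => cell T) hT)

theorem IsPieces.gradient_eq {D : Set E3} {k : ℕ} {q : E3 → ℝ}
    {p : Finset E3 → MvPolynomial (Fin 3) ℝ} (hp : IsPieces D M k q p) {T : Finset E3}
    (hT : T ∈ active D M) {x : E3} (hx : x ∈ interior (cell T)) :
    gradient q x = polyGrad (p T) x := by
  refine gradient_eq_polyGrad ?_
  filter_upwards [isOpen_interior.mem_nhds hx] with y hy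
  exact hp.eq_polyEval T hT y (interior_subset hy) (interior_cell_subset_activeDomain hT hy)

theorem IsPieces.ae_gradient_eq {D : Set E3} {k : ℕ} {q : E3 → ℝ}
    {p : Finset E3 → MvPolynomial (Fin 3) ℝ} (hp : IsPieces D M k q p) {T : Finset E3}
    (hT : T ∈ active D M) : ∀ᵐ x ∂volume.restrict (cell T), gradient q x = polyGrad (p T) x := by
  rw [← Measure.restrict_congr_set (interior_cell_ae_eq T),
    ae_restrict_iff' isOpen_interior.measurableSet]
  exact Filter.Eventually.of_forall fun x hx => hp.gradient_eq hT hx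

theorem integrableOn_inner_normal_sq (D : Set E3) (p : MvPolynomial (Fin 3) ℝ) (T : Finset E3) :
    IntegrableOn (fun x => inner ℝ (normal D x) (polyGrad p x) ^ 2) (cell T) := by
  have hdom : IntegrableOn (fun x => ‖polyGrad p x‖ ^ 2) (cell T) :=
    integrableOn_cell ((continuous_polyGrad p).norm.pow 2) T
  refine hdom.mono' ?_ (Filter.Eventually.of_forall fun x => ?_)
  · exact (((measurable_normal D).inner (continuous_polyGrad p).measurable).pow_const
      2).aestronglyMeasurable
  · rw [Real.norm_eq_abs, abs_of_nonneg (sq_nonneg _), ← sq_abs]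
    refine pow_le_pow_left₀ (abs_nonneg _) ((abs_real_inner_le_norm _ _).trans ?_) 2
    exact mul_le_of_le_one_left (norm_nonneg _) (norm_normal_le D x)

/-- Cell boundaries are null and cell interiors are disjoint subsets of the active domain, so the
nonnegative integrand is counted at most once. -/
theorem IsPieces.sum_integral_normal_le {D : Set E3} {k : ℕ} {q : E3 → ℝ}
    {p : Finset E3 → MvPolynomial (Fin 3) ℝ} (hp : IsPieces D M k q p) :
    ∑ T ∈ active D M, ∫ x in cell T, inner ℝ (normal D x) (polyGrad (p T) x) ^ 2 ≤
      ∫ x in activeDomain D M,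
        inner ℝ (normal D x) (gradient q x) * inner ℝ (normal D x) (gradient q x) := by
  simp only [← pow_two]
  have hae : ∀ T ∈ active D M, (fun x => inner ℝ (normal D x) (polyGrad (p T) x) ^ 2) =ᵐ[
      volume.restrict (cell T)] fun x => inner ℝ (normal D x) (gradient q x) ^ 2 := by
    intro T hT
    filter_upwards [hp.ae_gradient_eq hT] with x hx
    rw [hx]
  have hint : ∀ T ∈ active D M,
      IntegrableOn (fun x => inner ℝ (normal D x) (gradient q x) ^ 2) (cell T) := fun T hT =>
    (integrableOn_inner_normal_sq D (p T) T).congr (hae T hT)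
  have hintA : IntegrableOn (fun x => inner ℝ (normal D x) (gradient q x) ^ 2)
      (activeDomain D M) := by
    refine IntegrableOn.mono_set ?_ interior_subset
    rw [integrableOn_finset_iUnion]
    exact hint
  calc ∑ T ∈ active D M, ∫ x in cell T, inner ℝ (normal D x) (polyGrad (p T) x) ^ 2
      = ∑ T ∈ active D M, ∫ x in interior (cell T), inner ℝ (normal D x) (gradient q x) ^ 2 := by
        refine Finset.sum_congr rfl fun T hT => ?_
        rw [setIntegral_congr_set (interior_cell_ae_eq T)]
        exact integral_congr_ae (hae T hT)
    _ = ∫ x in ⋃ T ∈ active D M, interior (cell T), inner ℝ (normal D x) (gradient q x) ^ 2 := by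
        rw [integral_biUnion_finset _ fun T _ => isOpen_interior.measurableSet]
        · intro T hT T' hT' hne
          refine Set.disjoint_left.2 fun x hx hx' => hne ?_
          exact Triangulation.eq_of_mem_interior (mem_active.1 hT).1 (mem_active.1 hT').1 hx
            (interior_subset hx')
        · exact fun T hT => (hint T hT).mono_set interior_subset
    _ ≤ _ := by
        refine setIntegral_mono_set hintA (Filter.Eventually.of_forall fun _ => sq_nonneg _) ?_
        have hss : (⋃ T ∈ active D M, interior (cell T)) ⊆ activeDomain D M :=
          Set.iUnion₂_subset fun T hT => interior_cell_subset_activeDomain hT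
        exact hss.eventuallyLE

/-- Write `e = n - (n - e)`, use `(a - b)² ≤ 2a² + 2b²` and `|n - e|² ≤ 4δ`. -/
theorem integral_inner_sq_le {D : Set E3} {δ : ℝ} {e : E3} (p : MvPolynomial (Fin 3) ℝ)
    {T : Finset E3} (h : ∀ᵐ x ∂volume.restrict (cell T), ‖normal D x - e‖ ^ 2 ≤ 4 * δ) :
    ∫ x in cell T, inner ℝ e (polyGrad p x) ^ 2 ≤
      2 * (∫ x in cell T, inner ℝ (normal D x) (polyGrad p x) ^ 2) +
        8 * δ * ∫ x in cell T, ‖polyGrad p x‖ ^ 2 := by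
  have h1 : IntegrableOn (fun x => ‖polyGrad p x‖ ^ 2) (cell T) :=
    integrableOn_cell ((continuous_polyGrad p).norm.pow 2) T
  have h2 := integrableOn_inner_normal_sq D p T
  have h3 : IntegrableOn (fun x => inner ℝ e (polyGrad p x) ^ 2) (cell T) :=
    integrableOn_cell ((continuous_const.inner (continuous_polyGrad p)).pow 2) T
  rw [← integral_const_mul, ← integral_const_mul,
    ← integral_add (h2.const_mul 2) (h1.const_mul (8 * δ))]
  refine integral_mono_ae h3 ((h2.const_mul 2).add (h1.const_mul (8 * δ))) ?_
  filter_upwards [h] with x hx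
  have h4 : inner ℝ e (polyGrad p x) = inner ℝ (normal D x) (polyGrad p x) -
      inner ℝ (normal D x - e) (polyGrad p x) := by
    rw [inner_sub_left]; ring
  have h5 : inner ℝ (normal D x - e) (polyGrad p x) ^ 2 ≤ 4 * δ * ‖polyGrad p x‖ ^ 2 := by
    rw [← sq_abs]
    calc |inner ℝ (normal D x - e) (polyGrad p x)| ^ 2
        ≤ (‖normal D x - e‖ * ‖polyGrad p x‖) ^ 2 :=
          pow_le_pow_left₀ (abs_nonneg _) (abs_real_inner_le_norm _ _) 2
      _ = ‖normal D x - e‖ ^ 2 * ‖polyGrad p x‖ ^ 2 := mul_pow _ _ _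
      _ ≤ _ := by gcongr
  simp only [h4]
  nlinarith [sq_nonneg (inner ℝ (normal D x) (polyGrad p x) +
    inner ℝ (normal D x - e) (polyGrad p x))]

/-! ### Summation over the mesh -/

open Classical in
/-- The tetrahedra in `𝒮` that have a common vertex with `T`. -/
noncomputable def neighbors (𝒮 : Finset (Finset E3)) (T : Finset E3) : Finset (Finset E3) :=
  𝒮.filter fun T' => ∃ v ∈ T, v ∈ T'

theorem mem_neighbors {𝒮 : Finset (Finset E3)} {T T' : Finset E3} :
    T' ∈ neighbors 𝒮 T ↔ T' ∈ 𝒮 ∧ ∃ v ∈ T, v ∈ T' := by simp [neighbors]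

/-- Exchange the sums: each `T'` has four vertices with at most `σ³` tetrahedra each, and diameters
of neighbours differ at most by the factor `1 / sizeRatio σ`. -/
theorem ShapeRegular.sum_neighbors_le (hM : ShapeRegular σ M) (hσ : 2 ≤ σ) (hΩ : IsOpen Ω)
    {A 𝒮 : Finset (Finset E3)} (hA : A ⊆ M.tets) (h𝒮 : 𝒮 ⊆ M.tets)
    (hAΩ : ∀ T ∈ A, ∀ v ∈ T, v ∈ Ω) {G : Finset E3 → ℝ} (hG : ∀ T, 0 ≤ G T) :
    ∑ T ∈ A, diam T * ∑ T' ∈ neighbors 𝒮 T, G T' ≤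
      4 * σ ^ 3 / sizeRatio σ * ∑ T' ∈ 𝒮, diam T' * G T' := by
  classical
  have hσ0 : 0 < σ := by linarith
  have ha := sizeRatio_pos hσ0
  have h1 : ∀ T ∈ A, diam T * ∑ T' ∈ neighbors 𝒮 T, G T' =
      ∑ T' ∈ 𝒮, if ∃ v ∈ T, v ∈ T' then diam T * G T' else 0 := by
    intro T _
    rw [neighbors, Finset.mul_sum, Finset.sum_filter]
  rw [Finset.sum_congr rfl h1, Finset.sum_comm, Finset.mul_sum]
  refine Finset.sum_le_sum fun T' hT' => ?_
  rw [← Finset.sum_filter]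
  have h2 : ∀ T ∈ A.filter fun T => ∃ v ∈ T, v ∈ T',
      diam T * G T' ≤ diam T' / sizeRatio σ * G T' := by
    intro T hT
    obtain ⟨hTA, v, hvT, hvT'⟩ := Finset.mem_filter.1 hT
    refine mul_le_mul_of_nonneg_right ?_ (hG T')
    rw [le_div_iff₀ ha, mul_comm]
    exact hM.sizeRatio_mul_diam_le hσ hΩ (hAΩ T hTA v hvT)
      (Triangulation.mem_star.2 ⟨hA hTA, hvT⟩) (Triangulation.mem_star.2 ⟨h𝒮 hT', hvT'⟩)
  have h3 : ((A.filter fun T => ∃ v ∈ T, v ∈ T').card : ℝ) ≤ 4 * σ ^ 3 := by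
    have hsub : (A.filter fun T => ∃ v ∈ T, v ∈ T') ⊆ T'.biUnion fun v => M.star v := by
      intro T hT
      obtain ⟨hTA, v, hvT, hvT'⟩ := Finset.mem_filter.1 hT
      exact Finset.mem_biUnion.2 ⟨v, hvT', Triangulation.mem_star.2 ⟨hA hTA, hvT⟩⟩
    have h4 : ((A.filter fun T => ∃ v ∈ T, v ∈ T').card : ℝ) ≤
        ∑ v ∈ T', ((M.star v).card : ℝ) := by
      exact_mod_cast (Finset.card_le_card hsub).trans Finset.card_biUnion_le
    refine h4.trans ((Finset.sum_le_card_nsmul _ _ _ fun v _ => hM.card_star_le hσ0 v).trans ?_)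
    rw [((M.mem_tets T').1 (h𝒮 hT')).2, nsmul_eq_mul]
    norm_num
  have hd := Triangulation.diam_pos (h𝒮 hT')
  have h5 : 0 ≤ diam T' / sizeRatio σ * G T' := mul_nonneg (by positivity) (hG T')
  calc _ ≤ (A.filter fun T => ∃ v ∈ T, v ∈ T').card • (diam T' / sizeRatio σ * G T') :=
        Finset.sum_le_card_nsmul _ _ _ h2
    _ ≤ 4 * σ ^ 3 * (diam T' / sizeRatio σ * G T') := by
        rw [nsmul_eq_mul]; gcongr
    _ = _ := by ring

theorem diam_le_meshSize {D : Set E3} {T : Finset E3} (hT : T ∈ active D M) :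
    diam T ≤ meshSize D M :=
  le_csSup ((active D M).finite_toSet.image _).bddAbove ⟨T, hT, rfl⟩

theorem meshSize_nonneg (D : Set E3) (M : Triangulation Ω) : 0 ≤ meshSize D M := by
  refine Real.sSup_nonneg ?_
  rintro _ ⟨T, _, rfl⟩
  exact Metric.diam_nonneg

/-! ### From the local to the global gradient estimate -/

/-- The gradient on an active tetrahedron is controlled by the gradients on the neighboring regular
tetrahedra and by the normal derivatives on all active neighbors. -/
theorem exists_local_estimate (hσ : 2 ≤ σ) (k : ℕ) : ∃ C > 0, ∀ {Ω : Set E3}, IsOpen Ω →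
    ∀ {M : Triangulation Ω}, ShapeRegular σ M → ∀ {D : Set E3}, IsOpen D → IsCompact (frontier D) →
    ∀ {chat : ℝ}, 0 < chat → chat ≤ areaThreshold σ → ∀ {q : E3 → ℝ}
      {p : Finset E3 → MvPolynomial (Fin 3) ℝ}, IsPieces D M k q p →
      ContinuousOn q (activeDomain D M) →
    ∀ {δ r : ℝ}, 0 < δ → δ < 1 / 2 → δ < columnRadius σ / (32 * σ) → 4 * meshSize D M < r →
    ∀ {x₀ ν : E3}, FlatAt D δ r x₀ ν → x₀ ∈ frontier D →
      Metric.closedBall x₀ (2 * meshSize D M) ⊆ Ω →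
    ∀ {T : Finset E3}, T ∈ active D M → x₀ ∈ cell T →
      ∫ x in cell T, ‖polyGrad (p T) x‖ ^ 2 ≤
        C * ((∑ T' ∈ neighbors (regular D chat M) T, ∫ x in cell T', ‖polyGrad (p T') x‖ ^ 2) +
          ∑ S ∈ neighbors (active D M) T,
            (2 * (∫ x in cell S, inner ℝ (normal D x) (polyGrad (p S) x) ^ 2) +
              8 * δ * ∫ x in cell S, ‖polyGrad (p S) x‖ ^ 2)) := by
  classical
  obtain ⟨C, hC, H⟩ := exists_gradient_transfer hσ k
  -- The extra 1 covers the case that `T` is regular, hence among its own regular neighbours.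
  refine ⟨C + 1, by positivity, ?_⟩
  intro Ω hΩ M hM D hD hΓ chat hchat hchat' q p hp hq δ r hδ hδ2 hδσ hr x₀ ν hflat hx₀ hxΩ T hT hx₀T
  have hTt := (mem_active.1 hT).1
  have hE : ∀ S, 0 ≤ ∫ x in cell S, ‖polyGrad (p S) x‖ ^ 2 := fun S =>
    integral_nonneg fun _ => sq_nonneg _
  have hN : ∀ S, 0 ≤ ∫ x in cell S, inner ℝ (normal D x) (polyGrad (p S) x) ^ 2 := fun S =>
    integral_nonneg fun _ => sq_nonneg _
  have hdT := diam_le_meshSize hT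
  have hd0 := Triangulation.diam_pos hTt
  have hsum0 : 0 ≤ ∑ S ∈ neighbors (active D M) T,
      (2 * (∫ x in cell S, inner ℝ (normal D x) (polyGrad (p S) x) ^ 2) +
        8 * δ * ∫ x in cell S, ‖polyGrad (p S) x‖ ^ 2) :=
    Finset.sum_nonneg fun S _ => by have := hE S; have := hN S; positivity
  have hreg : ∀ T' ∈ neighbors (regular D chat M) T, ∫ x in cell T', ‖polyGrad (p T') x‖ ^ 2 ≤
      ∑ T' ∈ neighbors (regular D chat M) T, ∫ x in cell T', ‖polyGrad (p T') x‖ ^ 2 :=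
    fun T' hT' => Finset.single_le_sum
      (f := fun T' => ∫ x in cell T', ‖polyGrad (p T') x‖ ^ 2) (fun S _ => hE S) hT'
  have hreg0 : 0 ≤ ∑ T' ∈ neighbors (regular D chat M) T, ∫ x in cell T', ‖polyGrad (p T') x‖ ^ 2 :=
    Finset.sum_nonneg fun S _ => hE S
  rcases hM.regular_or_exists_bundle hσ hΩ hchat hchat' hflat hδ hδσ hTt hx₀ hx₀T
    (by linarith) ((Metric.closedBall_subset_closedBall (by linarith)).trans hxΩ) with
    hTr | ⟨T', hT'r, v, e, Y, he, hB, hvol⟩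
  · obtain ⟨v, hv⟩ : T.Nonempty := by
      rw [← Finset.card_pos, ((M.mem_tets T).1 hTt).2]; norm_num
    have h1 := hreg T (mem_neighbors.2 ⟨hTr, v, hv, hv⟩)
    have h2 := mul_nonneg hC.le (add_nonneg hreg0 hsum0)
    linarith
  · have hvT := (Triangulation.mem_star.1 hB.mem_star).2
    have hvT' := (Triangulation.mem_star.1 hB.mem_star').2
    have hvΩ : v ∈ Ω := hxΩ (by
      rw [Metric.mem_closedBall]
      linarith [dist_le_diam (subset_cell T hvT) hx₀T])
    have h1 := H hΩ hM hp hq hT (mem_regular.1 hT'r).1 hvΩ hB hvol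
    have h2 := hreg T' (mem_neighbors.2 ⟨hT'r, v, hvT, hvT'⟩)
    have h3 : ∑ S ∈ activeStar D M v, ∫ x in cell S, inner ℝ e (polyGrad (p S) x) ^ 2 ≤
        ∑ S ∈ neighbors (active D M) T,
          (2 * (∫ x in cell S, inner ℝ (normal D x) (polyGrad (p S) x) ^ 2) +
            8 * δ * ∫ x in cell S, ‖polyGrad (p S) x‖ ^ 2) := by
      refine le_trans (Finset.sum_le_sum fun S hS => ?_) (Finset.sum_le_sum_of_subset_of_nonneg
        (s := activeStar D M v) (fun S hS => ?_)
        fun S _ _ => by have := hE S; have := hN S; positivity)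
      · have hS' := mem_activeStar.1 hS
        have he2 : ∀ x, inner ℝ e (polyGrad (p S) x) ^ 2 = inner ℝ ν (polyGrad (p S) x) ^ 2 := by
          rcases he with rfl | rfl
          · exact fun _ => rfl
          · intro x; rw [inner_neg_left, neg_sq]
        simp only [he2]
        refine integral_inner_sq_le (p S) ?_
        rw [ae_restrict_iff' (isCompact_cell S).measurableSet]
        filter_upwards [hflat.ae_norm_normal_sub_sq_le hδ hδ2 hD hΓ hx₀] with x hx hxS
        apply hx
        have h4 := dist_le_diam hxS (subset_cell S (Triangulation.mem_star.1 hS'.1).2)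
        have h5 := dist_le_diam (subset_cell T hvT) hx₀T
        have h6 := diam_le_meshSize hS'.2
        have h7 := dist_triangle x v x₀
        linarith
      · have hS' := mem_activeStar.1 hS
        exact mem_neighbors.2 ⟨hS'.2, v, hvT, (Triangulation.mem_star.1 hS'.1).2⟩
    have h4 : C * ((∫ x in cell T', ‖polyGrad (p T') x‖ ^ 2) +
        ∑ S ∈ activeStar D M v, ∫ x in cell S, inner ℝ e (polyGrad (p S) x) ^ 2) ≤
        C * ((∑ T' ∈ neighbors (regular D chat M) T, ∫ x in cell T', ‖polyGrad (p T') x‖ ^ 2) +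
          ∑ S ∈ neighbors (active D M) T,
            (2 * (∫ x in cell S, inner ℝ (normal D x) (polyGrad (p S) x) ^ 2) +
              8 * δ * ∫ x in cell S, ‖polyGrad (p S) x‖ ^ 2)) := by gcongr
    linarith

/-- On sufficiently fine meshes, the gradients of finite element functions on all active tetrahedra
are controlled by those on the regular ones and by the normal derivative. -/
theorem exists_gradient_estimate (hσ : 2 ≤ σ) {chat : ℝ} (hchat : 0 < chat)
    (hchat' : chat ≤ areaThreshold σ) {D Ω : Set E3} (hD : IsC2Domain D) (hΩ : IsOpen Ω)
    (hDΩ : frontier D ⊆ Ω) (k : ℕ) : ∃ K > 0, ∃ h₀ > 0, ∀ M : Triangulation Ω, ShapeRegular σ M →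
      meshSize D M ≤ h₀ → ∀ q, IsFE D M k q →
      ∑ T ∈ active D M, diam T * ∫ x in cell T, ‖gradient q x‖ ^ 2 ≤
        K * ((∑ T ∈ regular D chat M, diam T * ∫ x in cell T, ‖gradient q x‖ ^ 2) +
          meshSize D M * ∫ x in activeDomain D M,
            inner ℝ (normal D x) (gradient q x) * inner ℝ (normal D x) (gradient q x)) := by
  have hσ0 : 0 < σ := by linarith
  have ha := sizeRatio_pos hσ0
  have hc := columnRadius_pos hσ0
  obtain ⟨C, hC, H⟩ := exists_local_estimate hσ k
  obtain ⟨K, hK⟩ : ∃ K, K = C * (4 * σ ^ 3 / sizeRatio σ) := ⟨_, rfl⟩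
  have hK0 : 0 < K := by rw [hK]; positivity
  -- `K` does not depend on `δ`, so `δ` can be chosen afterwards to make the gradient error at most
  -- half of the left-hand side. The flatness radius, and with it `h₀`, depends on this `δ`.
  obtain ⟨δ, hδ, hδ1, hδ2, hδ3⟩ : ∃ δ > 0, δ < 1 / 2 ∧ δ < columnRadius σ / (32 * σ) ∧
      8 * K * δ ≤ 1 / 2 := by
    refine ⟨min (1 / 4) (min (columnRadius σ / (32 * σ) / 2) (1 / (16 * K))), by positivity,
      ?_, ?_, ?_⟩
    · exact (min_le_left _ _).trans_lt (by norm_num)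
    · exact ((min_le_right _ _).trans (min_le_left _ _)).trans_lt (half_lt_self (by positivity))
    · have h1 : min (1 / 4) (min (columnRadius σ / (32 * σ) / 2) (1 / (16 * K))) ≤ 1 / (16 * K) :=
        (min_le_right _ _).trans (min_le_right _ _)
      calc _ ≤ 8 * K * (1 / (16 * K)) := by gcongr
        _ = 1 / 2 := by field_simp; norm_num
  obtain ⟨r, hr, hflat⟩ := hD.exists_flatAt hδ
  obtain ⟨s, hs, hsΩ⟩ := hD.isCompact_frontier.exists_thickening_subset_open hΩ hDΩ
  -- Absorbing `W/2` in `W ≤ K(B + 2hI) + W/2` gives `W ≤ 2KB + 4KhI`. The two bounds on `h` give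
  -- flatness on neighbourhoods of active elements and keep these inside `Ω`.
  refine ⟨4 * K, by positivity, min (r / 8) (s / 4), by positivity, fun M hM hh q hq => ?_⟩
  have hhr : 4 * meshSize D M < r := by linarith [hh.trans (min_le_left _ _)]
  have hhs : 2 * meshSize D M < s := by linarith [hh.trans (min_le_right _ _)]
  have hball : ∀ x ∈ frontier D, Metric.closedBall x (2 * meshSize D M) ⊆ Ω := fun x hx y hy =>
    hsΩ (Metric.mem_thickening_iff.2 ⟨x, hx, (Metric.mem_closedBall.1 hy).trans_lt hhs⟩)
  obtain ⟨p, hp⟩ := hq.exists_isPieces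
  have hgrad : ∀ T ∈ active D M, ∫ x in cell T, ‖gradient q x‖ ^ 2 =
      ∫ x in cell T, ‖polyGrad (p T) x‖ ^ 2 := by
    intro T hT
    refine integral_congr_ae ?_
    filter_upwards [hp.ae_gradient_eq hT] with x hx
    rw [hx]
  have hra : regular D chat M ⊆ active D M := fun T hT => (mem_regular.1 hT).1
  have hat : active D M ⊆ M.tets := fun T hT => (mem_active.1 hT).1
  rw [Finset.sum_congr rfl fun T hT => by rw [hgrad T hT],
    Finset.sum_congr (s₁ := regular D chat M) rfl fun T hT => by rw [hgrad T (hra hT)]]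
  set E : Finset E3 → ℝ := fun T => ∫ x in cell T, ‖polyGrad (p T) x‖ ^ 2 with hE
  set N : Finset E3 → ℝ := fun T => ∫ x in cell T, inner ℝ (normal D x) (polyGrad (p T) x) ^ 2
    with hN
  have hE0 : ∀ T, 0 ≤ E T := fun S => integral_nonneg fun _ => sq_nonneg _
  have hN0 : ∀ T, 0 ≤ N T := fun S => integral_nonneg fun _ => sq_nonneg _
  have hG0 : ∀ T, 0 ≤ 2 * N T + 8 * δ * E T := fun T => by
    have := hE0 T; have := hN0 T; positivity
  have hAΩ : ∀ T ∈ active D M, ∀ v ∈ T, v ∈ Ω := by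
    intro T hT v hv
    obtain ⟨x, hx, hxT⟩ := (mem_active.1 hT).2
    refine hball x hx ?_
    have h1 := diam_le_meshSize hT
    have h2 := meshSize_nonneg D M
    rw [Metric.mem_closedBall]
    linarith [dist_le_diam (subset_cell T hv) hxT]
  have hloc : ∀ T ∈ active D M, E T ≤ C * ((∑ T' ∈ neighbors (regular D chat M) T, E T') +
      ∑ S ∈ neighbors (active D M) T, (2 * N S + 8 * δ * E S)) := by
    intro T hT
    obtain ⟨x, hx, hxT⟩ := (mem_active.1 hT).2
    obtain ⟨ν, hν⟩ := hflat x hx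
    exact H hΩ hM hD.isOpen hD.isCompact_frontier hchat hchat' hp hq.1 hδ hδ1 hδ2 hhr hν hx
      (hball x hx) hT hxT
  have hsum1 := hM.sum_neighbors_le hσ hΩ hat (hra.trans hat) hAΩ hE0
  have hsum2 := hM.sum_neighbors_le hσ hΩ hat hat hAΩ hG0
  set W := ∑ T ∈ active D M, diam T * E T with hW
  set B := ∑ T ∈ regular D chat M, diam T * E T with hB
  set I := ∫ x in activeDomain D M,
    inner ℝ (normal D x) (gradient q x) * inner ℝ (normal D x) (gradient q x) with hI
  have hNsum : ∑ T ∈ active D M, diam T * N T ≤ meshSize D M * I := by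
    calc ∑ T ∈ active D M, diam T * N T ≤ ∑ T ∈ active D M, meshSize D M * N T :=
          Finset.sum_le_sum fun T hT => mul_le_mul_of_nonneg_right (diam_le_meshSize hT) (hN0 T)
      _ = meshSize D M * ∑ T ∈ active D M, N T := (Finset.mul_sum _ _ _).symm
      _ ≤ _ := mul_le_mul_of_nonneg_left hp.sum_integral_normal_le (meshSize_nonneg D M)
  have hsplit : ∑ T ∈ active D M, diam T * (2 * N T + 8 * δ * E T) =
      2 * (∑ T ∈ active D M, diam T * N T) + 8 * δ * W := by
    rw [hW, Finset.mul_sum, Finset.mul_sum, ← Finset.sum_add_distrib]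
    exact Finset.sum_congr rfl fun T _ => by ring
  rw [hsplit] at hsum2
  have hWle : W ≤ K * (B + 2 * (∑ T ∈ active D M, diam T * N T) + 8 * δ * W) := by
    calc W ≤ ∑ T ∈ active D M, (C * (diam T * ∑ T' ∈ neighbors (regular D chat M) T, E T') +
          C * (diam T * ∑ S ∈ neighbors (active D M) T, (2 * N S + 8 * δ * E S))) := by
          refine Finset.sum_le_sum fun T hT => ?_
          refine (mul_le_mul_of_nonneg_left (hloc T hT)
            (Triangulation.diam_pos (hat hT)).le).trans_eq ?_
          ring
      _ = C * (∑ T ∈ active D M, diam T * ∑ T' ∈ neighbors (regular D chat M) T, E T') +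
          C * ∑ T ∈ active D M, diam T *
            ∑ S ∈ neighbors (active D M) T, (2 * N S + 8 * δ * E S) := by
          rw [Finset.sum_add_distrib, Finset.mul_sum, Finset.mul_sum]
      _ ≤ C * (4 * σ ^ 3 / sizeRatio σ * B) + C * (4 * σ ^ 3 / sizeRatio σ *
          (2 * (∑ T ∈ active D M, diam T * N T) + 8 * δ * W)) := by gcongr
      _ = _ := by rw [hK]; ring
  have hW0 : 0 ≤ W := Finset.sum_nonneg fun T hT =>
    mul_nonneg (Triangulation.diam_pos (hat hT)).le (hE0 T)
  have h1 : 8 * K * δ * W ≤ 1 / 2 * W := by gcongr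
  have h2 : K * (∑ T ∈ active D M, diam T * N T) ≤ K * (meshSize D M * I) := by gcongr
  have h3 : 0 ≤ B := Finset.sum_nonneg fun T hT =>
    mul_nonneg (Triangulation.diam_pos (hat (hra hT))).le (hE0 T)
  have h4 : 0 ≤ K * B := by positivity
  nlinarith

/-! ### The two inf-sup conditions -/

/-- The zero velocity has quotient `0`. Nonnegativity lets the stabilization term be absorbed by
enlarging the constant in front of the supremum. -/
theorem IsLUB.nonneg_of_quotients {D : Set E3} {k : ℕ} {cτ ρu S : ℝ} {q : E3 → ℝ}
    (h : IsLUB (quotients D M k cτ ρu q) S) : 0 ≤ S := by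
  refine h.1 ⟨fun _ => 0, fun i => ⟨?_, fun T _ => ⟨0, by simp, fun x _ => by simp⟩⟩, ?_⟩
  · simpa using continuousOn_const
  · have h1 : tangPart D (fun _ => (0 : E3)) = fun _ => 0 := by
      funext x
      simp [tangPart, normalPart]
    have h2 : formB D (fun _ => (0 : E3)) q = 0 := by
      unfold formB
      rw [h1]
      have h3 : ∀ x, jac (fun _ => (0 : E3)) x = 0 := fun x => by
        ext i j
        simp [jac]
      simp [surfDiv, covGrad, h3]
    simp only [h2, zero_div]

end TraceFEM

open TraceFEM in
theorem lemma4p7 (σ : ℝ) (hσ : 0 < σ) :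
    -- the threshold `ĉ` has to be small, depending only on shape regularity
    ∃ chat₀ > 0, ∀ chat : ℝ, 0 < chat → chat ≤ chat₀ →
    ∀ (D Ω : Set E3), IsC2Domain D → IsOpen Ω → Bornology.IsBounded Ω → frontier D ⊆ Ω →
    ∀ (k : ℕ), 1 ≤ k →
    ∀ (Cqu Cres cτ cp cu Cu : ℝ), 0 < cτ → 0 < cp → 0 < cu → 0 < Cu →
    ∃ h₀ > 0,
      -- for every family of meshes (of size at most `h₀`) and of stabilization parameters
      ∀ (ι : Type) (M : ι → Triangulation Ω) (ρu : ι → ℝ),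
        (∀ i, ShapeRegular σ (M i) ∧ QuasiUniform D Cqu (M i) ∧ Resolves D Cres (M i) ∧
          meshSize D (M i) ≤ h₀ ∧
          ρu i ∈ Set.Icc (cu * meshSize D (M i)) (Cu * (meshSize D (M i))⁻¹)) →
        ((∃ c > 0, ∀ i, LBB2 D (M i) k cτ cp (ρu i) c) ↔
          (∃ c > 0, ∀ i, LBB3 D chat (M i) k cτ cp (ρu i) c)) := by
  -- Shape regularity weakens as `σ` grows, and `σ ≥ 2` keeps `sizeRatio` at most 1 and the star
  -- radii small.
  have hσ' : 2 ≤ max σ 2 := le_max_right _ _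
  refine ⟨areaThreshold (max σ 2), areaThreshold_pos (by linarith), ?_⟩
  intro chat hchat hchat' D Ω hD hΩ _ hDΩ k _ Cqu Cres cτ cp cu Cu _ hcp _ _
  obtain ⟨K, hK, h₀, hh₀, H⟩ := exists_gradient_estimate hσ' hchat hchat' hD hΩ hDΩ k
  refine ⟨h₀, hh₀, fun ι M ρu hM => ⟨?_, ?_⟩⟩
  · rintro ⟨c, hc, h⟩
    refine ⟨c, hc, fun i q hq => ?_⟩
    obtain ⟨S, hS, hle⟩ := h i q hq
    refine ⟨S, hS, le_trans (Real.sqrt_le_sqrt ?_) hle⟩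
    refine Finset.sum_le_sum_of_subset_of_nonneg (fun T hT => (mem_regular.1 hT).1) fun T _ _ =>
      mul_nonneg Metric.diam_nonneg (integral_nonneg fun _ => sq_nonneg _)
  · rintro ⟨c, hc, h⟩
    -- The factor `1 + 1/cp` converts `h ∫ (n·∇q)²` into `s_h(q,q)`; the `+ 1` takes up the
    -- stabilization term left beside the regular seminorm.
    refine ⟨Real.sqrt (K * (1 + 1 / cp)) * (c + 1), by positivity, fun i q hq => ?_⟩
    obtain ⟨S, hS, hle⟩ := h i q hq
    refine ⟨S, hS, ?_⟩
    have hS0 := IsLUB.nonneg_of_quotients hS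
    obtain ⟨hreg, -, -, hmesh, -⟩ := hM i
    have hest := H (M i) (hreg.mono hσ (le_max_left _ _)) hmesh q hq.1
    set I := ∫ x in activeDomain D (M i),
      inner ℝ (normal D x) (gradient q x) * inner ℝ (normal D x) (gradient q x) with hI
    have hI0 : 0 ≤ I := integral_nonneg fun x => mul_self_nonneg _
    have hm0 := meshSize_nonneg D (M i)
    set B := ∑ T ∈ regular D chat (M i), diam T * ∫ x in cell T, ‖gradient q x‖ ^ 2 with hB
    have hB0 : 0 ≤ B := Finset.sum_nonneg fun T _ =>
      mul_nonneg Metric.diam_nonneg (integral_nonneg fun _ => sq_nonneg _)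
    have hform : formS D (M i) cp q q = cp * meshSize D (M i) * I := rfl
    have hform0 : 0 ≤ formS D (M i) cp q q := by rw [hform]; positivity
    have hBreg : normOneReg D chat (M i) q = Real.sqrt B := rfl
    have h1 : normOneH D (M i) q ≤ Real.sqrt (K * (1 + 1 / cp)) *
        (normOneReg D chat (M i) q + Real.sqrt (formS D (M i) cp q q)) := by
      have h2 : K * (B + meshSize D (M i) * I) ≤
          K * (1 + 1 / cp) * (B + formS D (M i) cp q q) := by
        have h3 : meshSize D (M i) * I = 1 / cp * formS D (M i) cp q q := by
          rw [hform]; field_simp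
        rw [h3, mul_assoc]
        gcongr
        have : 0 ≤ 1 / cp * B := by positivity
        nlinarith
      calc normOneH D (M i) q ≤ Real.sqrt (K * (1 + 1 / cp) * (B + formS D (M i) cp q q)) :=
            Real.sqrt_le_sqrt (hest.trans h2)
        _ = Real.sqrt (K * (1 + 1 / cp)) * Real.sqrt (B + formS D (M i) cp q q) :=
            Real.sqrt_mul (by positivity) _
        _ ≤ _ := by
            rw [hBreg]
            gcongr
            refine Real.sqrt_le_iff.2 ⟨by positivity, ?_⟩
            have h5 := Real.sq_sqrt hB0
            have h6 := Real.sq_sqrt hform0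
            have h7 := mul_nonneg (Real.sqrt_nonneg B) (Real.sqrt_nonneg (formS D (M i) cp q q))
            nlinarith
    refine h1.trans ?_
    rw [mul_assoc]
    gcongr
    have h4 := Real.sqrt_nonneg (formS D (M i) cp q q)
    linarith
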